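/- **Setting.** Let $\Gamma=\mathbb Z^D$ with the graph metric $\mathrm{dist}$, with a finite-dimensional Hilbert space $\mathcal H_x$ at each site and $\mathcal H_Z=\bigotimes_{x\in Z}\mathcal H_x$ for finite $Z\subset\Gamma$; let $b_u(N)$ be the ball of radius $N$ around $u$. A *Lindbladian* is a generator of a semigroup of completely positive, trace preserving maps. A *uniform family* consists of Lindbladians $\mathcal M_Z$ acting on $\mathcal H_Z$, for all finite $Z\subset\Gamma$, and of a Lindbladian $\mathcal B^{\partial\Lambda}=\sum_{j\ge1}\mathcal B^{\partial\Lambda}_j$ for every ball $\Lambda$, with $\mathcal B^{\partial\Lambda}_j$ supported in $\{x\in\Lambda:\mathrm{dist}(x,\Gamma\setminus\Lambda)\le j\}$. Put $T_t^{\bar\Lambda}=\exp\bigl(t(\sum_{Z\subset\Lambda}\mathcal M_Z+\mathcal B^{\partial\Lambda})\bigr)$, and let $T_\infty^{\bar\Lambda}=\lim_N\frac1N\sum_{m\le N}T_m^{\bar\Lambda}$. Let $\nu:[0,\infty)\to(0,\infty)$ be increasing with $\nu(x+y)\le\nu(x)\nu(y)$, let $P$ be a real polynomial, and $v,c,\gamma,\delta>0$.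 We assume 1. (locality) $\sum_{Z\ni x}\|\mathcal M_Z\|_\diamond\,|Z|\,\nu(\mathrm{diam}\,Z)\le v$ for all $x\in\Gamma$, and $\nu(r)\sum_{j\ge r}\|\mathcal B_j^{\partial b_u(N)}\|_\diamond\le P(N)$ for all $u\in\Gamma$ and $N,r\ge0$; 2. (rapid mixing) $\sup_\rho\|T_t^{\bar\Lambda}(\rho)-T_\infty^{\bar\Lambda}(\rho)\|_1\le c|\Lambda|^{\delta}e^{-\gamma t}$ for all balls $\Lambda$ and $t\ge0$, the supremum being over all states $\rho$; 3. for each ball $\Lambda$, $T_t^{\bar\Lambda}$ has a unique fixed point among the states and no other periodic points. For a state $\rho$ on $\mathcal H_\Lambda$ and disjoint $A,B\subset\Lambda$ let $T(A:B)=\|\rho_{AB}-\rho_A\otimes\rho_B\|_1$ and $I(A:B)=S(\rho_A)+S(\rho_B)-S(\rho_{AB})$ with $S(\rho)=-\mathrm{tr}(\rho\log_2\rho)$. Let $h_b(x)=-x\log_2x-(1-x)\log_2(1-x)$. **Theorem (decay of correlations).** Let $\kappa>0$. There are $\delta',\beta>0$ and $k\ge0$, depending only on $D,\kappa,v,c,\gamma,\delta,P$,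 such that for every $\nu$ as above with $(1+r)^k\nu(r)^{-\beta}\to0$ as $r\to\infty$ there is a fast-decaying function $\Delta_0$, depending only on these data and $\nu$, with the following property. Let a uniform family satisfy 1–3, let $\Lambda=b_u(L)$ be a ball and $\rho_\infty$ the fixed point of $T^{\bar\Lambda}_t$, and let $A,B\subset\Lambda$ be nonempty with $d_{AB}=\mathrm{dist}(A,B)>0$, lying away from the boundary of $\Lambda$ in the sense that $\mathrm{dist}(A\cup B,\Gamma\setminus\Lambda)\ge\kappa\,(d_{AB}+L^{\kappa})$. Then, in the state $\rho_\infty$, $$T(A:B)\le\varepsilon:=3\,(|A|+|B|)^{\delta'}\,\Delta_0\!\left(\tfrac{d_{AB}}2\right).$$ Moreover $I(A:B)\le 6\,T(A:B)\log_2\dim\mathcal H_A+4h_b(T(A:B))$ if $T(A:B)<1$; consequently $I(A:B)\le6\,\varepsilon\log_2\dim\mathcal H_A+4h_b(\varepsilon)$ if $\varepsilon\le\frac12$, so that the mutual information decays at essentially the same rate. Here *fast-decaying* means that $\Delta_0\ge 0$ is nonincreasing on $[0,\infty)$, tends to $0$, and is at most a constant times $\sup_{r\ge s}(1+r)^k\nu(r)^{-\beta}$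 at $s$. In particular it is in the same class as $\nu^{-1}$: if $\nu(r)\ge a e^{\mu r}$ with $a,\mu>0$ then $\Delta_0(s)\le Ke^{-\mu's}$ for some $K$ and $\mu'>0$, and if $\nu(r)\ge a(1+r)^p$ with $a,p>0$ then $\Delta_0(s)\le K(1+s)^{-(\beta p-k)}$ for some $K$. -/

import Mathlib

open Filter Topology
open scoped ComplexOrder

noncomputable section

namespace DissipativeLattice

/-! ### The lattice `ℤ^D` with its graph metric -/

/-- Sites of the lattice `Γ = ℤ^D`. -/
abbrev Site (D : ℕ) : Type := Fin D → ℤ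

/-- The graph (i.e. `ℓ¹`) metric on `ℤ^D`. -/
def gdist {D : ℕ} (x y : Site D) : ℕ := ∑ i, (x i - y i).natAbs

/-- The ball `b_u(N) = {x : dist(u, x) ≤ N}`; see `mem_ball`. -/
def ball {D : ℕ} (u : Site D) (N : ℕ) : Finset (Site D) :=
  (Finset.Icc (fun i => u i - (N : ℤ)) (fun i => u i + (N : ℤ))).filter (fun x => gdist u x ≤ N)

theorem mem_ball {D : ℕ} {u x : Site D} {N : ℕ} : x ∈ ball u N ↔ gdist u x ≤ N := by
  unfold ball
  rw [Finset.mem_filter, and_iff_right_iff_imp]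
  intro h
  have key : ∀ i, (u i - x i).natAbs ≤ N := fun i =>
    (Finset.single_le_sum (f := fun i => (u i - x i).natAbs) (fun _ _ => Nat.zero_le _)
      (Finset.mem_univ i)).trans h
  rw [Finset.mem_Icc]
  refine ⟨fun i => ?_, fun i => ?_⟩ <;> have := key i <;> simp only <;> omega

/-- The diameter of a finite region. -/
def diam {D : ℕ} (Z : Finset (Site D)) : ℕ := (Z ×ˢ Z).sup (fun p => gdist p.1 p.2)

/-- The distance `d_AB` of two regions (it is `0` when one of them is empty). -/
def regionDist {D : ℕ} (A B : Finset (Site D)) : ℕ :=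
  sInf {n | ∃ a ∈ A, ∃ b ∈ B, n = gdist a b}

/-- The boundary layer `∂_j Λ = {x ∈ Λ : dist(x, Λᶜ) ≤ j}` of the ball `Λ = b_u(N)`. -/
def layer {D : ℕ} (u : Site D) (N j : ℕ) : Finset (Site D) :=
  @Finset.filter _ (fun x => ∃ y, y ∉ ball u N ∧ gdist x y ≤ j) (Classical.decPred _) (ball u N)

theorem layer_subset {D : ℕ} (u : Site D) (N j : ℕ) : layer u N j ⊆ ball u N :=
  @Finset.filter_subset _ _ (Classical.decPred _) _

/-! ### Operators, states and superoperators of a finite quantum system -/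

/-- A superoperator on the operators over `ℂ^n`. -/
abbrev SuperOp (n : Type) : Type := Matrix n n ℂ →ₗ[ℂ] Matrix n n ℂ

section General

variable {n : Type} [Fintype n] [DecidableEq n]

/-- A state: a positive semidefinite operator of trace one. -/
def IsState (ρ : Matrix n n ℂ) : Prop := ρ.PosSemidef ∧ ρ.trace = 1

/-- The trace norm `‖X‖₁ = max {|tr(F X)| : ‖F‖ ≤ 1}`, where `‖F‖` is the operator norm. -/
def traceNorm (X : Matrix n n ℂ) : ℝ :=
  sSup {r | ∃ F : Matrix n n ℂ, ‖Matrix.toEuclideanCLM (n := n) (𝕜 := ℂ) F‖ ≤ 1 ∧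
    r = ‖(F * X).trace‖}

/-- The von Neumann entropy `S(ρ) = - tr(ρ log₂ ρ)`, through the eigenvalues of `ρ`. -/
def entropy (ρ : Matrix n n ℂ) : ℝ :=
  open Classical in
  if h : ρ.IsHermitian then ∑ i, - (h.eigenvalues i * Real.logb 2 (h.eigenvalues i)) else 0

/-- The superoperator `T ⊗ id_k`. -/
def ampliate (T : SuperOp n) (k : ℕ) : SuperOp (n × Fin k) where
  toFun X := Matrix.of fun p q =>
    T (Matrix.of fun i j => X (i, p.2) (j, q.2)) p.1 q.1
  map_add' X Y := by
    ext p q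
    exact congrFun (congrFun (T.map_add (Matrix.of fun i j => X (i, p.2) (j, q.2))
      (Matrix.of fun i j => Y (i, p.2) (j, q.2))) p.1) q.1
  map_smul' c X := by
    ext p q
    exact congrFun (congrFun (T.map_smul c (Matrix.of fun i j => X (i, p.2) (j, q.2))) p.1) q.1

/-- The diamond norm `‖T‖_⋄ = sup_k sup_{X ≠ 0} ‖(T ⊗ id_k)(X)‖₁ / ‖X‖₁`. -/
def diamondNorm (T : SuperOp n) : ℝ :=
  sSup {r | ∃ (k : ℕ) (X : Matrix (n × Fin k) (n × Fin k) ℂ), X ≠ 0 ∧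
    r = traceNorm (ampliate T k X) / traceNorm X}

/-- Completely positive and trace preserving superoperators. -/
def IsCPTP (T : SuperOp n) : Prop :=
  (∀ (k : ℕ) (X : Matrix (n × Fin k) (n × Fin k) ℂ), X.PosSemidef → (ampliate T k X).PosSemidef) ∧
  ∀ X, (T X).trace = X.trace

/-- The evolution `T_t = exp(t 𝓛)`; the exponential is that of the matrix of `t 𝓛` with respect to
the basis of matrix units. -/
def evolve (L : SuperOp n) (t : ℝ) : SuperOp n :=
  Matrix.toLin (Matrix.stdBasis ℂ n n) (Matrix.stdBasis ℂ n n)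
    (NormedSpace.exp ((t : ℂ) •
      LinearMap.toMatrix (Matrix.stdBasis ℂ n n) (Matrix.stdBasis ℂ n n) L))

/-- A Lindbladian: the generator of a semigroup of completely positive and trace preserving maps. -/
def IsLindbladian (L : SuperOp n) : Prop := ∀ t : ℝ, 0 ≤ t → IsCPTP (evolve L t)

/-- `Tinf` is the infinite time limit `T_∞ = lim_N (1/N) ∑_{m ≤ N} T_m` of the evolution. -/
def IsInfiniteTimeLimit (T : ℝ → SuperOp n) (Tinf : SuperOp n) : Prop :=
  ∀ X, Tendsto (fun N : ℕ => ((N : ℂ) + 1)⁻¹ • ∑ m ∈ Finset.range (N + 1), T m X)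
    atTop (𝓝 (Tinf X))

/-- The state `ρ` is a fixed point of the evolution. -/
def IsFixedState (T : ℝ → SuperOp n) (ρ : Matrix n n ℂ) : Prop :=
  IsState ρ ∧ ∀ t : ℝ, 0 ≤ t → T t ρ = ρ

/-- The evolution has a unique fixed point among the states, and no other periodic points. -/
def HasUniqueFixedState (T : ℝ → SuperOp n) : Prop :=
  (∃! ρ, IsFixedState T ρ) ∧
  ∀ (σ : Matrix n n ℂ) (p : ℝ), IsState σ → 0 < p → T p σ = σ → IsFixedState T σ

end General

/-! ### Many-body systems

The site `x` carries the Hilbert space `ℂ^(d x)`, and a finite region `Z` the tensor product of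
these, whose canonical basis is indexed by the configurations on `Z`. -/

/-- The index set of the canonical basis of `𝓗_Z = ⨂_{x ∈ Z} ℂ^(d x)`. -/
abbrev Conf {D : ℕ} (d : Site D → ℕ) (Z : Finset (Site D)) : Type := (x : Z) → Fin (d x)

/-- The algebra `𝓐_Z` of operators on `𝓗_Z`. -/
abbrev Op {D : ℕ} (d : Site D → ℕ) (Z : Finset (Site D)) : Type := Matrix (Conf d Z) (Conf d Z) ℂ

section ManyBody

variable {D : ℕ} {d : Site D → ℕ}

/-- Restriction of a configuration to a smaller region. -/
def restrict {Z Λ : Finset (Site D)} (h : Z ⊆ Λ) (σ : Conf d Λ) : Conf d Z :=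
  fun x => σ ⟨x.1, h x.2⟩

/-- The configuration on `Λ` that is `a` on `Z` and `σ` on `Λ \ Z`. -/
def glue {Z Λ : Finset (Site D)} (a : Conf d Z) (σ : Conf d (Λ \ Z)) : Conf d Λ :=
  fun x => if h : x.1 ∈ Z then a ⟨x.1, h⟩ else σ ⟨x.1, Finset.mem_sdiff.2 ⟨x.2, h⟩⟩

/-- The superoperator `T ⊗ id_{Λ \ Z}` on `𝓐_Λ`, for a superoperator `T` on `𝓐_Z`, `Z ⊆ Λ`. -/
def embed {Z Λ : Finset (Site D)} (h : Z ⊆ Λ) (T : SuperOp (Conf d Z)) : SuperOp (Conf d Λ) where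
  toFun X := Matrix.of fun σ τ =>
    T (Matrix.of fun a b => X (glue a (restrict Finset.sdiff_subset σ))
      (glue b (restrict Finset.sdiff_subset τ))) (restrict h σ) (restrict h τ)
  map_add' X Y := by
    ext σ τ
    exact congrFun (congrFun (T.map_add
      (Matrix.of fun a b => X (glue a (restrict Finset.sdiff_subset σ))
        (glue b (restrict Finset.sdiff_subset τ)))
      (Matrix.of fun a b => Y (glue a (restrict Finset.sdiff_subset σ))
        (glue b (restrict Finset.sdiff_subset τ)))) (restrict h σ)) (restrict h τ)
  map_smul' c X := by
    ext σ τ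
    exact congrFun (congrFun (T.map_smul c
      (Matrix.of fun a b => X (glue a (restrict Finset.sdiff_subset σ))
        (glue b (restrict Finset.sdiff_subset τ)))) (restrict h σ)) (restrict h τ)

/-- The reduced operator on `A ⊆ Λ`: the partial trace over `Λ \ A`. -/
def reduce {Λ : Finset (Site D)} (A : Finset (Site D)) (X : Op d Λ) : Op d A :=
  Matrix.of fun a b => ∑ σ : Conf d (Λ \ A), X (glue a σ) (glue b σ)

/-- The operator `X ⊗ Y` on `𝓗_{A ∪ B} = 𝓗_A ⊗ 𝓗_B`, for disjoint regions `A` and `B`. -/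
def tensor {A B : Finset (Site D)} (X : Op d A) (Y : Op d B) : Op d (A ∪ B) :=
  Matrix.of fun σ τ =>
    X (restrict Finset.subset_union_left σ) (restrict Finset.subset_union_left τ) *
    Y (restrict Finset.subset_union_right σ) (restrict Finset.subset_union_right τ)

/-- The trace distance correlation `T(A : B) = ‖ρ_AB - ρ_A ⊗ ρ_B‖₁` in the state `ρ` on `Λ`. -/
def traceCorrelation {Λ : Finset (Site D)} (A B : Finset (Site D)) (ρ : Op d Λ) : ℝ :=
  traceNorm (reduce (A ∪ B) ρ - tensor (reduce A ρ) (reduce B ρ))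

/-- The mutual information `I(A : B) = S(ρ_A) + S(ρ_B) - S(ρ_AB)` in the state `ρ` on `Λ`. -/
def mutualInformation {Λ : Finset (Site D)} (A B : Finset (Site D)) (ρ : Op d Λ) : ℝ :=
  entropy (reduce A ρ) + entropy (reduce B ρ) - entropy (reduce (A ∪ B) ρ)

end ManyBody

/-- The binary entropy `h_b(x) = - x log₂ x - (1 - x) log₂ (1 - x)`. -/
def binaryEntropy (x : ℝ) : ℝ := - (x * Real.logb 2 x) - (1 - x) * Real.logb 2 (1 - x)

/-! ### Uniform families of Lindbladians -/

/-- A uniform family of Lindbladians on `ℤ^D`: local Lindbladians `𝓜_Z` for all finite regions `Z`,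
and for every ball `Λ = b_u(N)` a boundary condition, i.e. a Lindbladian
`𝓑^{∂Λ} = ∑_{j ≥ 1} 𝓑_j^{∂Λ}` with `𝓑_j^{∂Λ}` supported in the boundary layer `∂_j Λ`.
All the layers with `j ≥ N + 1` coincide, so that the sum is over `1 ≤ j ≤ N + 1`. -/
structure UniformFamily {D : ℕ} (d : Site D → ℕ) where
  /-- The local terms `𝓜_Z`. -/
  bulk : (Z : Finset (Site D)) → SuperOp (Conf d Z)
  bulk_lindbladian : ∀ Z, IsLindbladian (bulk Z)
  /-- The boundary terms `𝓑_j^{∂ b_u(N)}`. -/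
  bdry : (u : Site D) → (N j : ℕ) → SuperOp (Conf d (layer u N j))
  bdry_lindbladian : ∀ u N,
    IsLindbladian (∑ j ∈ Finset.Icc 1 (N + 1), embed (layer_subset u N j) (bdry u N j))

namespace UniformFamily

variable {D : ℕ} {d : Site D → ℕ} (F : UniformFamily d)

/-- The generator `∑_{Z ⊆ Λ} 𝓜_Z + 𝓑^{∂Λ}` of the evolution with closed boundary on the ball
`Λ = b_u(N)`. -/
def closedGenerator (u : Site D) (N : ℕ) : SuperOp (Conf d (ball u N)) :=
  ∑ Z ∈ (ball u N).powerset.attach, embed (Finset.mem_powerset.1 Z.2) (F.bulk Z.1) +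
  ∑ j ∈ Finset.Icc 1 (N + 1), embed (layer_subset u N j) (F.bdry u N j)

/-- The evolution with closed boundary on the ball `b_u(N)`. -/
def closedEvolution (u : Site D) (N : ℕ) (t : ℝ) : SuperOp (Conf d (ball u N)) :=
  evolve (F.closedGenerator u N) t

/-- The Lieb-Robinson assumptions: for every site `x`,
`∑_{Z ∋ x} ‖𝓜_Z‖_⋄ |Z| ν(diam Z) ≤ v`, and for every ball `b_u(N)` and every `r`,
`ν(r) ∑_{j ≥ r} ‖𝓑_j^{∂ b_u(N)}‖_⋄ ≤ P(N)`. -/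
def LiebRobinsonAssumptions (ν : ℝ → ℝ) (v : ℝ) (P : Polynomial ℝ) : Prop :=
  (∀ x : Site D,
    Summable (fun Z : {Z : Finset (Site D) // x ∈ Z} =>
      diamondNorm (F.bulk Z.1) * (Z.1.card : ℝ) * ν (diam Z.1)) ∧
    ∑' Z : {Z : Finset (Site D) // x ∈ Z},
      diamondNorm (F.bulk Z.1) * (Z.1.card : ℝ) * ν (diam Z.1) ≤ v) ∧
  ∀ (u : Site D) (N r : ℕ),
    ν r * ∑ j ∈ (Finset.Icc 1 (N + 1)).filter (fun j => r ≤ j), diamondNorm (F.bdry u N j)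
      ≤ P.eval (N : ℝ)

/-- Rapid mixing: `sup_ρ ‖T_t(ρ) - T_∞(ρ)‖₁ ≤ c |Λ|^δ e^(-γ t)`, the supremum over all states `ρ`,
for the evolution `T` with closed boundary on every ball `Λ`. -/
def RapidMixing (c γ δ : ℝ) : Prop :=
  ∀ (u : Site D) (N : ℕ), ∃ Tinf : SuperOp (Conf d (ball u N)),
    IsInfiniteTimeLimit (F.closedEvolution u N) Tinf ∧
    ∀ t : ℝ, 0 ≤ t → ∀ ρ : Op d (ball u N), IsState ρ →
      traceNorm (F.closedEvolution u N t ρ - Tinf ρ)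
        ≤ c * ((ball u N).card : ℝ) ^ δ * Real.exp (-(γ * t))

end UniformFamily

/-! ### Decay rates -/

/-- An increasing positive function `ν` on `[0, ∞)` with `ν(x + y) ≤ ν(x) ν(y)`. -/
structure IsGrowthFunction (ν : ℝ → ℝ) : Prop where
  pos : ∀ r, 0 ≤ r → 0 < ν r
  mono : MonotoneOn ν (Set.Ici 0)
  submul : ∀ x y, 0 ≤ x → 0 ≤ y → ν (x + y) ≤ ν x * ν y

/-- `ν⁻¹` decays fast enough for the exponents `β` and `k`: `(1 + r)^k ν(r)^(-β) → 0`. -/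
def SufficientlyFast (ν : ℝ → ℝ) (β k : ℝ) : Prop :=
  Tendsto (fun r : ℝ => (1 + r) ^ k * ν r ^ (-β)) atTop (𝓝 0)

/-- `Δ` is a fast-decaying function, in the same class as `ν⁻¹`: nonnegative, nonincreasing, tending
to zero, and up to a constant at most the least nonincreasing majorant of `(1 + r)^k ν(r)^(-β)`;
exponentially decaying if `ν⁻¹` is, and polynomially decaying, with degree at least `β p - k`, if
`ν⁻¹` is polynomially decaying with degree `p`. -/
structure IsFastDecaying (ν : ℝ → ℝ) (β k : ℝ) (Δ : ℝ → ℝ) : Prop where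
  nonneg : ∀ s, 0 ≤ s → 0 ≤ Δ s
  anti : AntitoneOn Δ (Set.Ici 0)
  tendsto_zero : Tendsto Δ atTop (𝓝 0)
  le_majorant : ∃ K : ℝ, ∀ s, 0 ≤ s → ∀ g : ℝ,
    (∀ r, s ≤ r → (1 + r) ^ k * ν r ^ (-β) ≤ g) → Δ s ≤ K * g
  exponential : ∀ a μ : ℝ, 0 < a → 0 < μ → (∀ r, 0 ≤ r → a * Real.exp (μ * r) ≤ ν r) →
    ∃ K μ' : ℝ, 0 < μ' ∧ ∀ s, 0 ≤ s → Δ s ≤ K * Real.exp (-(μ' * s))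
  polynomial : ∀ a p : ℝ, 0 < a → 0 < p → (∀ r, 0 ≤ r → a * (1 + r) ^ p ≤ ν r) →
    ∃ K : ℝ, ∀ s, 0 ≤ s → Δ s ≤ K * (1 + s) ^ (-(β * p - k))

end DissipativeLattice

end

open DissipativeLattice

/-!
# Decay of correlations in the fixed points of rapidly mixing Lindbladians

The argument works in the Heisenberg picture, with the operator norm on observables. The dual of a
Lindbladian generates a semigroup of contractions. It is therefore *dissipative*
(`IsDissipative`), a property of the generator that passes to sums, so that partial sums of local
terms generate contraction semigroups as well.

**Locality.** The dependence of an observable `O` on a site `x` is measured by `‖O - E_x O‖`, where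
`E_x` evaluates the site `x` in a fixed pure state. A local term annihilates the identity, hence is
controlled by the dependence of its argument on the sites of its support. A Grönwall argument for
the weighted maximum of these dependences gives the Lieb-Robinson bound `lieb_robinson`: the evolved
observable depends on a site at distance `r` at most by a constant times `e^(2vt) / ν(r)`.
With Duhamel's formula this yields `norm_closed_sub_semigroup_le`: for observables near
`X`, the evolution on `Λ` may be replaced by the evolution without boundary terms and without local
terms that are far from `X` or of large diameter. Only the sum of the boundary terms is a
Lindbladian; that its inner and outer parts cancel on the identity makes up for this
(`norm_sum_bdryTerm_le`).

**Two regions inside a ball.** Let `A` and `B` lie inside a ball `b ⊆ Λ`. An expectation value in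
the fixed point `ρ` on `Λ` does not change when the observable is evolved on `Λ`. By locality this
may be replaced by the evolution on `b` and then, because the latter forgets its initial state
(`norm_trace_semigroup_sub_le`), the state `ρ` by a product state. On the other hand the evolution
may be replaced by one that does not couple the half of `b` closer to `A` to the half closer to `B`.
So `ρ` is close, on observables on `A ∪ B`, to an uncoupled evolution of a product state; this
implies that `ρ_AB` is close to `ρ_A ⊗ ρ_B` in trace norm (`traceCorrelation_le_of_split`,
`traceCorrelation_le_of_ball`).

**Arbitrary regions.** Mixing is fast only on balls whose radius is comparable to the distance of
`A` and `B`, and `A ∪ B` may be much larger. But a finite set splits into two parts at a distance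
which is at least a fraction `1 / |A ∪ B|` of its diameter (`exists_bipartition`), and the estimate
for balls applies to these parts. The state nearly factorizes between them; by induction it nearly
factorizes between `A` and `B` inside each of them, and the errors add up to at most `3 |A ∪ B|`
times the estimate for one pair (`traceCorrelation_le_of_bipartitions`). If the ball that is needed
does not fit into `Λ`, then `Λ` itself is used; its radius is at most a power of the distance of
`A ∪ B` from the boundary. Choosing the time with `e^((2v+1+γ)t) = ν(y)`, for the relevant length
`y`, balances locality and mixing (`exists_time`) and bounds all the errors by multiples of
`(1 + r)^k ν(r)^(-β)` at lengths `r` comparable to or larger than the distance of `A` and `B`. The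
function `Δ₀` is a multiple of the nonincreasing majorant of this rate (`majorant`).

**Mutual information.** The mutual information is the difference of the conditional entropies, given
`B`, of `ρ_A ⊗ ρ_B` and of `ρ_AB`, and the conditional entropy is continuous
(`conditional_natEntropy_sub_le`). The proof needs no strong subadditivity. Two inequalities suffice:
the entropy of a state is at most that of its diagonal, and the entropy of an ensemble of pure states
is at most that of its weights. They bound the conditional entropy by `± log dim`, and show that the
entropy is concave, and convex up to the entropy of mixing. If `P - Q` is the Jordan decomposition of
the difference of two states, mixing one with a multiple of `Q` and the other with a multiple of `P`
gives the same state, and comparing the entropies along these two mixtures gives the estimate.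
-/

noncomputable section

set_option linter.unusedSectionVars false

namespace DissipativeLattice

/-! ### Semigroups of bounded operators and dissipativity -/

section Semigroup

variable {V : Type*} [NormedAddCommGroup V] [NormedSpace ℂ V] [CompleteSpace V]

/-- The one-parameter semigroup `exp (t G)` generated by a bounded operator `G`. -/
def semigroup (G : V →L[ℂ] V) (t : ℝ) : V →L[ℂ] V := NormedSpace.exp (t • G)

theorem semigroup_zero (G : V →L[ℂ] V) : semigroup G 0 = 1 := by
  simp [semigroup]

theorem semigroup_add (G : V →L[ℂ] V) (s t : ℝ) :
    semigroup G (s + t) = semigroup G s * semigroup G t := by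
  let _ : NormedAlgebra ℚ (V →L[ℂ] V) := NormedAlgebra.restrictScalars ℚ ℝ _
  rw [semigroup, add_smul, NormedSpace.exp_add_of_commute]
  · rfl
  · exact ((Commute.refl G).smul_left s).smul_right t

theorem commute_semigroup {A G : V →L[ℂ] V} (h : Commute A G) (t : ℝ) :
    Commute A (semigroup G t) := by
  exact (h.smul_right t).exp_right

theorem semigroup_apply_comm {A G : V →L[ℂ] V} (h : Commute A G) (t : ℝ) (O : V) :
    A (semigroup G t O) = semigroup G t (A O) :=
  congrArg (fun T : V →L[ℂ] V => T O) (commute_semigroup h t).eq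

theorem semigroup_add_of_commute {G H : V →L[ℂ] V} (h : Commute G H) (t : ℝ) :
    semigroup (G + H) t = semigroup G t * semigroup H t := by
  let _ : NormedAlgebra ℚ (V →L[ℂ] V) := NormedAlgebra.restrictScalars ℚ ℝ _
  rw [semigroup, smul_add, NormedSpace.exp_add_of_commute]
  · rfl
  · exact (h.smul_left t).smul_right t

theorem hasDerivAt_semigroup (G : V →L[ℂ] V) (O : V) (t : ℝ) :
    HasDerivAt (fun s => semigroup G s O) (G (semigroup G t O)) t := by
  have h := hasDerivAt_exp_smul_const' (𝕂 := ℝ) G t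
  have h2 : HasDerivAt (fun s : ℝ => (ContinuousLinearMap.apply ℂ V O) (semigroup G s)) _ t :=
    ((ContinuousLinearMap.apply ℂ V O).restrictScalars ℝ).hasFDerivAt.comp_hasDerivAt t h
  exact h2

theorem continuous_semigroup_apply (G : V →L[ℂ] V) (O : V) :
    Continuous fun s => semigroup G s O :=
  continuous_iff_continuousAt.2 fun t => (hasDerivAt_semigroup G O t).continuousAt

/-- If `G O = 0` then the semigroup generated by `G` fixes `O`. -/
theorem semigroup_apply_of_eq_zero {G : V →L[ℂ] V} {O : V} (h : G O = 0) (t : ℝ) :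
    semigroup G t O = O := by
  have hc : Commute G G := Commute.refl G
  have h1 : ∀ s, HasDerivAt (fun s => semigroup G s O) 0 s := by
    intro s
    have := hasDerivAt_semigroup G O s
    have e : G (semigroup G s O) = 0 := by
      have := congrArg (fun T : V →L[ℂ] V => T O) (commute_semigroup hc s).eq
      simpa [h] using this
    rwa [e] at this
  have := is_const_of_deriv_eq_zero (fun s => (h1 s).differentiableAt) (fun s => (h1 s).deriv) t 0
  simpa [semigroup_zero] using this

/-- The first order expansion of the semigroup in time. -/
theorem eventually_norm_semigroup_sub_le (G : V →L[ℂ] V) (O : V) (t : ℝ) {c : ℝ} (hc : 0 < c) :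
    ∀ᶠ h in 𝓝[>] (0 : ℝ),
      ‖semigroup G (t + h) O - (semigroup G t O + h • G (semigroup G t O))‖ ≤ c * h := by
  have h := (hasDerivAt_semigroup G O t).hasFDerivAt.isLittleO
  have h0 : Tendsto (fun h : ℝ => t + h) (𝓝[>] 0) (𝓝 t) := by
    have : Tendsto (fun h : ℝ => t + h) (𝓝 0) (𝓝 (t + 0)) := by
      exact (continuous_const.add continuous_id).tendsto 0
    rw [add_zero] at this
    exact this.mono_left nhdsWithin_le_nhds
  have h3 := h0.eventually (h.def hc)
  filter_upwards [h3, self_mem_nhdsWithin] with s hs hs0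
  have hs0 : 0 < s := hs0
  simp only [add_sub_cancel_left, ContinuousLinearMap.toSpanSingleton_apply, Real.norm_eq_abs,
    abs_of_pos hs0] at hs
  rwa [← sub_sub]

/-- A Grönwall estimate: if the seminorm `‖Φ ·‖` grows at most at the infinitesimal rate `a` under
the generator `G`, then it grows at most by the factor `exp (a t)` under the semigroup. -/
theorem norm_semigroup_le_of_rate {W : Type*} [NormedAddCommGroup W] [NormedSpace ℝ W]
    (Φ : V →L[ℝ] W) (G : V →L[ℂ] V) (a : ℝ)
    (H : ∀ O : V, ∀ ε : ℝ, 0 < ε → ∀ᶠ h in 𝓝[>] (0 : ℝ),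
      ‖Φ (O + h • G O)‖ ≤ ‖Φ O‖ + h * (a * ‖Φ O‖ + ε))
    (O : V) {t : ℝ} (ht : 0 ≤ t) :
    ‖Φ (semigroup G t O)‖ ≤ Real.exp (a * t) * ‖Φ O‖ := by
  have key := le_gronwallBound_of_liminf_deriv_right_le
    (f := fun s => ‖Φ (semigroup G s O)‖) (f' := fun s => a * ‖Φ (semigroup G s O)‖)
    (δ := ‖Φ O‖) (K := a) (ε := 0) (a := 0) (b := t)
    (by
      have := continuous_semigroup_apply G O
      fun_prop)
    (by
      intro x _ r hr
      apply Eventually.frequently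
      set Ox := semigroup G x O with hOx
      set ε := (r - a * ‖Φ Ox‖) / 3 with hε
      have hε0 : 0 < ε := by
        have : a * ‖Φ Ox‖ < r := hr
        rw [hε]; linarith
      have hK : 0 < ‖Φ‖ + 1 := by positivity
      have h1 := eventually_norm_semigroup_sub_le G O x (div_pos hε0 hK)
      have h2 := H Ox ε hε0
      have h0 : Tendsto (fun z : ℝ => z - x) (𝓝[>] x) (𝓝[>] 0) := by
        apply tendsto_nhdsWithin_iff.2 ⟨?_, ?_⟩
        · have : Tendsto (fun z : ℝ => z - x) (𝓝 x) (𝓝 (x - x)) :=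
            (continuous_id.sub continuous_const).tendsto x
          rw [sub_self] at this
          exact this.mono_left nhdsWithin_le_nhds
        · filter_upwards [self_mem_nhdsWithin] with z hz
          exact sub_pos.2 (Set.mem_Ioi.1 hz)
      filter_upwards [h0.eventually h1, h0.eventually h2, self_mem_nhdsWithin] with z hz1 hz2 hz
      have hz : x < z := hz
      have hzp : 0 < z - x := sub_pos.2 hz
      rw [add_sub_cancel, ← hOx] at hz1
      have e : Φ (semigroup G z O) = Φ (Ox + (z - x) • G Ox) +
          Φ (semigroup G z O - (Ox + (z - x) • G Ox)) := by
        rw [← map_add, add_sub_cancel]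
      have h3 : ‖Φ (semigroup G z O - (Ox + (z - x) • G Ox))‖ ≤ ε * (z - x) := by
        calc _ ≤ ‖Φ‖ * (ε / (‖Φ‖ + 1) * (z - x)) :=
              (Φ.le_opNorm _).trans (by gcongr)
          _ ≤ (‖Φ‖ + 1) * (ε / (‖Φ‖ + 1) * (z - x)) := by gcongr; linarith
          _ = ε * (z - x) := by field_simp
      have h4 : ‖Φ (semigroup G z O)‖ - ‖Φ Ox‖ ≤ (z - x) * (a * ‖Φ Ox‖ + 2 * ε) := by
        rw [e]
        have := norm_add_le (Φ (Ox + (z - x) • G Ox)) (Φ (semigroup G z O - (Ox + (z - x) • G Ox)))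
        linarith
      rw [inv_mul_lt_iff₀ hzp]
      refine h4.trans_lt ?_
      apply mul_lt_mul_of_pos_left _ hzp
      rw [hε]
      have : a * ‖Φ Ox‖ < r := hr
      linarith)
    (by simp [semigroup_zero]) (by intro x _; simp) t ⟨ht, le_refl t⟩
  simpa [gronwallBound_ε0, mul_comm] using key

/-- A bounded operator `G` is dissipative if `‖O + h G O‖ ≤ ‖O‖ + o(h)` as `h ↓ 0`, for every `O`.
These are the generators of contraction semigroups, and, unlike the latter property, dissipativity
is visibly stable under sums. -/
def IsDissipative (G : V →L[ℂ] V) : Prop :=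
  ∀ O : V, ∀ ε : ℝ, 0 < ε → ∀ᶠ h in 𝓝[>] (0 : ℝ), ‖O + h • G O‖ ≤ ‖O‖ + h * ε

theorem IsDissipative.zero : IsDissipative (0 : V →L[ℂ] V) := by
  intro O ε hε
  filter_upwards [self_mem_nhdsWithin] with h hh
  have hh : 0 < h := hh
  simp only [zero_apply, smul_zero, add_zero]
  have := mul_pos hh hε
  linarith

theorem IsDissipative.add {G H : V →L[ℂ] V} (hG : IsDissipative G) (hH : IsDissipative H) :
    IsDissipative (G + H) := by
  intro O ε hε
  have h0 : Tendsto (fun h : ℝ => 2 * h) (𝓝[>] 0) (𝓝[>] 0) := by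
    apply tendsto_nhdsWithin_iff.2 ⟨?_, ?_⟩
    · have : Tendsto (fun h : ℝ => 2 * h) (𝓝 0) (𝓝 (2 * 0)) :=
        (continuous_const.mul continuous_id).tendsto 0
      rw [mul_zero] at this
      exact this.mono_left nhdsWithin_le_nhds
    · filter_upwards [self_mem_nhdsWithin] with z hz
      exact mul_pos two_pos (Set.mem_Ioi.1 hz)
  filter_upwards [h0.eventually (hG O (ε / 2) (half_pos hε)),
    h0.eventually (hH O (ε / 2) (half_pos hε)), self_mem_nhdsWithin] with h h1 h2 hh
  have hh : 0 < h := hh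
  have e : O + h • (G + H) O = (1 / 2 : ℝ) • (O + (2 * h) • G O) +
      (1 / 2 : ℝ) • (O + (2 * h) • H O) := by
    rw [add_apply]
    module
  rw [e]
  refine (norm_add_le _ _).trans ?_
  rw [norm_smul, norm_smul]
  norm_num
  nlinarith

theorem IsDissipative.sum {ι : Type*} (s : Finset ι) {G : ι → V →L[ℂ] V}
    (h : ∀ i ∈ s, IsDissipative (G i)) : IsDissipative (∑ i ∈ s, G i) := by
  classical
  induction s using Finset.induction_on with
  | empty => simpa using IsDissipative.zero
  | insert a s ha ih =>
    rw [Finset.sum_insert ha]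
    exact (h a (Finset.mem_insert_self a s)).add
      (ih fun i hi => h i (Finset.mem_insert_of_mem hi))

theorem IsDissipative.norm_semigroup_apply_le {G : V →L[ℂ] V} (hG : IsDissipative G) (O : V)
    {t : ℝ} (ht : 0 ≤ t) : ‖semigroup G t O‖ ≤ ‖O‖ := by
  have := norm_semigroup_le_of_rate (ContinuousLinearMap.id ℝ V) G 0
    (by simpa [IsDissipative] using hG) O ht
  simpa using this

theorem isDissipative_of_contraction {G : V →L[ℂ] V}
    (h : ∀ t : ℝ, 0 ≤ t → ∀ O, ‖semigroup G t O‖ ≤ ‖O‖) : IsDissipative G := by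
  intro O ε hε
  filter_upwards [eventually_norm_semigroup_sub_le G O 0 hε, self_mem_nhdsWithin] with s hs hs0
  have hs0 : 0 < s := hs0
  simp only [zero_add, semigroup_zero, one_apply_eq_self] at hs
  have h1 := norm_sub_norm_le (O + s • G O) (semigroup G s O)
  rw [norm_sub_rev] at h1
  have := h s hs0.le O
  linarith

/-- Duhamel's comparison of two semigroups, through the derivative of
`s ↦ exp ((t - s) G) exp (s G') O`. -/
theorem norm_semigroup_sub_semigroup_le {G G' : V →L[ℂ] V} (hG : IsDissipative G) (O : V)
    {t C : ℝ} (ht : 0 ≤ t)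
    (hC : ∀ s, 0 ≤ s → s ≤ t → ‖(G - G') (semigroup G' s O)‖ ≤ C) :
    ‖semigroup G t O - semigroup G' t O‖ ≤ C * t := by
  let B : (V →L[ℂ] V) →L[ℝ] V →L[ℝ] V :=
    (ContinuousLinearMap.restrictScalarsL ℂ V V ℝ ℝ)
  have hd : ∀ s : ℝ, HasDerivAt (fun s => semigroup G (t - s) (semigroup G' s O))
      (- semigroup G (t - s) ((G - G') (semigroup G' s O))) s := by
    intro s
    have h1 : HasDerivAt (fun s => semigroup G (t - s)) (- (semigroup G (t - s) * G)) s := by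
      have h := hasDerivAt_exp_smul_const (𝕂 := ℝ) G (t - s)
      have h2 : HasDerivAt (fun s : ℝ => t - s) (-1) s := by
        simpa using (hasDerivAt_id s).const_sub t
      have := h.scomp s h2
      simpa [semigroup, Function.comp_def] using this
    have h2 := hasDerivAt_semigroup G' O s
    have h3 : HasDerivAt (fun s => B (semigroup G (t - s))) (B (- (semigroup G (t - s) * G))) s :=
      B.hasFDerivAt.comp_hasDerivAt s h1
    have h4 := h3.clm_apply h2
    refine h4.congr_deriv ?_
    change (- (semigroup G (t - s) * G)) (semigroup G' s O) +
      semigroup G (t - s) (G' (semigroup G' s O)) = _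
    simp
    abel
  have := norm_image_sub_le_of_norm_deriv_le_segment' (a := 0) (b := t) (C := C)
    (f := fun s => semigroup G (t - s) (semigroup G' s O))
    (fun x _ => (hd x).hasDerivWithinAt)
    (fun x hx => by
      rw [norm_neg]
      exact (hG.norm_semigroup_apply_le _ (by linarith [hx.2])).trans (hC x hx.1 hx.2.le))
    t ⟨ht, le_refl t⟩
  simpa [semigroup_zero, norm_sub_rev] using this

end Semigroup

/-! ### The Lieb-Robinson bound -/

section LiebRobinson

variable {V : Type*} [NormedAddCommGroup V] [NormedSpace ℂ V] [CompleteSpace V]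
  {ι κ : Type*} [DecidableEq ι]

/-- The Lieb-Robinson bound in an abstract form. The maps `E x` are contractions ("forget the site
`x`"), so that `‖O - E x O‖` measures the dependence of `O` on the site `x`. Each term `M z` of the
generator commutes with `E x` for `x` outside its support, and is controlled by the dependence of
its argument on the sites of its support. If the weights `w` satisfy the given summability
condition, the weighted dependence grows at most at the rate `2 a`. -/
theorem lieb_robinson (Λ : Finset ι) (E : ι → V →L[ℂ] V) (coll : Finset κ)
    (supp : κ → Finset ι) (M : κ → V →L[ℂ] V) (m : κ → ℝ) (w : ι → ℝ) (a : ℝ)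
    (hE : ∀ x ∈ Λ, ∀ O, ‖E x O‖ ≤ ‖O‖)
    (hsupp : ∀ z ∈ coll, supp z ⊆ Λ)
    (hcomm : ∀ z ∈ coll, ∀ x ∈ Λ, x ∉ supp z → Commute (E x) (M z))
    (hdiss : ∀ z ∈ coll, IsDissipative (M z))
    (hm : ∀ z ∈ coll, 0 ≤ m z)
    (hM : ∀ z ∈ coll, ∀ O, ‖M z O‖ ≤ m z * ∑ x ∈ supp z, ‖O - E x O‖)
    (hw : ∀ x, 0 < w x)
    (ha : ∀ x ∈ Λ, ∑ z ∈ coll with x ∈ supp z, m z * ∑ y ∈ supp z, w x / w y ≤ a)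
    (O : V) {C : ℝ} (hC0 : 0 ≤ C) (hC : ∀ x ∈ Λ, w x * ‖O - E x O‖ ≤ C)
    {t : ℝ} (ht : 0 ≤ t) {x : ι} (hx : x ∈ Λ) :
    w x * ‖semigroup (∑ z ∈ coll, M z) t O - E x (semigroup (∑ z ∈ coll, M z) t O)‖
      ≤ Real.exp (2 * a * t) * C := by
  set G := ∑ z ∈ coll, M z with hG
  -- the weighted dependences on all the sites, as one seminorm
  let Φ : V →L[ℝ] (Λ → V) := ContinuousLinearMap.pi fun x =>
    (w x.1) • ((ContinuousLinearMap.id ℂ V - E x.1).restrictScalars ℝ)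
  have hΦ : ∀ (O : V) (x : Λ), Φ O x = w x.1 • (O - E x.1 O) := fun O x => rfl
  have hΦn : ∀ (O : V) (x : ι), x ∈ Λ → w x * ‖O - E x O‖ ≤ ‖Φ O‖ := by
    intro O x hx
    have := norm_le_pi_norm (Φ O) ⟨x, hx⟩
    rwa [hΦ, norm_smul, Real.norm_of_nonneg (hw x).le] at this
  have rate : ∀ O : V, ∀ ε : ℝ, 0 < ε → ∀ᶠ h in 𝓝[>] (0 : ℝ),
      ‖Φ (O + h • G O)‖ ≤ ‖Φ O‖ + h * ((2 * a) * ‖Φ O‖ + ε) := by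
    intro O ε hε
    have hpt : ∀ x : Λ, ∀ᶠ h in 𝓝[>] (0 : ℝ),
        ‖Φ (O + h • G O) x‖ ≤ ‖Φ O‖ + h * ((2 * a) * ‖Φ O‖ + ε) := by
      intro x
      -- the terms off `x` act on `P` as a contraction semigroup; the terms at `x` are a perturbation
      set P := O - E x O with hP
      set G1 := ∑ z ∈ coll with x.1 ∉ supp z, M z with hG1
      set K := ∑ z ∈ coll with x.1 ∈ supp z, M z with hK
      have hsplit : G = K + G1 := by
        rw [hG, hK, hG1, Finset.sum_filter_add_sum_filter_not]
      have hd1 : IsDissipative G1 :=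
        IsDissipative.sum _ fun z hz => hdiss z (Finset.mem_filter.1 hz).1
      have hc1 : Commute (E x.1) G1 :=
        Commute.sum_right _ _ _ fun z hz =>
          hcomm z (Finset.mem_filter.1 hz).1 x x.2 (Finset.mem_filter.1 hz).2
      have hc1' : E x (G1 O) = G1 (E x O) := congrArg (fun T : V →L[ℂ] V => T O) hc1.eq
      have hKO : ‖K O - E x (K O)‖ ≤ 2 * ‖K O‖ := by
        have := norm_sub_le (K O) (E x (K O))
        have := hE x x.2 (K O)
        linarith
      have hKw : w x * ‖K O‖ ≤ a * ‖Φ O‖ := by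
        calc w x * ‖K O‖ ≤ w x * ∑ z ∈ coll with x.1 ∈ supp z, ‖M z O‖ := by
              have := hw x
              rw [hK, sum_apply]
              gcongr
              exact norm_sum_le _ _
          _ ≤ w x * ∑ z ∈ coll with x.1 ∈ supp z,
                m z * ∑ y ∈ supp z, (‖Φ O‖ / w y) := by
              have := (hw x).le
              gcongr with z hz
              have hz' := (Finset.mem_filter.1 hz).1
              refine (hM z hz' O).trans ?_
              have := hm z hz'
              gcongr with y hy
              rw [le_div_iff₀ (hw y), mul_comm]
              exact hΦn O y (hsupp z hz' hy)
          _ = (∑ z ∈ coll with x.1 ∈ supp z, m z * ∑ y ∈ supp z, w x / w y) * ‖Φ O‖ := by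
              rw [Finset.mul_sum, Finset.sum_mul]
              refine Finset.sum_congr rfl fun z _ => ?_
              simp only [Finset.mul_sum, Finset.sum_mul]
              refine Finset.sum_congr rfl fun y _ => ?_
              ring
          _ ≤ a * ‖Φ O‖ := by
              gcongr
              exact ha x x.2
      filter_upwards [hd1 P (ε / w x) (div_pos hε (hw x)), self_mem_nhdsWithin] with h hh hh0
      have hh0 : 0 < h := hh0
      have e : O + h • G O - E x (O + h • G O) = (P + h • G1 P) + h • (K O - E x (K O)) := by
        rw [hsplit, hP]
        simp only [add_apply, map_add, map_sub, smul_add, smul_sub, ← hc1',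
          ContinuousLinearMap.map_smul_of_tower]
        abel
      rw [hΦ, norm_smul, Real.norm_of_nonneg (hw x).le, e]
      have h1 : ‖(P + h • G1 P) + h • (K O - E x (K O))‖ ≤
          ‖P‖ + h * (ε / w x) + h * (2 * ‖K O‖) := by
        refine (norm_add_le _ _).trans ?_
        rw [norm_smul, Real.norm_of_nonneg hh0.le]
        have := mul_le_mul_of_nonneg_left hKO hh0.le
        linarith
      have h2 := mul_le_mul_of_nonneg_left h1 (hw x).le
      have h3 := hΦn O x x.2
      have h4 : w x * (h * (ε / w x)) = h * ε := by
        have := (hw x).ne'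
        field_simp
      have h5 := mul_le_mul_of_nonneg_left hKw hh0.le
      rw [← hP] at h3
      nlinarith
    have := Filter.eventually_all.2 hpt
    filter_upwards [this, self_mem_nhdsWithin] with h hh hh0
    have hh0 : 0 < h := hh0
    have hnn : 0 ≤ ‖Φ O‖ + h * ((2 * a) * ‖Φ O‖ + ε) := by
      rcases isEmpty_or_nonempty Λ with hemp | ⟨⟨x⟩⟩
      · have : ‖Φ O‖ = 0 := by
          rw [norm_eq_zero]; exact Subsingleton.elim _ _
        rw [this]
        have := mul_pos hh0 hε
        linarith
      · exact (norm_nonneg _).trans (hh x)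
    exact (pi_norm_le_iff_of_nonneg hnn).2 hh
  have hfin := norm_semigroup_le_of_rate Φ G (2 * a) rate O ht
  refine (hΦn _ x hx).trans (hfin.trans ?_)
  gcongr
  refine (pi_norm_le_iff_of_nonneg hC0).2 fun x => ?_
  rw [hΦ, norm_smul, Real.norm_of_nonneg (hw x).le]
  exact hC x x.2

end LiebRobinson

open scoped Matrix.Norms.L2Operator

/-! ### The operator norm of matrices -/

section MatrixNorm

variable {n : Type} [Fintype n] [DecidableEq n]

/-- The squared euclidean norm of a vector. -/
def normSq (v : n → ℂ) : ℝ := ∑ i, ‖v i‖ ^ 2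

theorem normSq_nonneg (v : n → ℂ) : 0 ≤ normSq v := Finset.sum_nonneg fun _ _ => by positivity

theorem normSq_eq (v : n → ℂ) : normSq v = ‖WithLp.toLp 2 v‖ ^ 2 := by
  rw [EuclideanSpace.norm_sq_eq]; rfl

theorem quad_eq_inner (M : Matrix n n ℂ) (v w : n → ℂ) :
    star v ⬝ᵥ M.mulVec w =
      inner ℂ (WithLp.toLp 2 v) (Matrix.toEuclideanCLM (n := n) (𝕜 := ℂ) M (WithLp.toLp 2 w)) := by
  rw [Matrix.toEuclideanCLM_toLp, EuclideanSpace.inner_toLp_toLp, dotProduct_comm]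

theorem norm_quad_le (M : Matrix n n ℂ) (v w : n → ℂ) :
    ‖star v ⬝ᵥ M.mulVec w‖ ≤ ‖M‖ * ((normSq v + normSq w) / 2) := by
  rw [quad_eq_inner, normSq_eq, normSq_eq]
  refine (norm_inner_le_norm _ _).trans ?_
  have h1 := (Matrix.toEuclideanCLM (n := n) (𝕜 := ℂ) M).le_opNorm (WithLp.toLp 2 w)
  rw [← Matrix.cstar_norm_def] at h1
  have h2 := mul_le_mul_of_nonneg_left h1 (norm_nonneg (WithLp.toLp 2 v))
  have h3 : ‖WithLp.toLp 2 v‖ * ‖WithLp.toLp 2 w‖ ≤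
      (‖WithLp.toLp 2 v‖ ^ 2 + ‖WithLp.toLp 2 w‖ ^ 2) / 2 := by
    nlinarith [sq_nonneg (‖WithLp.toLp 2 v‖ - ‖WithLp.toLp 2 w‖)]
  have h4 := mul_le_mul_of_nonneg_left h3 (norm_nonneg M)
  nlinarith

/-- The operator norm is the supremum of the sesquilinear form over pairs of unit vectors. -/
theorem norm_le_of_quad (M : Matrix n n ℂ) {C : ℝ} (hC : 0 ≤ C)
    (h : ∀ v w, normSq v = 1 → normSq w = 1 → ‖star v ⬝ᵥ M.mulVec w‖ ≤ C) : ‖M‖ ≤ C := by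
  rw [Matrix.cstar_norm_def]
  have key : ∀ x y : EuclideanSpace ℂ n, ‖x‖ = 1 → ‖y‖ = 1 →
      ‖inner ℂ x (Matrix.toEuclideanCLM (n := n) (𝕜 := ℂ) M y)‖ ≤ C := by
    intro x y hx hy
    have := h x.ofLp y.ofLp (by rw [normSq_eq, WithLp.toLp_ofLp, hx, one_pow])
      (by rw [normSq_eq, WithLp.toLp_ofLp, hy, one_pow])
    rwa [quad_eq_inner, WithLp.toLp_ofLp, WithLp.toLp_ofLp] at this
  refine ContinuousLinearMap.opNorm_le_of_unit_norm (𝕜 := ℂ) hC ?_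
  intro y hy
  set z := Matrix.toEuclideanCLM (n := n) (𝕜 := ℂ) M y with hz
  rcases eq_or_ne z 0 with h0 | h0
  · rw [h0, norm_zero]; exact hC
  · have hzn : ‖z‖ ≠ 0 := norm_ne_zero_iff.2 h0
    have := key ((‖z‖⁻¹ : ℂ) • z) y (by
      rw [norm_smul, norm_inv, Complex.norm_real, norm_norm, inv_mul_cancel₀ hzn]) hy
    rw [inner_smul_left, ← hz, inner_self_eq_norm_sq_to_K, norm_mul] at this
    simp only [map_inv₀, Complex.conj_ofReal, norm_inv, Complex.norm_real, norm_norm, norm_pow,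
      Complex.coe_algebraMap] at this
    have e : ‖z‖⁻¹ * ‖z‖ ^ 2 = ‖z‖ := by field_simp
    rwa [e] at this

theorem norm_apply_le (M : Matrix n n ℂ) (i j : n) : ‖M i j‖ ≤ ‖M‖ := by
  have h := norm_quad_le M (Pi.single i 1) (Pi.single j 1)
  have e : ∀ i : n, normSq (Pi.single i (1 : ℂ)) = 1 := by
    intro i
    rw [normSq, Finset.sum_eq_single i] <;> simp +contextual
  rw [e, e] at h
  have e2 : (star (Pi.single i (1 : ℂ)) : n → ℂ) = Pi.single i 1 := by
    ext k; by_cases hk : k = i <;> simp [hk]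
  rw [e2] at h
  simpa using h

theorem norm_submatrix_le {m : Type} [Fintype m] [DecidableEq m] (M : Matrix n n ℂ) (f : m → n)
    (hf : Function.Injective f) : ‖M.submatrix f f‖ ≤ ‖M‖ := by
  refine norm_le_of_quad _ (norm_nonneg _) fun v w hv hw => ?_
  have hsum : ∀ (g : n → ℂ) (v : m → ℂ), ∑ i, (Function.extend f v 0) i * g i =
      ∑ i, v i * g (f i) := by
    intro g v
    rw [← Finset.sum_subset (Finset.subset_univ (Finset.univ.map ⟨f, hf⟩))]
    · simp [hf.extend_apply]
    · intro i _ hi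
      rw [Function.extend_apply']
      · simp
      · rintro ⟨a, rfl⟩
        exact hi (by simp)
  have hn : ∀ v : m → ℂ, normSq (Function.extend f v 0) = normSq v := by
    intro v
    unfold normSq
    rw [← Finset.sum_subset (Finset.subset_univ (Finset.univ.map ⟨f, hf⟩))]
    · simp [hf.extend_apply]
    · intro i _ hi
      rw [Function.extend_apply']
      · simp
      · rintro ⟨a, rfl⟩
        exact hi (by simp)
  have h := norm_quad_le M (Function.extend f v 0) (Function.extend f w 0)
  rw [hn, hn, hv, hw] at h
  have e : star v ⬝ᵥ (M.submatrix f f).mulVec w =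
      star (Function.extend f v 0) ⬝ᵥ M.mulVec (Function.extend f w 0) := by
    have hs : (star (Function.extend f v 0) : n → ℂ) = Function.extend f (star v) 0 := by
      ext i
      by_cases hi : ∃ a, f a = i
      · obtain ⟨a, rfl⟩ := hi
        simp [hf.extend_apply]
      · simp [Function.extend_apply' _ _ _ hi]
    simp only [dotProduct, Matrix.mulVec, hs, hsum, Matrix.submatrix_apply]
    refine Finset.sum_congr rfl fun i _ => ?_
    congr 1
    have := hsum (fun j => M (f i) j) w
    simp only [mul_comm] at this ⊢
    exact this.symm
  rw [e]
  simpa using h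

theorem norm_submatrix_equiv {m : Type} [Fintype m] [DecidableEq m] (M : Matrix n n ℂ) (e : m ≃ n) :
    ‖M.submatrix e e‖ = ‖M‖ := by
  refine le_antisymm (norm_submatrix_le M e e.injective) ?_
  have := norm_submatrix_le (M.submatrix e e) e.symm e.symm.injective
  simpa using this

end MatrixNorm

/-! ### The trace norm -/

section TraceNorm

variable {n : Type} [Fintype n] [DecidableEq n]

theorem traceNorm_bddAbove (X : Matrix n n ℂ) :
    BddAbove {r | ∃ F : Matrix n n ℂ, ‖Matrix.toEuclideanCLM (n := n) (𝕜 := ℂ) F‖ ≤ 1 ∧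
      r = ‖(F * X).trace‖} := by
  refine ⟨∑ i, ∑ j, ‖X j i‖, ?_⟩
  rintro r ⟨F, hF, rfl⟩
  rw [← Matrix.cstar_norm_def] at hF
  simp only [Matrix.trace, Matrix.diag, Matrix.mul_apply]
  refine (norm_sum_le _ _).trans (Finset.sum_le_sum fun i _ => (norm_sum_le _ _).trans
    (Finset.sum_le_sum fun j _ => ?_))
  rw [norm_mul]
  exact mul_le_of_le_one_left (norm_nonneg _) ((norm_apply_le F i j).trans hF)

theorem norm_trace_mul_le (F X : Matrix n n ℂ) : ‖(F * X).trace‖ ≤ ‖F‖ * traceNorm X := by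
  rcases eq_or_ne F 0 with rfl | hF
  · simp
  · have hF' : ‖F‖ ≠ 0 := norm_ne_zero_iff.2 hF
    have := le_csSup (traceNorm_bddAbove X) ⟨(‖F‖⁻¹ : ℂ) • F, by
      rw [← Matrix.cstar_norm_def, norm_smul, norm_inv, Complex.norm_real, norm_norm,
        inv_mul_cancel₀ hF'], rfl⟩
    rw [Matrix.smul_mul, Matrix.trace_smul, norm_smul, norm_inv, Complex.norm_real, norm_norm,
      inv_mul_le_iff₀ (by positivity)] at this
    exact this

theorem traceNorm_le {X : Matrix n n ℂ} {C : ℝ}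
    (h : ∀ F : Matrix n n ℂ, ‖F‖ ≤ 1 → ‖(F * X).trace‖ ≤ C) : traceNorm X ≤ C := by
  refine csSup_le ⟨_, 0, by simp, rfl⟩ ?_
  rintro r ⟨F, hF, rfl⟩
  exact h F (by rwa [Matrix.cstar_norm_def])

theorem traceNorm_nonneg (X : Matrix n n ℂ) : 0 ≤ traceNorm X :=
  (norm_nonneg _).trans (le_csSup (traceNorm_bddAbove X) ⟨0, by simp, rfl⟩)

theorem traceNorm_zero : traceNorm (0 : Matrix n n ℂ) = 0 :=
  le_antisymm (traceNorm_le (by simp)) (traceNorm_nonneg _)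

theorem traceNorm_sub_comm (X Y : Matrix n n ℂ) : traceNorm (X - Y) = traceNorm (Y - X) := by
  have : ∀ X Y : Matrix n n ℂ, traceNorm (X - Y) ≤ traceNorm (Y - X) := fun X Y =>
    traceNorm_le fun F hF => by
      rw [← neg_sub Y X, Matrix.mul_neg, Matrix.trace_neg, norm_neg]
      exact (norm_trace_mul_le _ _).trans (mul_le_of_le_one_left (traceNorm_nonneg _) hF)
  exact le_antisymm (this X Y) (this Y X)

theorem traceNorm_add_le (X Y : Matrix n n ℂ) : traceNorm (X + Y) ≤ traceNorm X + traceNorm Y :=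
  traceNorm_le fun F hF => by
    rw [Matrix.mul_add, Matrix.trace_add]
    refine (norm_add_le _ _).trans (add_le_add ?_ ?_) <;>
    exact (norm_trace_mul_le _ _).trans (mul_le_of_le_one_left (traceNorm_nonneg _) hF)

theorem traceNorm_submatrix_equiv {m : Type} [Fintype m] [DecidableEq m] (X : Matrix n n ℂ)
    (e : m ≃ n) : traceNorm (X.submatrix e e) = traceNorm X := by
  have key : ∀ {m n : Type} [Fintype m] [DecidableEq m] [Fintype n] [DecidableEq n]
      (X : Matrix n n ℂ) (e : m ≃ n), traceNorm (X.submatrix e e) ≤ traceNorm X := by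
    intro m n _ _ _ _ X e
    refine traceNorm_le fun F hF => ?_
    have h : (F * X.submatrix e e).trace = (F.submatrix e.symm e.symm * X).trace := by
      simp only [Matrix.trace, Matrix.diag, Matrix.mul_apply, Matrix.submatrix_apply]
      rw [← e.sum_comp (fun i => ∑ j, F (e.symm i) (e.symm j) * X j i)]
      refine Finset.sum_congr rfl fun i _ => ?_
      rw [← e.sum_comp (fun j => F (e.symm (e i)) (e.symm j) * X j (e i))]
      simp
    rw [h]
    refine (norm_trace_mul_le _ _).trans (mul_le_of_le_one_left (traceNorm_nonneg _) ?_)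
    rwa [norm_submatrix_equiv F e.symm]
  refine le_antisymm (key X e) ?_
  have := key (X.submatrix e e) e.symm
  simpa using this

theorem trace_mul_vecMulVec (M : Matrix n n ℂ) (v w : n → ℂ) :
    (M * Matrix.vecMulVec w (star v)).trace = star v ⬝ᵥ M.mulVec w := by
  rw [Matrix.mul_vecMulVec, Matrix.trace_vecMulVec, dotProduct_comm]

theorem traceNorm_vecMulVec_le (v w : n → ℂ) :
    traceNorm (Matrix.vecMulVec w (star v)) ≤ (normSq v + normSq w) / 2 := by
  refine traceNorm_le fun F hF => ?_
  rw [trace_mul_vecMulVec]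
  refine (norm_quad_le F v w).trans (mul_le_of_le_one_left ?_ hF)
  have := normSq_nonneg v
  have := normSq_nonneg w
  positivity

open scoped MatrixOrder in
/-- A positive semidefinite matrix is a sum of positive rank one matrices. -/
theorem posSemidef_eq_sum_vecMulVec {ρ : Matrix n n ℂ} (hρ : ρ.PosSemidef) :
    ∃ u : n → n → ℂ, ρ = ∑ k, Matrix.vecMulVec (u k) (star (u k)) := by
  obtain ⟨B, rfl⟩ : ∃ B : Matrix n n ℂ, ρ = B.conjTranspose * B := by
    exact CStarAlgebra.nonneg_iff_eq_star_mul_self.mp hρ.nonneg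
  refine ⟨fun k i => star (B k i), ?_⟩
  ext i j
  simp [Matrix.mul_apply, Matrix.sum_apply, Matrix.vecMulVec_apply]

theorem trace_vecMulVec_star (v : n → ℂ) :
    (Matrix.vecMulVec v (star v)).trace = (normSq v : ℂ) := by
  rw [Matrix.trace_vecMulVec, normSq]
  simp only [dotProduct, Pi.star_apply, RCLike.star_def, Complex.mul_conj']
  push_cast
  rfl

theorem traceNorm_posSemidef_le {ρ : Matrix n n ℂ} (hρ : ρ.PosSemidef) :
    traceNorm ρ ≤ ρ.trace.re := by
  obtain ⟨u, rfl⟩ := posSemidef_eq_sum_vecMulVec hρ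
  refine traceNorm_le fun F hF => ?_
  rw [Matrix.mul_sum, Matrix.trace_sum, Matrix.trace_sum, Complex.re_sum]
  refine (norm_sum_le _ _).trans (Finset.sum_le_sum fun k _ => ?_)
  rw [trace_vecMulVec_star, Complex.ofReal_re]
  refine (norm_trace_mul_le _ _).trans ((mul_le_of_le_one_left (traceNorm_nonneg _) hF).trans ?_)
  refine (traceNorm_vecMulVec_le _ _).trans (le_of_eq (by ring))

theorem IsState.traceNorm_le_one {ρ : Matrix n n ℂ} (hρ : IsState ρ) : traceNorm ρ ≤ 1 := by
  have := traceNorm_posSemidef_le hρ.1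
  rwa [hρ.2, Complex.one_re] at this

end TraceNorm

/-! ### The dual of a superoperator -/

section Dual

variable {n : Type} [Fintype n] [DecidableEq n]

/-- The dual (Heisenberg picture) of a superoperator, for the trace pairing; see
`trace_dual_mul`. -/
def dual : SuperOp n →ₗ[ℂ] SuperOp n where
  toFun T :=
    { toFun := fun O => Matrix.of fun i j => (O * T (Matrix.single j i 1)).trace
      map_add' := fun O O' => by
        ext i j; simp [Matrix.add_mul]
      map_smul' := fun c O => by
        ext i j; simp }
  map_add' T S := by
    ext O i j
    simp [Matrix.mul_add]
  map_smul' c T := by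
    ext O i j
    simp

theorem superOp_apply_eq_sum (T : SuperOp n) (X : Matrix n n ℂ) (i j : n) :
    T X i j = ∑ a, ∑ b, X a b * T (Matrix.single a b 1) i j := by
  conv_lhs => rw [Matrix.matrix_eq_sum_single X]
  simp only [map_sum, Matrix.sum_apply]
  refine Finset.sum_congr rfl fun a _ => Finset.sum_congr rfl fun b _ => ?_
  have : Matrix.single a b (X a b) = X a b • Matrix.single a b (1 : ℂ) := by simp
  rw [this, map_smul, Matrix.smul_apply, smul_eq_mul]

theorem trace_dual_mul (T : SuperOp n) (O X : Matrix n n ℂ) :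
    (dual T O * X).trace = (O * T X).trace := by
  have h : T X = ∑ a, ∑ b, X a b • T (Matrix.single a b 1) := by
    ext i j
    rw [superOp_apply_eq_sum]
    simp [Matrix.sum_apply]
  rw [h]
  simp only [Matrix.mul_sum, Matrix.trace_sum, Matrix.mul_smul, Matrix.trace_smul, smul_eq_mul]
  rw [Matrix.trace]
  simp only [Matrix.diag, Matrix.mul_apply]
  rw [Finset.sum_comm]
  refine Finset.sum_congr rfl fun a _ => Finset.sum_congr rfl fun b _ => ?_
  rw [mul_comm]; rfl

theorem dual_eq_of_trace {T S : SuperOp n}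
    (h : ∀ O X, (S O * X).trace = (O * T X).trace) : dual T = S := by
  refine LinearMap.ext fun O => Matrix.ext_iff_trace_mul_right.2 fun X => ?_
  rw [trace_dual_mul, h]

theorem dual_mul (T S : SuperOp n) : dual (T * S) = dual S * dual T :=
  dual_eq_of_trace fun O X => by
    rw [Module.End.mul_apply, Module.End.mul_apply, trace_dual_mul, trace_dual_mul]

theorem dual_one : dual (1 : SuperOp n) = 1 := dual_eq_of_trace fun _ _ => rfl

/-- The superoperator `O ↦ tr(τ O) 1`, which evaluates `O` in the state `τ`. -/
def evalMap (τ : Matrix n n ℂ) : SuperOp n where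
  toFun O := (τ * O).trace • 1
  map_add' O O' := by rw [Matrix.mul_add, Matrix.trace_add, add_smul]
  map_smul' c O := by rw [Matrix.mul_smul, Matrix.trace_smul, smul_assoc]; rfl

theorem evalMap_apply (τ O : Matrix n n ℂ) : evalMap τ O = (τ * O).trace • 1 := rfl

end Dual

/-! ### Tensoring with the identity, and the diamond norm -/

section Amp

variable {n : Type} [Fintype n] [DecidableEq n]

/-- The superoperator `T ⊗ id`, with an arbitrary finite index set for the second factor. -/
def amp (T : SuperOp n) (κ : Type) : SuperOp (n × κ) where
  toFun X := Matrix.of fun p q =>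
    T (Matrix.of fun i j => X (i, p.2) (j, q.2)) p.1 q.1
  map_add' X Y := by
    ext p q
    exact congrFun (congrFun (T.map_add (Matrix.of fun i j => X (i, p.2) (j, q.2))
      (Matrix.of fun i j => Y (i, p.2) (j, q.2))) p.1) q.1
  map_smul' c X := by
    ext p q
    exact congrFun (congrFun (T.map_smul c (Matrix.of fun i j => X (i, p.2) (j, q.2))) p.1) q.1

theorem amp_apply (T : SuperOp n) (κ : Type) (X : Matrix (n × κ) (n × κ) ℂ) (p q : n × κ) :
    amp T κ X p q = T (Matrix.of fun i j => X (i, p.2) (j, q.2)) p.1 q.1 := rfl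

variable {κ : Type} [Fintype κ] [DecidableEq κ]

theorem amp_eq_ampliate (T : SuperOp n) {k : ℕ} (f : κ ≃ Fin k) (X : Matrix (n × κ) (n × κ) ℂ) :
    amp T κ X = (ampliate T k (X.submatrix ((Equiv.refl n).prodCongr f.symm)
      ((Equiv.refl n).prodCongr f.symm))).submatrix ((Equiv.refl n).prodCongr f)
      ((Equiv.refl n).prodCongr f) := by
  ext p q
  simp [amp_apply, ampliate]

theorem dual_amp (T : SuperOp n) : dual (amp T κ) = amp (dual T) κ := by
  refine dual_eq_of_trace fun O X => ?_
  have key : ∀ M N : Matrix (n × κ) (n × κ) ℂ, (M * N).trace = ∑ c, ∑ c',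
      ((Matrix.of fun i j => M (i, c) (j, c')) * (Matrix.of fun i j => N (i, c') (j, c))).trace := by
    intro M N
    simp only [Matrix.trace, Matrix.diag, Matrix.mul_apply, Matrix.of_apply, Fintype.sum_prod_type]
    rw [Finset.sum_comm]
    refine Finset.sum_congr rfl fun c _ => ?_
    rw [Finset.sum_comm (s := (Finset.univ : Finset κ))]
    refine Finset.sum_congr rfl fun i _ => ?_
    rw [Finset.sum_comm]
  rw [key, key]
  refine Finset.sum_congr rfl fun c _ => Finset.sum_congr rfl fun c' _ => ?_
  exact trace_dual_mul T (Matrix.of fun i j => O (i, c) (j, c'))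
    (Matrix.of fun i j => X (i, c') (j, c))

theorem quad_eq_sum {m : Type} [Fintype m] (M : Matrix m m ℂ) (v w : m → ℂ) :
    star v ⬝ᵥ M.mulVec w = ∑ i, ∑ j, star (v i) * M i j * w j := by
  simp only [dotProduct, Matrix.mulVec, Finset.mul_sum, Pi.star_apply, mul_assoc]

theorem normSq_prod (v : n × κ → ℂ) : normSq v = ∑ i, normSq fun c => v (i, c) := by
  simp only [normSq, Fintype.sum_prod_type]

theorem normSq_prod' (v : n × κ → ℂ) : normSq v = ∑ c, normSq fun i => v (i, c) := by
  simp only [normSq, Fintype.sum_prod_type_right]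

/-- Evaluation of the first factor in `τ` is bounded by the trace norm of `τ`. -/
theorem norm_amp_evalMap_le (τ : Matrix n n ℂ) (O : Matrix (n × κ) (n × κ) ℂ) :
    ‖amp (evalMap τ) κ O‖ ≤ traceNorm τ * ‖O‖ := by
  refine norm_le_of_quad _ (mul_nonneg (traceNorm_nonneg _) (norm_nonneg _)) fun v w hv hw => ?_
  let N : n → Matrix n n ℂ := fun i => Matrix.of fun a b =>
    ∑ c, ∑ c', star (v (i, c)) * w (i, c') * O (a, c) (b, c')
  have hN : ∀ i, ‖N i‖ ≤ ‖O‖ * ((normSq (fun c => v (i, c)) + normSq fun c => w (i, c)) / 2) := by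
    intro i
    refine norm_le_of_quad _ ?_ fun x y hx hy => ?_
    · have := normSq_nonneg fun c => v (i, c)
      have := normSq_nonneg fun c => w (i, c)
      positivity
    · have h := norm_quad_le O (fun p : n × κ => x p.1 * v (i, p.2))
        (fun p : n × κ => y p.1 * w (i, p.2))
      have hs : ∀ (x : n → ℂ) (v : κ → ℂ), normSq x = 1 →
          normSq (fun p : n × κ => x p.1 * v p.2) = normSq v := by
        intro x v hx
        rw [normSq_prod]
        simp only [normSq, norm_mul, mul_pow, ← Finset.mul_sum] at hx ⊢
        rw [← Finset.sum_mul, hx, one_mul]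
      rw [hs x (fun c => v (i, c)) hx, hs y (fun c => w (i, c)) hy] at h
      convert h using 2
      rw [quad_eq_sum, quad_eq_sum]
      simp only [Fintype.sum_prod_type, N, Matrix.of_apply, Finset.mul_sum, Finset.sum_mul]
      refine Finset.sum_congr rfl fun a _ => ?_
      rw [Finset.sum_comm]
      refine Finset.sum_congr rfl fun c _ => Finset.sum_congr rfl fun b _ =>
        Finset.sum_congr rfl fun c' _ => ?_
      rw [star_mul']
      ring
  have e : star v ⬝ᵥ (amp (evalMap τ) κ O).mulVec w = ∑ i, (N i * τ).trace := by
    rw [quad_eq_sum]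
    simp only [Fintype.sum_prod_type, amp_apply, evalMap_apply, Matrix.smul_apply, smul_eq_mul]
    refine Finset.sum_congr rfl fun i _ => ?_
    have : ∀ c, (∑ j, ∑ c', star (v (i, c)) *
        ((τ * Matrix.of fun a b => O (a, c) (b, c')).trace * (1 : Matrix n n ℂ) i j) * w (j, c')) =
        ∑ c', star (v (i, c)) * w (i, c') * (τ * Matrix.of fun a b => O (a, c) (b, c')).trace := by
      intro c
      rw [Finset.sum_eq_single i]
      · refine Finset.sum_congr rfl fun c' _ => ?_
        rw [Matrix.one_apply_eq]; ring
      · intro j _ hj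
        refine Finset.sum_eq_zero fun c' _ => ?_
        rw [Matrix.one_apply_ne hj.symm]; ring
      · simp
    simp only [this]
    have hNi : N i = ∑ c, ∑ c', (star (v (i, c)) * w (i, c')) •
        (Matrix.of fun a b => O (a, c) (b, c')) := by
      ext a b
      simp [N, Matrix.sum_apply]
    rw [hNi]
    simp only [Matrix.sum_mul, Matrix.trace_sum, Matrix.smul_mul, Matrix.trace_smul, smul_eq_mul]
    refine Finset.sum_congr rfl fun c _ => Finset.sum_congr rfl fun c' _ => ?_
    rw [Matrix.trace_mul_comm]
  rw [e]
  calc _ ≤ ∑ i, ‖O‖ * ((normSq (fun c => v (i, c)) + normSq fun c => w (i, c)) / 2) *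
        traceNorm τ := by
        refine (norm_sum_le _ _).trans (Finset.sum_le_sum fun i _ => ?_)
        exact (norm_trace_mul_le _ _).trans
          (mul_le_mul_of_nonneg_right (hN i) (traceNorm_nonneg _))
    _ = traceNorm τ * ‖O‖ := by
      rw [← Finset.sum_mul, ← Finset.mul_sum, ← Finset.sum_div, Finset.sum_add_distrib,
        ← normSq_prod v, ← normSq_prod w, hv, hw]
      ring

/-- The partial matrix element `⟨b| F |a⟩` of `F`, placed at the position `(p, q)`, is bounded. -/
theorem norm_block_le (F : Matrix (n × κ) (n × κ) ℂ) (p q b a : n) :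
    ‖(Matrix.of fun x y => if x.1 = p ∧ y.1 = q then F (b, x.2) (a, y.2) else 0 :
      Matrix (n × κ) (n × κ) ℂ)‖ ≤ ‖F‖ := by
  refine norm_le_of_quad _ (norm_nonneg _) fun v w hv hw => ?_
  have h := norm_quad_le F (fun x : n × κ => if x.1 = b then v (p, x.2) else 0)
    (fun x : n × κ => if x.1 = a then w (q, x.2) else 0)
  have hs : ∀ (v : n × κ → ℂ) (b p : n), normSq v = 1 →
      normSq (fun x : n × κ => if x.1 = b then v (p, x.2) else 0) ≤ 1 := by
    intro v b p hv
    rw [normSq_prod, Finset.sum_eq_single b]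
    · simp only [if_true]
      rw [← hv, normSq_prod]
      exact Finset.single_le_sum (f := fun i => normSq fun c => v (i, c))
        (fun i _ => normSq_nonneg _) (Finset.mem_univ p)
    · intro i _ hi
      simp [hi, normSq]
    · simp
  have h1 := hs v b p hv
  have h2 := hs w a q hw
  have e : star v ⬝ᵥ (Matrix.of fun x y => if x.1 = p ∧ y.1 = q then F (b, x.2) (a, y.2) else 0 :
      Matrix (n × κ) (n × κ) ℂ).mulVec w =
      star (fun x : n × κ => if x.1 = b then v (p, x.2) else 0) ⬝ᵥ
        F.mulVec (fun x : n × κ => if x.1 = a then w (q, x.2) else 0) := by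
    rw [quad_eq_sum, quad_eq_sum]
    simp only [Fintype.sum_prod_type, Matrix.of_apply]
    rw [Finset.sum_eq_single p, Finset.sum_eq_single b]
    · refine Finset.sum_congr rfl fun c _ => ?_
      rw [Finset.sum_eq_single q, Finset.sum_eq_single a]
      · simp
      · intro i _ hi; simp [hi]
      · simp
      · intro i _ hi; simp [hi]
      · simp
    · intro i _ hi; simp [hi]
    · simp
    · intro i _ hi; simp [hi]
    · simp
  rw [e]
  refine h.trans (mul_le_of_le_one_right (norm_nonneg _) ?_)
  linarith

/-- The superoperators `T ⊗ id` are bounded in trace norm, uniformly in the second factor. -/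
theorem exists_traceNorm_amp_le (T : SuperOp n) : ∃ C : ℝ, 0 ≤ C ∧
    ∀ (κ : Type) [Fintype κ] [DecidableEq κ] (X : Matrix (n × κ) (n × κ) ℂ),
      traceNorm (amp T κ X) ≤ C * traceNorm X := by
  refine ⟨∑ a, ∑ b, ∑ i, ∑ j, ‖T (Matrix.single i j 1) a b‖, by positivity, ?_⟩
  intro κ _ _ X
  refine traceNorm_le fun F hF => ?_
  have e : (F * amp T κ X).trace = ∑ a, ∑ b, ∑ i, ∑ j, T (Matrix.single i j 1) a b *
      ((Matrix.of fun x y => if x.1 = j ∧ y.1 = i then F (b, x.2) (a, y.2) else 0 :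
        Matrix (n × κ) (n × κ) ℂ) * X).trace := by
    have h1 : ∀ a b i j, ((Matrix.of fun x y => if x.1 = j ∧ y.1 = i then F (b, x.2) (a, y.2)
        else 0 : Matrix (n × κ) (n × κ) ℂ) * X).trace =
        ∑ c, ∑ c', F (b, c) (a, c') * X (i, c') (j, c) := by
      intro a b i j
      simp only [Matrix.trace, Matrix.diag, Matrix.mul_apply, Fintype.sum_prod_type,
        Matrix.of_apply]
      rw [Finset.sum_eq_single j]
      · refine Finset.sum_congr rfl fun c _ => ?_
        rw [Finset.sum_eq_single i]
        · simp
        · intro k _ hk; simp [hk]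
        · simp
      · intro k _ hk; simp [hk]
      · simp
    simp only [h1]
    simp only [Matrix.trace, Matrix.diag, Matrix.mul_apply, Fintype.sum_prod_type, amp_apply]
    have h2 : ∀ (c c' : κ) (a b : n), T (Matrix.of fun i j => X (i, c') (j, c)) a b =
        ∑ i, ∑ j, X (i, c') (j, c) * T (Matrix.single i j 1) a b := fun c c' a b =>
      superOp_apply_eq_sum T _ a b
    simp only [h2, Finset.mul_sum]
    have h3 : ∀ f : n → κ → n → κ → n → n → ℂ,
        ∑ b, ∑ c, ∑ a, ∑ c', ∑ i, ∑ j, f b c a c' i j =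
        ∑ a, ∑ b, ∑ i, ∑ j, ∑ c, ∑ c', f b c a c' i j := by
      intro f
      calc _ = ∑ x : n × κ × n × κ × n × n,
            f x.1 x.2.1 x.2.2.1 x.2.2.2.1 x.2.2.2.2.1 x.2.2.2.2.2 := by
              simp only [Fintype.sum_prod_type]
        _ = ∑ y : n × n × n × n × κ × κ,
            f y.2.1 y.2.2.2.2.1 y.1 y.2.2.2.2.2 y.2.2.1 y.2.2.2.1 :=
              Fintype.sum_equiv
                { toFun := fun x => (x.2.2.1, x.1, x.2.2.2.2.1, x.2.2.2.2.2, x.2.1, x.2.2.2.1)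
                  invFun := fun y => (y.2.1, y.2.2.2.2.1, y.1, y.2.2.2.2.2, y.2.2.1, y.2.2.2.1)
                  left_inv := fun _ => rfl
                  right_inv := fun _ => rfl } _ _ fun _ => rfl
        _ = _ := by simp only [Fintype.sum_prod_type]
    rw [h3]
    refine Finset.sum_congr rfl fun a _ => Finset.sum_congr rfl fun b _ =>
      Finset.sum_congr rfl fun i _ => Finset.sum_congr rfl fun j _ =>
      Finset.sum_congr rfl fun c _ => Finset.sum_congr rfl fun c' _ => ?_
    ring
  rw [e]
  simp only [Finset.sum_mul]
  refine (norm_sum_le _ _).trans (Finset.sum_le_sum fun a _ => ?_)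
  refine (norm_sum_le _ _).trans (Finset.sum_le_sum fun b _ => ?_)
  refine (norm_sum_le _ _).trans (Finset.sum_le_sum fun i _ => ?_)
  refine (norm_sum_le _ _).trans (Finset.sum_le_sum fun j _ => ?_)
  rw [norm_mul]
  refine mul_le_mul_of_nonneg_left ?_ (norm_nonneg _)
  refine (norm_trace_mul_le _ _).trans (mul_le_of_le_one_left (traceNorm_nonneg _) ?_)
  exact (norm_block_le F j i b a).trans hF

theorem diamondNorm_nonneg (T : SuperOp n) : 0 ≤ diamondNorm T := by
  refine Real.sSup_nonneg ?_
  rintro r ⟨k, X, _, rfl⟩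
  exact div_nonneg (traceNorm_nonneg _) (traceNorm_nonneg _)

theorem traceNorm_amp_le (T : SuperOp n) (X : Matrix (n × κ) (n × κ) ℂ) :
    traceNorm (amp T κ X) ≤ diamondNorm T * traceNorm X := by
  have f := Fintype.equivFin κ
  rw [amp_eq_ampliate T f, traceNorm_submatrix_equiv]
  rw [← traceNorm_submatrix_equiv X ((Equiv.refl n).prodCongr f.symm)]
  set Y := X.submatrix ((Equiv.refl n).prodCongr f.symm) ((Equiv.refl n).prodCongr f.symm)
  obtain ⟨C, hC0, hC⟩ := exists_traceNorm_amp_le T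
  have hC' : ∀ (k : ℕ) (Y : Matrix (n × Fin k) (n × Fin k) ℂ),
      traceNorm (ampliate T k Y) ≤ C * traceNorm Y := fun k Y => hC (Fin k) Y
  rcases eq_or_lt_of_le (traceNorm_nonneg Y) with h0 | h0
  · have := hC' _ Y
    rw [← h0, mul_zero] at this ⊢
    exact this
  · rw [← div_le_iff₀ h0]
    refine le_csSup ⟨C, ?_⟩ ⟨_, Y, ?_, rfl⟩
    · rintro r ⟨k, Z, _, rfl⟩
      exact div_le_of_le_mul₀ (traceNorm_nonneg _) hC0 (hC' k Z)
    · rintro h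
      rw [h, traceNorm_zero] at h0
      exact lt_irrefl _ h0

theorem norm_amp_dual_le (T : SuperOp n) (O : Matrix (n × κ) (n × κ) ℂ) :
    ‖amp (dual T) κ O‖ ≤ diamondNorm T * ‖O‖ := by
  refine norm_le_of_quad _ (mul_nonneg (diamondNorm_nonneg _) (norm_nonneg _)) fun v w hv hw => ?_
  rw [← trace_mul_vecMulVec, ← dual_amp, trace_dual_mul]
  refine (norm_trace_mul_le _ _).trans ?_
  rw [mul_comm]
  refine mul_le_mul_of_nonneg_right ((traceNorm_amp_le _ _).trans ?_) (norm_nonneg _)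
  refine mul_le_of_le_one_right (diamondNorm_nonneg _) ((traceNorm_vecMulVec_le v w).trans ?_)
  rw [hv, hw]; norm_num

theorem IsCPTP.posSemidef_amp {S : SuperOp n} (hS : IsCPTP S) {X : Matrix (n × κ) (n × κ) ℂ}
    (hX : X.PosSemidef) : (amp S κ X).PosSemidef := by
  rw [amp_eq_ampliate S (Fintype.equivFin κ)]
  exact (hS.1 _ _ (hX.submatrix _)).submatrix _

theorem IsCPTP.trace_amp {S : SuperOp n} (hS : IsCPTP S) (X : Matrix (n × κ) (n × κ) ℂ) :
    (amp S κ X).trace = X.trace := by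
  simp only [Matrix.trace, Matrix.diag, Fintype.sum_prod_type_right]
  refine Finset.sum_congr rfl fun c _ => ?_
  exact hS.2 (Matrix.of fun i j => X (i, c) (j, c))

/-- The dual of a completely positive and trace preserving map is a contraction, also after
tensoring with the identity: apply the map to the positive operator
`(w ⊕ v) (w ⊕ v)†` with an additional qubit. -/
theorem IsCPTP.norm_amp_dual_le {S : SuperOp n} (hS : IsCPTP S) (O : Matrix (n × κ) (n × κ) ℂ) :
    ‖amp (dual S) κ O‖ ≤ ‖O‖ := by
  refine norm_le_of_quad _ (norm_nonneg _) fun v w hv hw => ?_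
  rw [← trace_mul_vecMulVec, ← dual_amp, trace_dual_mul]
  let z : n × (κ × Bool) → ℂ := fun p => if p.2.2 then v (p.1, p.2.1) else w (p.1, p.2.1)
  have hz : normSq z = 2 := by
    simp only [normSq, Fintype.sum_prod_type, z, Fintype.sum_bool, if_true] at hv hw ⊢
    simp only [Bool.false_eq_true, if_false, Finset.sum_add_distrib, hv, hw]
    norm_num
  set Z := Matrix.vecMulVec z (star z) with hZdef
  have hZ : Z.PosSemidef := Matrix.posSemidef_vecMulVec_self_star z
  obtain ⟨u, hu⟩ := posSemidef_eq_sum_vecMulVec (hS.posSemidef_amp hZ)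
  have hblock : amp S κ (Matrix.vecMulVec w (star v)) =
      ∑ k, Matrix.vecMulVec (fun p : n × κ => u k (p.1, (p.2, false)))
        (star fun p : n × κ => u k (p.1, (p.2, true))) := by
    have : amp S κ (Matrix.vecMulVec w (star v)) = (amp S (κ × Bool) Z).submatrix
        (fun p : n × κ => (p.1, (p.2, false))) (fun p : n × κ => (p.1, (p.2, true))) := by
      ext p q
      simp [amp_apply, Z, z, Matrix.vecMulVec_apply]
    rw [this, hu]
    ext p q
    simp [Matrix.sum_apply, Matrix.vecMulVec_apply]
  have htr : ∑ k, normSq (u k) = 2 := by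
    have h := hS.trace_amp Z
    rw [hu, Matrix.trace_sum, hZdef, trace_vecMulVec_star, hz] at h
    simp only [trace_vecMulVec_star] at h
    exact_mod_cast h
  rw [hblock, Matrix.mul_sum, Matrix.trace_sum]
  calc _ ≤ ∑ k, ‖O‖ * (normSq (u k) / 2) := by
        refine (norm_sum_le _ _).trans (Finset.sum_le_sum fun k _ => ?_)
        rw [trace_mul_vecMulVec]
        refine (norm_quad_le _ _ _).trans (le_of_eq ?_)
        congr 2
        simp only [normSq, Fintype.sum_prod_type, Fintype.sum_bool, Finset.sum_add_distrib]
    _ = ‖O‖ := by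
        rw [← Finset.mul_sum, ← Finset.sum_div, htr]; norm_num

end Amp

/-! ### The Heisenberg picture -/

section Heisenberg

variable {n : Type} [Fintype n] [DecidableEq n]

/-- A superoperator, as a bounded operator for the operator norm. -/
def toCLM : SuperOp n ≃ₐ[ℂ] (Matrix n n ℂ →L[ℂ] Matrix n n ℂ) :=
  Module.End.toContinuousLinearMap (Matrix n n ℂ)

theorem toCLM_apply (T : SuperOp n) (O : Matrix n n ℂ) : toCLM T O = T O := rfl

theorem semigroup_intertwine {V W : Type*} [NormedAddCommGroup V] [NormedSpace ℂ V]
    [CompleteSpace V] [NormedAddCommGroup W] [NormedSpace ℂ W] [CompleteSpace W]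
    {G : V →L[ℂ] V} {H : W →L[ℂ] W} (J : V →L[ℂ] W) (hJ : ∀ O, J (G O) = H (J O)) (O : V)
    (t : ℝ) : semigroup H t (J O) = J (semigroup G t O) := by
  let B : (W →L[ℂ] W) →L[ℝ] W →L[ℝ] W := ContinuousLinearMap.restrictScalarsL ℂ W W ℝ ℝ
  have hd : ∀ s : ℝ, HasDerivAt (fun s => semigroup H (t - s) (J (semigroup G s O))) 0 s := by
    intro s
    have h1 : HasDerivAt (fun s => semigroup H (t - s)) (- (semigroup H (t - s) * H)) s := by
      have h := hasDerivAt_exp_smul_const (𝕂 := ℝ) H (t - s)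
      have h2 : HasDerivAt (fun s : ℝ => t - s) (-1) s := by
        simpa using (hasDerivAt_id s).const_sub t
      have := h.scomp s h2
      simpa [semigroup, Function.comp_def] using this
    have h2 : HasDerivAt (fun s => J (semigroup G s O)) (J (G (semigroup G s O))) s :=
      (J.restrictScalars ℝ).hasFDerivAt.comp_hasDerivAt s (hasDerivAt_semigroup G O s)
    have h3 : HasDerivAt (fun s => B (semigroup H (t - s))) (B (- (semigroup H (t - s) * H))) s :=
      B.hasFDerivAt.comp_hasDerivAt s h1
    have h4 := h3.clm_apply h2
    refine h4.congr_deriv ?_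
    change (- (semigroup H (t - s) * H)) (J (semigroup G s O)) +
      semigroup H (t - s) (J (G (semigroup G s O))) = 0
    simp [hJ]
  have := is_const_of_deriv_eq_zero (fun s => (hd s).differentiableAt) (fun s => (hd s).deriv) 0 t
  simpa [semigroup_zero] using this

/-- A homomorphism of algebras maps semigroups to semigroups. -/
theorem map_semigroup {m : Type} [Fintype m] [DecidableEq m]
    (φ : SuperOp n →ₐ[ℂ] SuperOp m) (G : Matrix n n ℂ →L[ℂ] Matrix n n ℂ) (t : ℝ) :
    toCLM (φ (toCLM.symm (semigroup G t))) = semigroup (toCLM (φ (toCLM.symm G))) t := by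
  let _ : NormedAlgebra ℚ (Matrix n n ℂ →L[ℂ] Matrix n n ℂ) :=
    NormedAlgebra.restrictScalars ℚ ℝ _
  let _ : NormedAlgebra ℚ (Matrix m m ℂ →L[ℂ] Matrix m m ℂ) :=
    NormedAlgebra.restrictScalars ℚ ℝ _
  let ψ : (Matrix n n ℂ →L[ℂ] Matrix n n ℂ) →ₐ[ℂ] (Matrix m m ℂ →L[ℂ] Matrix m m ℂ) :=
    (toCLM.toAlgHom.comp φ).comp toCLM.symm.toAlgHom
  have hc : Continuous ψ := ψ.toLinearMap.continuous_of_finiteDimensional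
  have h := NormedSpace.map_exp ψ hc (t • G)
  have e : ψ (t • G) = t • ψ G := by
    have h1 : ∀ (t : ℝ) (A : Matrix n n ℂ →L[ℂ] Matrix n n ℂ), t • A = (t : ℂ) • A :=
      fun t A => (Complex.coe_smul t A).symm
    have h2 : ∀ (t : ℝ) (A : Matrix m m ℂ →L[ℂ] Matrix m m ℂ), t • A = (t : ℂ) • A :=
      fun t A => (Complex.coe_smul t A).symm
    rw [h1, map_smul, h2]
  rw [e] at h
  exact h

/-- The evolution of a state and the semigroup of the dual generator are dual to each other. -/
theorem toCLM_dual_evolve (L : SuperOp n) (t : ℝ) :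
    toCLM (dual (evolve L t)) = semigroup (toCLM (dual L)) t := by
  let b := Matrix.stdBasis ℂ n n
  let _ : NormedAlgebra ℚ (Matrix n n ℂ →L[ℂ] Matrix n n ℂ) :=
    NormedAlgebra.restrictScalars ℚ ℝ _
  let _ : NormedAlgebra ℚ (Matrix (n × n) (n × n) ℂ) :=
    NormedAlgebra.restrictScalars ℚ ℂ _
  let _ : Algebra ℚ (Matrix n n ℂ →L[ℂ] Matrix n n ℂ)ᵐᵒᵖ := inferInstance
  let f : Matrix (n × n) (n × n) ℂ →ₗ[ℂ] (Matrix n n ℂ →L[ℂ] Matrix n n ℂ)ᵐᵒᵖ :=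
    (MulOpposite.opLinearEquiv ℂ).toLinearMap ∘ₗ toCLM.toLinearMap ∘ₗ dual ∘ₗ
      (Matrix.toLin b b).toLinearMap
  let g : Matrix (n × n) (n × n) ℂ →+* (Matrix n n ℂ →L[ℂ] Matrix n n ℂ)ᵐᵒᵖ :=
    { toFun := f
      map_one' := by
        change MulOpposite.op (toCLM (dual (Matrix.toLin b b 1))) = 1
        rw [Matrix.toLin_one]
        change MulOpposite.op (toCLM (dual (1 : SuperOp n))) = 1
        rw [dual_one, map_one, MulOpposite.op_one]
      map_mul' := fun A B => by
        change MulOpposite.op (toCLM (dual (Matrix.toLin b b (A * B)))) = _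
        rw [Matrix.toLin_mul b b b]
        change MulOpposite.op (toCLM (dual (Matrix.toLin b b A * Matrix.toLin b b B))) = _
        rw [dual_mul, map_mul, MulOpposite.op_mul]
        rfl
      map_zero' := map_zero f
      map_add' := map_add f }
  have hg : Continuous g := f.continuous_of_finiteDimensional
  have h := NormedSpace.map_exp g hg ((t : ℂ) • LinearMap.toMatrix b b L)
  have e : g ((t : ℂ) • LinearMap.toMatrix b b L) = MulOpposite.op (t • toCLM (dual L)) := by
    change f _ = _
    rw [map_smul]
    change (t : ℂ) • MulOpposite.op (toCLM (dual (Matrix.toLin b b (LinearMap.toMatrix b b L)))) = _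
    rw [Matrix.toLin_toMatrix, ← MulOpposite.op_smul]
    exact congrArg MulOpposite.op (Complex.coe_smul t (toCLM (dual L)))
  rw [e] at h
  exact MulOpposite.op_injective (h.trans (NormedSpace.exp_op (t • toCLM (dual L))))

theorem trace_mul_evolve (L : SuperOp n) (t : ℝ) (O X : Matrix n n ℂ) :
    (O * evolve L t X).trace = (semigroup (toCLM (dual L)) t O * X).trace := by
  rw [← trace_dual_mul, ← toCLM_dual_evolve]; rfl

/-- A Lindbladian annihilates the trace, i.e. its dual annihilates the identity. -/
theorem IsLindbladian.dual_one_eq_zero {L : SuperOp n} (hL : IsLindbladian L) : dual L 1 = 0 := by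
  have h : ∀ t : ℝ, 0 ≤ t → semigroup (toCLM (dual L)) t 1 = 1 := by
    intro t ht
    refine Matrix.ext_iff_trace_mul_right.2 fun X => ?_
    rw [← trace_mul_evolve, Matrix.one_mul, Matrix.one_mul, (hL t ht).2]
  have h1 := (hasDerivAt_semigroup (toCLM (dual L)) (1 : Matrix n n ℂ) 0).hasDerivWithinAt
    (s := Set.Ici 0)
  have h2 : HasDerivWithinAt (fun s => semigroup (toCLM (dual L)) s (1 : Matrix n n ℂ))
      (0 : Matrix n n ℂ) (Set.Ici 0) 0 := by
    refine (hasDerivWithinAt_const (0 : ℝ) (Set.Ici 0) (1 : Matrix n n ℂ)).congr_of_mem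
      (fun s hs => h s hs) Set.self_mem_Ici
  have := (uniqueDiffOn_Ici (0 : ℝ) 0 Set.self_mem_Ici).eq_deriv _ h1 h2
  rw [semigroup_zero] at this
  exact this

end Heisenberg

/-! ### Embeddings between regions of the lattice -/

section Lattice

variable {D : ℕ} {d : Site D → ℕ} {Z Y Λ X b : Finset (Site D)}

/-- Replace the part of the configuration `σ` on `Z` by `a`. -/
def upd (σ : Conf d Λ) (a : Conf d Z) : Conf d Λ :=
  fun x => if h : x.1 ∈ Z then a ⟨x.1, h⟩ else σ x

theorem restrict_upd (h : Z ⊆ Λ) (σ : Conf d Λ) (a : Conf d Z) : restrict h (upd σ a) = a := by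
  ext x; simp [restrict, upd]

theorem restrict_upd_of_disjoint (h : Y ⊆ Λ) (hd : Disjoint Y Z) (σ : Conf d Λ) (a : Conf d Z) :
    restrict h (upd σ a) = restrict h σ := by
  ext x
  have : x.1 ∉ Z := Finset.disjoint_left.1 hd x.2
  simp [restrict, upd, this]

theorem upd_upd (σ : Conf d Λ) (a c : Conf d Z) : upd (upd σ a) c = upd σ c := by
  ext x; by_cases h : x.1 ∈ Z <;> simp [upd, h]

theorem upd_comm (hd : Disjoint Y Z) (σ : Conf d Λ) (a : Conf d Y) (c : Conf d Z) :
    upd (upd σ a) c = upd (upd σ c) a := by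
  ext x
  by_cases h : x.1 ∈ Z
  · have : x.1 ∉ Y := Finset.disjoint_right.1 hd h
    simp [upd, h, this]
  · by_cases h' : x.1 ∈ Y <;> simp [upd, h, h']

theorem upd_restrict (h : Z ⊆ Λ) (σ : Conf d Λ) : upd σ (restrict h σ) = σ := by
  ext x; by_cases h : x.1 ∈ Z <;> simp [upd, restrict, h]

theorem embed_apply (h : Z ⊆ Λ) (T : SuperOp (Conf d Z)) (M : Op d Λ) (σ τ : Conf d Λ) :
    embed h T M σ τ =
      T (Matrix.of fun a b => M (upd σ a) (upd τ b)) (restrict h σ) (restrict h τ) := rfl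

/-- Configurations on `Λ` are pairs of configurations on `Z` and on `Λ \ Z`. -/
def splitEquiv (d : Site D → ℕ) (h : Z ⊆ Λ) : Conf d Λ ≃ Conf d Z × Conf d (Λ \ Z) where
  toFun σ := (restrict h σ, restrict Finset.sdiff_subset σ)
  invFun p := glue p.1 p.2
  left_inv σ := upd_restrict h σ
  right_inv p := by
    refine Prod.ext ?_ ?_
    · ext x; simp [restrict, glue]
    · ext x
      have := (Finset.mem_sdiff.1 x.2).2
      simp [restrict, glue, this]

theorem embed_eq_amp (h : Z ⊆ Λ) (T : SuperOp (Conf d Z)) (M : Op d Λ) :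
    embed h T M = (amp T (Conf d (Λ \ Z)) (M.submatrix (splitEquiv d h).symm
      (splitEquiv d h).symm)).submatrix (splitEquiv d h) (splitEquiv d h) := rfl

theorem trace_submatrix_mul {m n : Type} [Fintype m] [Fintype n] (e : m ≃ n)
    (M : Matrix n n ℂ) (N : Matrix m m ℂ) :
    (M.submatrix e e * N).trace = (M * N.submatrix e.symm e.symm).trace := by
  simp only [Matrix.trace, Matrix.diag, Matrix.mul_apply, Matrix.submatrix_apply]
  rw [← e.sum_comp]
  refine Finset.sum_congr rfl fun i _ => ?_
  rw [← e.sum_comp]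
  simp

theorem dual_embed (h : Z ⊆ Λ) (T : SuperOp (Conf d Z)) :
    dual (embed h T) = embed h (dual T) := by
  refine dual_eq_of_trace fun O M => ?_
  rw [embed_eq_amp, trace_submatrix_mul, ← dual_amp, trace_dual_mul, Matrix.trace_mul_comm,
    ← trace_submatrix_mul, Matrix.trace_mul_comm, embed_eq_amp]

theorem norm_embed_evalMap_le (h : Z ⊆ Λ) (τ : Op d Z) (O : Op d Λ) :
    ‖embed h (evalMap τ) O‖ ≤ traceNorm τ * ‖O‖ := by
  rw [embed_eq_amp, norm_submatrix_equiv]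
  refine (norm_amp_evalMap_le _ _).trans_eq ?_
  rw [norm_submatrix_equiv]

theorem norm_embed_dual_le (h : Z ⊆ Λ) (T : SuperOp (Conf d Z)) (O : Op d Λ) :
    ‖embed h (dual T) O‖ ≤ diamondNorm T * ‖O‖ := by
  rw [embed_eq_amp, norm_submatrix_equiv]
  refine (norm_amp_dual_le _ _).trans_eq ?_
  rw [norm_submatrix_equiv]

theorem IsCPTP.norm_embed_dual_le (h : Z ⊆ Λ) {T : SuperOp (Conf d Z)} (hT : IsCPTP T)
    (O : Op d Λ) : ‖embed h (dual T) O‖ ≤ ‖O‖ := by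
  rw [embed_eq_amp, norm_submatrix_equiv]
  refine (hT.norm_amp_dual_le _).trans_eq ?_
  rw [norm_submatrix_equiv]

theorem embed_mul (h : Z ⊆ Λ) (T S : SuperOp (Conf d Z)) :
    embed h (T * S) = embed h T * embed h S := by
  refine LinearMap.ext fun M => ?_
  ext σ τ
  rw [Module.End.mul_apply]
  simp only [embed_apply, upd_upd, restrict_upd, Module.End.mul_apply]
  rfl

theorem embed_one (h : Z ⊆ Λ) : embed h (1 : SuperOp (Conf d Z)) = 1 := by
  refine LinearMap.ext fun M => ?_
  ext σ τ
  simp [embed_apply, upd_restrict]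

/-- The embedding `T ↦ T ⊗ id` as a homomorphism of algebras. -/
def embedHom (d : Site D → ℕ) (h : Z ⊆ Λ) : SuperOp (Conf d Z) →ₐ[ℂ] SuperOp (Conf d Λ) :=
  AlgHom.ofLinearMap
    { toFun := embed h
      map_add' := fun _ _ => rfl
      map_smul' := fun _ _ => rfl } (embed_one h) (embed_mul h)

theorem commute_embed (hY : Y ⊆ Λ) (hZ : Z ⊆ Λ) (hd : Disjoint Y Z) (S : SuperOp (Conf d Y))
    (T : SuperOp (Conf d Z)) : Commute (embed hY S) (embed hZ T) := by
  refine LinearMap.ext fun M => ?_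
  ext σ τ
  rw [Module.End.mul_apply, Module.End.mul_apply]
  simp only [embed_apply, restrict_upd_of_disjoint hZ hd.symm, restrict_upd_of_disjoint hY hd]
  rw [superOp_apply_eq_sum S, superOp_apply_eq_sum T]
  simp only [Matrix.of_apply]
  simp_rw [superOp_apply_eq_sum T (Matrix.of _), superOp_apply_eq_sum S (Matrix.of _)]
  simp only [Matrix.of_apply, Finset.sum_mul]
  simp only [← Fintype.sum_prod_type', upd_comm hd]
  refine Fintype.sum_equiv
    { toFun := fun x => (x.2.2.1, x.2.2.2, x.1, x.2.1)
      invFun := fun x => (x.2.2.1, x.2.2.2, x.1, x.2.1)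
      left_inv := fun _ => rfl
      right_inv := fun _ => rfl } _ _ fun x => ?_
  simp only [Equiv.coe_fn_mk]
  ring

theorem embed_embed (hZ : Z ⊆ b) (hb : b ⊆ Λ) (T : SuperOp (Conf d Z)) :
    embed hb (embed hZ T) = embed (hZ.trans hb) T := by
  have key : ∀ (σ : Conf d Λ) (i : Conf d Z), upd σ (upd (restrict hb σ) i) = upd σ i := by
    intro σ i
    ext x
    by_cases h : x.1 ∈ Z
    · simp [upd, h, hZ h]
    · by_cases h' : x.1 ∈ b <;> simp [upd, h, h', restrict]
  refine LinearMap.ext fun M => ?_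
  ext σ τ
  simp only [embed_apply, Matrix.of_apply, key]
  rfl

/-- The operator `F ⊗ 1` on `Λ`, for an operator `F` on `X ⊆ Λ`. -/
def lift (h : X ⊆ Λ) : Op d X →ₗ[ℂ] Op d Λ where
  toFun F := Matrix.of fun σ τ =>
    if restrict (Finset.sdiff_subset (s := Λ) (t := X)) σ = restrict Finset.sdiff_subset τ
    then F (restrict h σ) (restrict h τ) else 0
  map_add' F G := by
    ext σ τ; simp only [Matrix.of_apply, Matrix.add_apply]; split_ifs <;> simp
  map_smul' c F := by
    ext σ τ; simp only [Matrix.of_apply, Matrix.smul_apply, RingHom.id_apply]; split_ifs <;> simp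

theorem restrict_eq_iff (h : X ⊆ Λ) (σ τ : Conf d Λ) :
    restrict h σ = restrict h τ ↔ ∀ x : Λ, x.1 ∈ X → σ x = τ x := by
  constructor
  · intro e x hx
    exact congrFun e ⟨x.1, hx⟩
  · intro e
    ext x
    exact congrArg _ (e ⟨x.1, h x.2⟩ x.2)

theorem lift_apply (h : X ⊆ Λ) (F : Op d X) (σ τ : Conf d Λ) [Decidable (∀ x : Λ, x.1 ∉ X → σ x = τ x)] :
    lift h F σ τ =
      if ∀ x : Λ, x.1 ∉ X → σ x = τ x then F (restrict h σ) (restrict h τ) else 0 := by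
  have : (restrict (Finset.sdiff_subset (s := Λ) (t := X)) σ = restrict Finset.sdiff_subset τ) ↔
      ∀ x : Λ, x.1 ∉ X → σ x = τ x := by
    rw [restrict_eq_iff]
    exact ⟨fun e x hx => e x (Finset.mem_sdiff.2 ⟨x.2, hx⟩),
      fun e x hx => e x (Finset.mem_sdiff.1 hx).2⟩
  simp only [← this]
  rfl

theorem lift_one (h : X ⊆ Λ) : lift h (1 : Op d X) = 1 := by
  classical
  ext σ τ
  rw [lift_apply, Matrix.one_apply, Matrix.one_apply]
  by_cases e : σ = τ
  · simp [e]
  · rw [if_neg e]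
    split_ifs with h1 h2
    · exfalso
      apply e
      ext x
      by_cases hx : x.1 ∈ X
      · exact congrArg _ ((restrict_eq_iff h σ τ).1 h2 x hx)
      · exact congrArg _ (h1 x hx)
    · rfl
    · rfl

theorem lift_lift (hX : X ⊆ b) (hb : b ⊆ Λ) (F : Op d X) :
    lift hb (lift hX F) = lift (hX.trans hb) F := by
  classical
  ext σ τ
  rw [lift_apply, lift_apply, lift_apply]
  by_cases h1 : ∀ x : Λ, x.1 ∉ b → σ x = τ x
  · rw [if_pos h1]
    have : (∀ x : b, x.1 ∉ X → restrict hb σ x = restrict hb τ x) ↔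
        ∀ x : Λ, x.1 ∉ X → σ x = τ x := by
      constructor
      · intro e x hx
        by_cases hxb : x.1 ∈ b
        · exact e ⟨x.1, hxb⟩ hx
        · exact h1 x hxb
      · intro e x hx
        exact e ⟨x.1, hb x.2⟩ hx
    simp only [this]
    rfl
  · rw [if_neg h1, if_neg]
    exact fun e => h1 fun x hx => e x fun hxX => hx (hX hxX)

theorem embed_lift (hZ : Z ⊆ b) (hb : b ⊆ Λ) (T : SuperOp (Conf d Z)) (O : Op d b) :
    embed (hZ.trans hb) T (lift hb O) = lift hb (embed hZ T O) := by
  classical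
  ext σ τ
  rw [embed_apply, lift_apply]
  have h1 : ∀ (σ τ : Conf d Λ) (i j : Conf d Z),
      (∀ x : Λ, x.1 ∉ b → upd σ i x = upd τ j x) ↔ ∀ x : Λ, x.1 ∉ b → σ x = τ x := by
    intro σ τ i j
    refine forall_congr' fun x => forall_congr' fun hx => ?_
    have : x.1 ∉ Z := fun h => hx (hZ h)
    simp [upd, this]
  have h2 : ∀ (σ : Conf d Λ) (i : Conf d Z), restrict hb (upd σ i) = upd (restrict hb σ) i := by
    intro σ i
    rfl
  simp only [lift_apply, h1, h2]
  split_ifs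
  · rfl
  · have : (Matrix.of fun (_ _ : Conf d Z) => (0 : ℂ)) = 0 := rfl
    rw [this, map_zero]; rfl

/-- A superoperator acts trivially on an operator supported off its region. -/
theorem embed_lift_of_disjoint (hZ : Z ⊆ Λ) (hX : X ⊆ Λ) (hd : Disjoint Z X)
    {T : SuperOp (Conf d Z)} {c : ℂ} (hT : T 1 = c • 1) (F : Op d X) :
    embed hZ T (lift hX F) = c • lift hX F := by
  classical
  ext σ τ
  have h1 : ∀ i j : Conf d Z, lift hX F (upd σ i) (upd τ j) =
      (if ∀ x : Λ, x.1 ∉ X → x.1 ∉ Z → σ x = τ x then F (restrict hX σ) (restrict hX τ) else 0) *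
        (1 : Op d Z) i j := by
    intro i j
    rw [lift_apply, restrict_upd_of_disjoint hX hd.symm, restrict_upd_of_disjoint hX hd.symm,
      Matrix.one_apply]
    have : (∀ x : Λ, x.1 ∉ X → upd σ i x = upd τ j x) ↔
        (∀ x : Λ, x.1 ∉ X → x.1 ∉ Z → σ x = τ x) ∧ i = j := by
      constructor
      · intro e
        refine ⟨fun x hx hz => ?_, ?_⟩
        · have := e x hx
          simpa [upd, hz] using this
        · ext x
          have := e ⟨x.1, hZ x.2⟩ (Finset.disjoint_left.1 hd x.2)
          simp only [upd, x.2, dite_true] at this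
          exact congrArg _ this
      · rintro ⟨e, rfl⟩ x hx
        by_cases hz : x.1 ∈ Z
        · simp [upd, hz]
        · simpa [upd, hz] using e x hx hz
    simp only [this]
    by_cases h1 : ∀ x : Λ, x.1 ∉ X → x.1 ∉ Z → σ x = τ x <;> by_cases h2 : i = j <;> simp [h2]
  rw [embed_apply]
  simp only [h1]
  have h2 : ∀ k : ℂ, (Matrix.of fun i j => k * (1 : Op d Z) i j) = k • (1 : Op d Z) := by
    intro k; ext i j; simp
  rw [h2, map_smul, hT, Matrix.smul_apply, Matrix.smul_apply, Matrix.smul_apply, lift_apply,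
    Matrix.one_apply, smul_eq_mul, smul_eq_mul]
  have : (∀ x : Λ, x.1 ∉ X → σ x = τ x) ↔
      (∀ x : Λ, x.1 ∉ X → x.1 ∉ Z → σ x = τ x) ∧ restrict hZ σ = restrict hZ τ := by
    rw [restrict_eq_iff]
    constructor
    · exact fun e => ⟨fun x hx _ => e x hx, fun x hx => e x (Finset.disjoint_left.1 hd hx)⟩
    · rintro ⟨e1, e2⟩ x hx
      by_cases hz : x.1 ∈ Z
      · exact e2 x hz
      · exact e1 x hx hz
  simp only [this]
  by_cases h1 : ∀ x : Λ, x.1 ∉ X → x.1 ∉ Z → σ x = τ x <;>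
    by_cases h2 : restrict hZ σ = restrict hZ τ <;> simp [h2, mul_comm]

theorem trace_lift_mul (h : X ⊆ Λ) (F : Op d X) (ρ : Op d Λ) :
    (lift h F * ρ).trace = (F * reduce X ρ).trace := by
  have e1 : lift h F = (Matrix.of fun p q : Conf d X × Conf d (Λ \ X) =>
      if p.2 = q.2 then F p.1 q.1 else 0).submatrix (splitEquiv d h) (splitEquiv d h) := rfl
  rw [e1, trace_submatrix_mul]
  simp only [Matrix.trace, Matrix.diag, Matrix.mul_apply, Fintype.sum_prod_type,
    Matrix.of_apply, Matrix.submatrix_apply, reduce, Finset.mul_sum]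
  refine Finset.sum_congr rfl fun a _ => ?_
  rw [Finset.sum_comm]
  refine Finset.sum_congr rfl fun c _ => ?_
  simp only [ite_mul, zero_mul, Finset.sum_ite_eq, Finset.mem_univ, if_true]
  rfl

theorem norm_lift_le (h : X ⊆ Λ) (F : Op d X) : ‖lift h F‖ ≤ ‖F‖ := by
  have e1 : lift h F = (Matrix.of fun p q : Conf d X × Conf d (Λ \ X) =>
      if p.2 = q.2 then F p.1 q.1 else 0).submatrix (splitEquiv d h) (splitEquiv d h) := rfl
  rw [e1, norm_submatrix_equiv]
  refine norm_le_of_quad _ (norm_nonneg _) fun v w hv hw => ?_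
  have e2 : star v ⬝ᵥ (Matrix.of fun p q : Conf d X × Conf d (Λ \ X) =>
      if p.2 = q.2 then F p.1 q.1 else 0).mulVec w =
      ∑ c, star (fun i => v (i, c)) ⬝ᵥ F.mulVec (fun i => w (i, c)) := by
    simp only [quad_eq_sum, Fintype.sum_prod_type_right, Matrix.of_apply]
    refine Finset.sum_congr rfl fun c _ => Finset.sum_congr rfl fun a _ => ?_
    rw [Finset.sum_eq_single c]
    · simp
    · intro c' _ hc; simp [hc.symm]
    · simp
  rw [e2]
  calc _ ≤ ∑ c, ‖F‖ * ((normSq (fun i => v (i, c)) + normSq fun i => w (i, c)) / 2) :=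
        (norm_sum_le _ _).trans (Finset.sum_le_sum fun c _ => norm_quad_le _ _ _)
    _ = ‖F‖ := by
      rw [← Finset.mul_sum, ← Finset.sum_div, Finset.sum_add_distrib, ← normSq_prod' v,
        ← normSq_prod' w, hv, hw]
      ring

end Lattice

/-! ### Evaluating a part of an operator in a state -/

section Evaluation

variable {D : ℕ} {d : Site D → ℕ} {A B Y Λ X b : Finset (Site D)}

/-- Configurations on a disjoint union are pairs of configurations. -/
def unionEquiv (d : Site D → ℕ) (hd : Disjoint A B) :
    Conf d (A ∪ B) ≃ Conf d A × Conf d B where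
  toFun p := (restrict Finset.subset_union_left p, restrict Finset.subset_union_right p)
  invFun q := fun x => if h : x.1 ∈ A then q.1 ⟨x.1, h⟩ else
    q.2 ⟨x.1, (Finset.mem_union.1 x.2).resolve_left h⟩
  left_inv p := by
    ext x; by_cases h : x.1 ∈ A <;> simp [restrict, h]
  right_inv q := by
    refine Prod.ext ?_ ?_
    · ext x; simp [restrict]
    · ext x
      have := Finset.disjoint_right.1 hd x.2
      simp [restrict, this]

theorem upd_unionEquiv_symm (hd : Disjoint A B) (σ : Conf d Λ) (a : Conf d A) (c : Conf d B) :
    upd σ ((unionEquiv d hd).symm (a, c)) = upd (upd σ a) c := by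
  ext x
  by_cases hA : x.1 ∈ A
  · have := Finset.disjoint_left.1 hd hA
    simp [upd, unionEquiv, hA, this]
  · by_cases hB : x.1 ∈ B <;> simp [upd, unionEquiv, hA, hB]

theorem tensor_eq_submatrix (hd : Disjoint A B) (τ : Op d A) (τ' : Op d B) :
    tensor τ τ' = (Matrix.of fun p q : Conf d A × Conf d B => τ p.1 q.1 * τ' p.2 q.2).submatrix
      (unionEquiv d hd) (unionEquiv d hd) := rfl

theorem trace_tensor_mul (hd : Disjoint A B) (τ : Op d A) (τ' : Op d B) (N : Op d (A ∪ B)) :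
    (tensor τ τ' * N).trace = (τ * Matrix.of fun a b => (τ' * Matrix.of fun a' b' =>
      N ((unionEquiv d hd).symm (a, a')) ((unionEquiv d hd).symm (b, b'))).trace).trace := by
  rw [tensor_eq_submatrix hd, trace_submatrix_mul]
  simp only [Matrix.trace, Matrix.diag, Matrix.mul_apply, Fintype.sum_prod_type,
    Matrix.of_apply, Matrix.submatrix_apply, Finset.mul_sum]
  refine Finset.sum_congr rfl fun a _ => ?_
  rw [Finset.sum_comm]
  refine Finset.sum_congr rfl fun c _ => Finset.sum_congr rfl fun a' _ =>
    Finset.sum_congr rfl fun c' _ => ?_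
  ring

theorem indicator_mul_indicator (p q : Prop) [Decidable p] [Decidable q] :
    (if p then (1 : ℂ) else 0) * (if q then 1 else 0) = if p ∧ q then 1 else 0 := by
  by_cases hp : p <;> by_cases hq : q <;> simp [hp, hq]

/-- Evaluation of the part of an operator on the region `Y` in the state `τ`; the result does not
depend on the region `Y` any more. -/
def evalOn (h : Y ⊆ Λ) (τ : Op d Y) : Op d Λ →L[ℂ] Op d Λ := toCLM (embed h (evalMap τ))

theorem evalOn_sub (h : Y ⊆ Λ) (τ τ' : Op d Y) :
    evalOn h (τ - τ') = evalOn h τ - evalOn h τ' := by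
  ext O σ σ'
  change (embed h (evalMap (τ - τ')) O) σ σ' =
    (embed h (evalMap τ) O) σ σ' - (embed h (evalMap τ') O) σ σ'
  simp [embed_apply, evalMap_apply, sub_mul]

theorem evalOn_apply (h : Y ⊆ Λ) (τ : Op d Y) (O : Op d Λ) (σ σ' : Conf d Λ) :
    evalOn h τ O σ σ' = (τ * Matrix.of fun a b => O (upd σ a) (upd σ' b)).trace *
      (1 : Op d Y) (restrict h σ) (restrict h σ') := rfl

theorem norm_evalOn_apply_le (h : Y ⊆ Λ) (τ : Op d Y) (O : Op d Λ) :
    ‖evalOn h τ O‖ ≤ traceNorm τ * ‖O‖ := norm_embed_evalMap_le h τ O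

theorem commute_evalOn (hA : A ⊆ Λ) (hB : B ⊆ Λ) (hd : Disjoint A B) (τ : Op d A) (τ' : Op d B) :
    Commute (evalOn hA τ) (evalOn hB τ') := by
  exact (commute_embed hA hB hd (evalMap τ) (evalMap τ')).map toCLM

theorem commute_evalOn_embed (hA : A ⊆ Λ) (hB : B ⊆ Λ) (hd : Disjoint A B) (τ : Op d A)
    (T : SuperOp (Conf d B)) : Commute (evalOn hA τ) (toCLM (embed hB T)) := by
  exact (commute_embed hA hB hd (evalMap τ) T).map toCLM

theorem evalOn_tensor (hA : A ⊆ Λ) (hB : B ⊆ Λ) (hAB : A ∪ B ⊆ Λ) (hd : Disjoint A B)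
    (τ : Op d A) (τ' : Op d B) :
    evalOn hAB (tensor τ τ') = evalOn hA τ * evalOn hB τ' := by
  refine ContinuousLinearMap.ext fun O => ?_
  ext σ σ'
  change evalOn hAB (tensor τ τ') O σ σ' = evalOn hA τ (evalOn hB τ' O) σ σ'
  rw [evalOn_apply, evalOn_apply, trace_tensor_mul hd]
  have h1 : (Matrix.of fun a b => evalOn hB τ' O (upd σ a) (upd σ' b) : Op d A) =
      (1 : Op d B) (restrict hB σ) (restrict hB σ') • Matrix.of fun a b =>
        (τ' * Matrix.of fun a' b' => O (upd (upd σ a) a') (upd (upd σ' b) b')).trace := by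
    ext a b
    rw [Matrix.of_apply, evalOn_apply, restrict_upd_of_disjoint hB hd.symm,
      restrict_upd_of_disjoint hB hd.symm, Matrix.smul_apply, smul_eq_mul, mul_comm]
    rfl
  rw [h1, Matrix.mul_smul, Matrix.trace_smul, smul_eq_mul]
  simp only [Matrix.of_apply, upd_unionEquiv_symm]
  have h2 : (1 : Op d (A ∪ B)) (restrict hAB σ) (restrict hAB σ') =
      (1 : Op d B) (restrict hB σ) (restrict hB σ') *
        (1 : Op d A) (restrict hA σ) (restrict hA σ') := by
    simp only [Matrix.one_apply, restrict_eq_iff]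
    have : (∀ x : Λ, x.1 ∈ A ∪ B → σ x = σ' x) ↔
        (∀ x : Λ, x.1 ∈ B → σ x = σ' x) ∧ (∀ x : Λ, x.1 ∈ A → σ x = σ' x) := by
      simp only [Finset.mem_union]
      exact ⟨fun e => ⟨fun x hx => e x (Or.inr hx), fun x hx => e x (Or.inl hx)⟩,
        fun e x hx => hx.elim (e.2 x) (e.1 x)⟩
    rw [indicator_mul_indicator]
    exact if_congr this rfl rfl
  rw [h2]
  ring

theorem embed_refl (T : SuperOp (Conf d X)) (F : Op d X) :
    embed (Finset.Subset.refl X) T F = T F := by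
  ext σ τ
  rw [embed_apply]
  have h : ∀ (σ a : Conf d X), upd σ a = a := by
    intro σ a; ext x; simp [upd]
  simp only [h]
  rfl

theorem embed_lift_self (h : X ⊆ Λ) (T : SuperOp (Conf d X)) (F : Op d X) :
    embed h T (lift h F) = lift h (T F) := by
  have := embed_lift (Finset.Subset.refl X) h T F
  rwa [embed_refl] at this

theorem evalOn_lift (h : X ⊆ Λ) (τ F : Op d X) :
    evalOn h τ (lift h F) = (τ * F).trace • 1 := by
  change embed h (evalMap τ) (lift h F) = _
  rw [embed_lift_self, evalMap_apply, map_smul, lift_one]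

theorem evalOn_one (h : Y ⊆ Λ) (τ : Op d Y) : evalOn h τ 1 = τ.trace • 1 := by
  rw [← lift_one h, evalOn_lift, mul_one, lift_one]

/-- Evaluation of the part of an operator on the region `Y` in the reference product state given by
the configuration `ω`. -/
def freeze (ω : Conf d Λ) (h : Y ⊆ Λ) : Op d Λ →L[ℂ] Op d Λ :=
  evalOn h (Matrix.single (restrict h ω) (restrict h ω) 1)

theorem single_mul_trace {n : Type} [Fintype n] [DecidableEq n] (a : n) (M : Matrix n n ℂ) :
    (Matrix.single a a 1 * M).trace = M a a := by
  simp [Matrix.trace, Matrix.mul_apply, Matrix.single_apply, Finset.sum_ite_eq, ite_and]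

theorem freeze_apply (ω : Conf d Λ) (h : Y ⊆ Λ) (O : Op d Λ) (σ τ : Conf d Λ) :
    freeze ω h O σ τ = O (upd σ (restrict h ω)) (upd τ (restrict h ω)) *
      (1 : Op d Y) (restrict h σ) (restrict h τ) := by
  rw [freeze, evalOn_apply, single_mul_trace]; rfl

theorem isState_single {n : Type} [Fintype n] [DecidableEq n] (a : n) :
    IsState (Matrix.single a a (1 : ℂ)) := by
  constructor
  · have : Matrix.single a a (1 : ℂ) = Matrix.vecMulVec (Pi.single a 1) (star (Pi.single a 1)) := by
      ext i j
      by_cases hi : i = a <;> by_cases hj : j = a <;>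
        simp [Matrix.vecMulVec_apply, hi, hj, Ne.symm]
    rw [this]
    exact Matrix.posSemidef_vecMulVec_self_star _
  · have := single_mul_trace a (1 : Matrix n n ℂ)
    rwa [mul_one, Matrix.one_apply_eq] at this

theorem norm_freeze_apply_le (ω : Conf d Λ) (h : Y ⊆ Λ) (O : Op d Λ) : ‖freeze ω h O‖ ≤ ‖O‖ := by
  refine (norm_evalOn_apply_le _ _ _).trans (mul_le_of_le_one_left (norm_nonneg _) ?_)
  exact (isState_single _).traceNorm_le_one

theorem freeze_union (ω : Conf d Λ) (hA : A ⊆ Λ) (hB : B ⊆ Λ) (hAB : A ∪ B ⊆ Λ)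
    (hd : Disjoint A B) : freeze ω hAB = freeze ω hA * freeze ω hB := by
  rw [freeze, freeze, freeze, ← evalOn_tensor hA hB hAB hd]
  congr 1
  ext p q
  have h : ∀ p : Conf d (A ∪ B), restrict hAB ω = p ↔
      restrict hA ω = restrict Finset.subset_union_left p ∧
        restrict hB ω = restrict Finset.subset_union_right p := by
    intro p
    constructor
    · rintro rfl; exact ⟨rfl, rfl⟩
    · rintro ⟨h1, h2⟩
      exact (unionEquiv d hd).injective (Prod.ext h1 h2)
  simp only [tensor, Matrix.of_apply, Matrix.single_apply, h]
  rw [indicator_mul_indicator]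
  refine if_congr ?_ rfl rfl
  tauto

theorem evalOn_mul_evalOn (h : Y ⊆ Λ) (τ τ' : Op d Y) (hτ : τ.trace = 1) :
    evalOn h τ * evalOn h τ' = evalOn h τ' := by
  have : evalMap τ * evalMap τ' = evalMap τ' := by
    refine LinearMap.ext fun O => ?_
    rw [Module.End.mul_apply, evalMap_apply τ' O, map_smul, evalMap_apply, mul_one, hτ, one_smul]
  rw [evalOn, evalOn, ← map_mul, ← embed_mul, this]

theorem freeze_mul_evalOn (ω : Conf d Λ) (h : Y ⊆ Λ) (τ : Op d Y) :
    freeze ω h * evalOn h τ = evalOn h τ :=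
  evalOn_mul_evalOn h _ _ (isState_single _).2

theorem freeze_one (ω : Conf d Λ) (h : Y ⊆ Λ) : freeze ω h 1 = 1 := by
  rw [freeze, evalOn_one, (isState_single _).2, one_smul]

theorem freeze_mul_of_subset (ω : Conf d Λ) (hA : A ⊆ B) (hB : B ⊆ Λ) :
    freeze ω (hA.trans hB) * freeze ω hB = freeze ω hB := by
  have hu : A ∪ B \ A ⊆ Λ := by rwa [Finset.union_sdiff_of_subset hA]
  have key : ∀ (C : Finset (Site D)) (hC : C ⊆ Λ), A ∪ B \ A = C →
      freeze ω hC = freeze ω (hA.trans hB) * freeze ω (Finset.sdiff_subset.trans hB : B \ A ⊆ Λ) := by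
    rintro C hC rfl
    exact freeze_union ω _ _ hC Finset.disjoint_sdiff
  rw [key B hB (Finset.union_sdiff_of_subset hA), ← mul_assoc]
  congr 1
  exact freeze_mul_evalOn ω _ _

/-- The operator `O` is supported on `X`: it is not changed by the evaluation of its part outside of
`X` in a reference product state. The notion does not depend on the reference configuration `ω`. -/
def SupportedOn (ω : Conf d Λ) (X : Finset (Site D)) (O : Op d Λ) : Prop :=
  freeze ω (Finset.sdiff_subset : Λ \ X ⊆ Λ) O = O

theorem SupportedOn.freeze_eq {ω : Conf d Λ} {O : Op d Λ} (hO : SupportedOn ω X O) (hY : Y ⊆ Λ)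
    (hd : Disjoint Y X) : freeze ω hY O = O := by
  have h : Y ⊆ Λ \ X := Finset.subset_sdiff.2 ⟨hY, hd⟩
  have := freeze_mul_of_subset ω h Finset.sdiff_subset
  have h2 := congrArg (fun T : Op d Λ →L[ℂ] Op d Λ => T O) this
  change freeze ω hY (freeze ω _ O) = freeze ω _ O at h2
  rwa [hO] at h2

theorem SupportedOn.mono {ω : Conf d Λ} {O : Op d Λ} (hO : SupportedOn ω X O) (h : X ⊆ b) :
    SupportedOn ω b O :=
  hO.freeze_eq _ (Finset.disjoint_left.2 fun _ hx hX => (Finset.mem_sdiff.1 hx).2 (h hX))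

theorem freeze_lift_of_disjoint (ω : Conf d Λ) (hY : Y ⊆ Λ) (hX : X ⊆ Λ) (hd : Disjoint Y X)
    (F : Op d X) : freeze ω hY (lift hX F) = lift hX F := by
  have h : evalMap (Matrix.single (restrict hY ω) (restrict hY ω) (1 : ℂ)) 1 = (1 : ℂ) • 1 := by
    rw [evalMap_apply, mul_one, (isState_single _).2]
  have := embed_lift_of_disjoint hY hX hd h F
  rwa [one_smul] at this

theorem supportedOn_lift (ω : Conf d Λ) (hX : X ⊆ Λ) (F : Op d X) :
    SupportedOn ω X (lift hX F) :=
  freeze_lift_of_disjoint ω _ hX Finset.sdiff_disjoint F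

theorem SupportedOn.exists_lift {ω : Conf d Λ} {O : Op d Λ} (hX : X ⊆ Λ)
    (hO : SupportedOn ω X O) : ∃ F : Op d X, lift hX F = O ∧ ‖F‖ ≤ ‖O‖ := by
  classical
  refine ⟨O.submatrix (fun a => upd ω a) (fun a => upd ω a), ?_, ?_⟩
  · conv_rhs => rw [← hO]
    ext σ τ
    have h : ∀ σ : Conf d Λ, upd σ (restrict (Finset.sdiff_subset : Λ \ X ⊆ Λ) ω) =
        upd ω (restrict hX σ) := by
      intro σ
      ext x
      by_cases hx : x.1 ∈ X <;> simp [upd, restrict, hx]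
    rw [freeze_apply, h, h, Matrix.one_apply]
    change (if _ then _ else _) = _
    split_ifs <;> simp
  · refine norm_submatrix_le O _ fun a a' h => ?_
    have := congrArg (restrict hX) h
    rwa [restrict_upd, restrict_upd] at this

/-- In a state `ρ` on `Λ`, evaluating the region `X` gives the expectation value of all operators
supported on `X`. -/
theorem SupportedOn.evalOn_reduce {ω : Conf d Λ} {O : Op d Λ} (hX : X ⊆ Λ)
    (hO : SupportedOn ω X O) (ρ : Op d Λ) :
    evalOn hX (reduce X ρ) O = (ρ * O).trace • 1 := by
  obtain ⟨F, rfl, _⟩ := hO.exists_lift hX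
  rw [evalOn_lift, Matrix.trace_mul_comm, ← trace_lift_mul, Matrix.trace_mul_comm]

theorem norm_one_op (ω : Conf d Λ) : ‖(1 : Op d Λ)‖ = 1 := by
  have : Nonempty (Conf d Λ) := ⟨ω⟩
  exact norm_one

/-- The correlation between two regions is bounded by the difference between evaluating them
jointly and separately. -/
theorem traceCorrelation_le_of_evalOn (ω : Conf d Λ) (hA : A ⊆ Λ) (hB : B ⊆ Λ) (hAB : A ∪ B ⊆ Λ)
    (hd : Disjoint A B) (ρ : Op d Λ) {C : ℝ}
    (h : ∀ O, SupportedOn ω (A ∪ B) O → ‖evalOn hAB (reduce (A ∪ B) ρ) O -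
      evalOn hA (reduce A ρ) (evalOn hB (reduce B ρ) O)‖ ≤ C * ‖O‖) :
    traceCorrelation A B ρ ≤ C := by
  refine traceNorm_le fun F hF => ?_
  have h1 := h _ (supportedOn_lift ω hAB F)
  have h2 : evalOn hAB (reduce (A ∪ B) ρ) (lift hAB F) -
      evalOn hA (reduce A ρ) (evalOn hB (reduce B ρ) (lift hAB F)) =
      evalOn hAB (reduce (A ∪ B) ρ - tensor (reduce A ρ) (reduce B ρ)) (lift hAB F) := by
    rw [evalOn_sub, evalOn_tensor hA hB hAB hd]
    rfl
  rw [h2, evalOn_lift, norm_smul, norm_one_op ω, mul_one, Matrix.trace_mul_comm] at h1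
  have hC : 0 ≤ C := by
    have := h 1 (freeze_one ω _)
    rw [norm_one_op ω, mul_one] at this
    exact (norm_nonneg _).trans this
  refine h1.trans ?_
  exact mul_le_of_le_one_right hC ((norm_lift_le hAB F).trans hF)

theorem norm_evalOn_sub_le (hA : A ⊆ Λ) (hB : B ⊆ Λ) (hAB : A ∪ B ⊆ Λ)
    (hd : Disjoint A B) (ρ : Op d Λ) (O : Op d Λ) :
    ‖evalOn hAB (reduce (A ∪ B) ρ) O - evalOn hA (reduce A ρ) (evalOn hB (reduce B ρ) O)‖ ≤
      traceCorrelation A B ρ * ‖O‖ := by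
  have h2 : evalOn hAB (reduce (A ∪ B) ρ) O -
      evalOn hA (reduce A ρ) (evalOn hB (reduce B ρ) O) =
      evalOn hAB (reduce (A ∪ B) ρ - tensor (reduce A ρ) (reduce B ρ)) O := by
    rw [evalOn_sub, evalOn_tensor hA hB hAB hd]
    rfl
  rw [h2]
  exact norm_evalOn_apply_le _ _ _

/-- Freezing a region changes an operator at most by the sum of the changes from freezing its
sites. -/
theorem norm_sub_freeze_le (ω : Conf d Λ) (E : Site D → Op d Λ →L[ℂ] Op d Λ)
    (hE : ∀ (x : Site D) (hx : {x} ⊆ Λ), E x = freeze ω hx) (hY : Y ⊆ Λ) (O : Op d Λ) :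
    ‖O - freeze ω hY O‖ ≤ ∑ x ∈ Y, ‖O - E x O‖ := by
  classical
  induction Y using Finset.induction_on with
  | empty =>
    have : freeze ω hY O = O := by
      ext σ τ
      have h : ∀ (σ : Conf d Λ), upd σ (restrict hY ω) = σ := by
        intro σ; ext x; simp [upd]
      rw [freeze_apply, h, h, Matrix.one_apply, if_pos (Subsingleton.elim _ _), mul_one]
    simp [this]
  | insert x Y hx ih =>
    rw [Finset.sum_insert hx]
    have hx1 : {x} ⊆ Λ := (Finset.singleton_subset_iff.2 (Finset.mem_insert_self x Y)).trans hY
    have hY1 : Y ⊆ Λ := (Finset.subset_insert x Y).trans hY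
    have e : freeze ω hY = freeze ω hx1 * freeze ω hY1 := by
      have := freeze_union ω hx1 hY1 (by rwa [← Finset.insert_eq])
        (Finset.disjoint_singleton_left.2 hx)
      rw [← this]
      congr 1
    rw [e, hE x hx1]
    change ‖O - freeze ω hx1 (freeze ω hY1 O)‖ ≤ _
    have e2 : O - freeze ω hx1 (freeze ω hY1 O) =
        (O - freeze ω hx1 O) + freeze ω hx1 (O - freeze ω hY1 O) := by
      rw [map_sub]; abel
    rw [e2]
    exact (norm_add_le _ _).trans
      (add_le_add le_rfl ((norm_freeze_apply_le ω _ _).trans (ih hY1)))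

end Evaluation

/-! ### Bounds on local terms -/

section LocalTerms

variable {D : ℕ} {d : Site D → ℕ} {A B Y Z Λ X b : Finset (Site D)}

theorem semigroup_embed_dual (h : Z ⊆ Λ) (L : SuperOp (Conf d Z)) (t : ℝ) :
    semigroup (toCLM (embed h (dual L))) t = toCLM (embed h (dual (evolve L t))) := by
  have := map_semigroup (embedHom d h) (toCLM (dual L)) t
  rw [← toCLM_dual_evolve, AlgEquiv.symm_apply_apply, AlgEquiv.symm_apply_apply] at this
  exact this.symm

theorem IsLindbladian.isDissipative_embed (h : Z ⊆ Λ) {L : SuperOp (Conf d Z)}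
    (hL : IsLindbladian L) : IsDissipative (toCLM (embed h (dual L))) := by
  refine isDissipative_of_contraction fun t ht O => ?_
  rw [semigroup_embed_dual]
  exact (hL t ht).norm_embed_dual_le h O

theorem IsLindbladian.isDissipative {L : SuperOp (Conf d Λ)}
    (hL : IsLindbladian L) : IsDissipative (toCLM (dual L)) := by
  have : embed (Finset.Subset.refl Λ) (dual L) = dual L := LinearMap.ext fun F => embed_refl _ F
  have h := hL.isDissipative_embed (Finset.Subset.refl Λ)
  rwa [this] at h

/-- A term which annihilates the identity is controlled by the dependence of its argument on the
region of the term. -/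
theorem norm_embed_dual_le_of_dual_one (ω : Conf d Λ) (h : Z ⊆ Λ) {T : SuperOp (Conf d Z)}
    (hT : dual T 1 = 0) (O : Op d Λ) :
    ‖embed h (dual T) O‖ ≤ diamondNorm T * ‖O - freeze ω h O‖ := by
  have h1 : embed h (dual T) (freeze ω h O) = 0 := by
    have h2 : dual T * evalMap (Matrix.single (restrict h ω) (restrict h ω) 1) = 0 := by
      refine LinearMap.ext fun F => ?_
      rw [Module.End.mul_apply, evalMap_apply, map_smul, hT, smul_zero]; rfl
    have h3 := embed_mul h (dual T) (evalMap (Matrix.single (restrict h ω) (restrict h ω) 1))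
    rw [h2] at h3
    have h4 := congrArg (fun S : SuperOp (Conf d Λ) => S O) h3
    exact h4.symm.trans (by ext σ τ; rfl)
  have h2 : embed h (dual T) O = embed h (dual T) (O - freeze ω h O) := by
    rw [map_sub, h1, sub_zero]
  rw [h2]
  exact norm_embed_dual_le h T _

/-- A superoperator on the region `Y` acts on an operator supported off `Y` as multiplication by
the image of the identity. -/
theorem embed_freeze (ω : Conf d Λ) (h : Y ⊆ Λ) (T : SuperOp (Conf d Y)) (O : Op d Λ) :
    embed h T (freeze ω h O) = embed h T 1 * freeze ω h O := by
  classical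
  have h1 : embed h T 1 = lift h (T 1) := by rw [← lift_one h, embed_lift_self]
  rw [h1]
  ext σ τ
  have h2 : (Matrix.of fun a b => freeze ω h O (upd σ a) (upd τ b) : Op d Y) =
      O (upd σ (restrict h ω)) (upd τ (restrict h ω)) • 1 := by
    ext a b
    rw [Matrix.of_apply, freeze_apply, upd_upd, upd_upd, restrict_upd, restrict_upd,
      Matrix.smul_apply, smul_eq_mul]
  rw [embed_apply, h2, map_smul, Matrix.smul_apply, smul_eq_mul, Matrix.mul_apply,
    Finset.sum_eq_single (upd σ (restrict h τ))]
  · rw [freeze_apply, upd_upd, restrict_upd, Matrix.one_apply_eq, mul_one, lift_apply, restrict_upd,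
      if_pos, mul_comm]
    intro x hx
    simp [upd, hx]
  · intro σ' _ hσ'
    rw [freeze_apply, lift_apply, Matrix.one_apply]
    split_ifs with h3 h4
    · exfalso
      apply hσ'
      ext x
      by_cases hx : x.1 ∈ Y
      · have := (restrict_eq_iff h _ _).1 h4 x hx
        simp [upd, hx, restrict, this]
      · simp [upd, hx, (h3 x hx).symm]
    · simp
    · simp
    · simp
  · simp

end LocalTerms

/-! ### Comparison of the evolutions of a uniform family -/

section Family

variable {D : ℕ} {d : Site D → ℕ} (F : UniformFamily d) {A B Y Z Λ X b : Finset (Site D)}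

/-- The local term of the generator in the Heisenberg picture, as an operator on the observables
of a region `Λ`. -/
def bulkTerm (Λ Z : Finset (Site D)) : Op d Λ →L[ℂ] Op d Λ :=
  if h : Z ⊆ Λ then toCLM (embed h (dual (F.bulk Z))) else 0

theorem bulkTerm_of_subset (h : Z ⊆ Λ) :
    bulkTerm F Λ Z = toCLM (embed h (dual (F.bulk Z))) := dif_pos h

/-- The boundary term of the generator in the Heisenberg picture. -/
def bdryTerm (u : Site D) (N j : ℕ) : Op d (ball u N) →L[ℂ] Op d (ball u N) :=
  toCLM (embed (layer_subset u N j) (dual (F.bdry u N j)))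

theorem toCLM_dual_bdry (u : Site D) (N : ℕ) :
    toCLM (dual (∑ j ∈ Finset.Icc 1 (N + 1), embed (layer_subset u N j) (F.bdry u N j))) =
      ∑ j ∈ Finset.Icc 1 (N + 1), bdryTerm F u N j := by
  rw [map_sum, map_sum]
  exact Finset.sum_congr rfl fun j _ => by rw [dual_embed]; rfl

theorem toCLM_dual_closedGenerator (u : Site D) (N : ℕ) :
    toCLM (dual (F.closedGenerator u N)) = ∑ Z ∈ (ball u N).powerset, bulkTerm F (ball u N) Z +
      ∑ j ∈ Finset.Icc 1 (N + 1), bdryTerm F u N j := by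
  rw [UniformFamily.closedGenerator, map_add, map_add, toCLM_dual_bdry, map_sum, map_sum]
  congr 1
  rw [← Finset.sum_attach (ball u N).powerset]
  refine Finset.sum_congr rfl fun Z _ => ?_
  rw [dual_embed, bulkTerm_of_subset F (Finset.mem_powerset.1 Z.2)]

theorem isDissipative_bulkTerm (Λ Z : Finset (Site D)) : IsDissipative (bulkTerm F Λ Z) := by
  by_cases h : Z ⊆ Λ
  · rw [bulkTerm_of_subset F h]
    exact (F.bulk_lindbladian Z).isDissipative_embed h
  · rw [bulkTerm, dif_neg h]
    exact IsDissipative.zero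

theorem isDissipative_closedGenerator (u : Site D) (N : ℕ) :
    IsDissipative (toCLM (dual (F.closedGenerator u N))) := by
  rw [toCLM_dual_closedGenerator]
  refine (IsDissipative.sum _ fun Z _ => isDissipative_bulkTerm F _ Z).add ?_
  rw [← toCLM_dual_bdry]
  exact (F.bdry_lindbladian u N).isDissipative

theorem bulkTerm_one (Λ Z : Finset (Site D)) : bulkTerm F Λ Z 1 = 0 := by
  by_cases h : Z ⊆ Λ
  · rw [bulkTerm_of_subset F h]
    change embed h (dual (F.bulk Z)) 1 = 0
    rw [← lift_one h, embed_lift_self, (F.bulk_lindbladian Z).dual_one_eq_zero, map_zero]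
  · rw [bulkTerm, dif_neg h]; rfl

theorem sum_bdryTerm_one (u : Site D) (N : ℕ) :
    (∑ j ∈ Finset.Icc 1 (N + 1), bdryTerm F u N j) 1 = 0 := by
  rw [← toCLM_dual_bdry]
  exact (F.bdry_lindbladian u N).dual_one_eq_zero

theorem semigroup_closedGenerator_one (u : Site D) (N : ℕ) (t : ℝ) :
    semigroup (toCLM (dual (F.closedGenerator u N))) t 1 = 1 := by
  refine semigroup_apply_of_eq_zero ?_ t
  rw [toCLM_dual_closedGenerator, add_apply, sum_bdryTerm_one, add_zero, sum_apply]
  exact Finset.sum_eq_zero fun Z _ => bulkTerm_one F _ Z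

/-- Evaluation of a single site in the reference product state. -/
def siteFreeze (ω : Conf d Λ) (x : Site D) : Op d Λ →L[ℂ] Op d Λ :=
  if h : {x} ⊆ Λ then freeze ω h else 1

theorem siteFreeze_eq (ω : Conf d Λ) (x : Site D) (h : {x} ⊆ Λ) :
    siteFreeze ω x = freeze ω h := dif_pos h

theorem norm_siteFreeze_le (ω : Conf d Λ) (x : Site D) (O : Op d Λ) :
    ‖siteFreeze ω x O‖ ≤ ‖O‖ := by
  by_cases h : {x} ⊆ Λ
  · rw [siteFreeze_eq ω x h]; exact norm_freeze_apply_le ω h O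
  · rw [siteFreeze, dif_neg h]; exact le_rfl

theorem commute_evalOn_bulkTerm (hY : Y ⊆ Λ) (τ : Op d Y) (hd : Disjoint Y Z) :
    Commute (evalOn hY τ) (bulkTerm F Λ Z) := by
  by_cases h : Z ⊆ Λ
  · rw [bulkTerm_of_subset F h]; exact commute_evalOn_embed hY h hd τ _
  · rw [bulkTerm, dif_neg h]; exact Commute.zero_right _

theorem norm_bulkTerm_le (ω : Conf d Λ) (h : Z ⊆ Λ) (O : Op d Λ) :
    ‖bulkTerm F Λ Z O‖ ≤ diamondNorm (F.bulk Z) * ∑ x ∈ Z, ‖O - siteFreeze ω x O‖ := by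
  rw [bulkTerm_of_subset F h]
  refine (norm_embed_dual_le_of_dual_one ω h (F.bulk_lindbladian Z).dual_one_eq_zero O).trans ?_
  exact mul_le_mul_of_nonneg_left
    (norm_sub_freeze_le ω (siteFreeze ω) (fun x hx => siteFreeze_eq ω x hx) h O)
    (diamondNorm_nonneg _)

theorem gdist_le_diam {x y : Site D} (hx : x ∈ Z) (hy : y ∈ Z) : gdist x y ≤ diam Z :=
  Finset.le_sup (f := fun p : Site D × Site D => gdist p.1 p.2) (b := (x, y))
    (Finset.mem_product.2 ⟨hx, hy⟩)

theorem IsGrowthFunction.one_le {ν : ℝ → ℝ} (hν : IsGrowthFunction ν) {r : ℝ} (hr : 0 ≤ r) :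
    1 ≤ ν r := by
  have h0 := hν.pos 0 le_rfl
  have h1 := hν.submul 0 0 le_rfl le_rfl
  rw [add_zero] at h1
  have h2 : 1 ≤ ν 0 := by
    by_contra h
    push Not at h
    nlinarith
  exact h2.trans (hν.mono Set.self_mem_Ici hr hr)

variable {F} {ν : ℝ → ℝ} {v : ℝ} {P : Polynomial ℝ}

theorem sum_bulk_le (hν : IsGrowthFunction ν) (hF : F.LiebRobinsonAssumptions ν v P)
    (coll : Finset (Finset (Site D))) (x : Site D) :
    ∑ Z ∈ coll with x ∈ Z, diamondNorm (F.bulk Z) * (Z.card : ℝ) * ν (diam Z) ≤ v := by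
  classical
  obtain ⟨hs, hle⟩ := hF.1 x
  refine le_trans ?_ hle
  have hnn : ∀ Z : {Z : Finset (Site D) // x ∈ Z},
      0 ≤ diamondNorm (F.bulk Z.1) * (Z.1.card : ℝ) * ν (diam Z.1) := fun Z =>
    mul_nonneg (mul_nonneg (diamondNorm_nonneg _) (Nat.cast_nonneg _))
      (hν.pos _ (Nat.cast_nonneg _)).le
  have := hs.sum_le_tsum (coll.subtype (fun Z => x ∈ Z)) (fun Z _ => hnn Z)
  refine le_trans (le_of_eq ?_) this
  rw [Finset.sum_subtype_eq_sum_filter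
    (f := fun Z => diamondNorm (F.bulk Z) * (Z.card : ℝ) * ν (diam Z))]

/-- The Lieb-Robinson bound: under the evolution with any subcollection of the local terms, an
operator supported on `X` depends only weakly on a site `x` at a large distance `ℓ x` from `X`. -/
theorem norm_sub_siteFreeze_le (hν : IsGrowthFunction ν) (hF : F.LiebRobinsonAssumptions ν v P)
    (ω : Conf d Λ) {coll : Finset (Finset (Site D))} (hcoll : ∀ Z ∈ coll, Z ⊆ Λ)
    {ℓ : Site D → ℕ} (hℓ : ∀ x y, ℓ x ≤ gdist x y + ℓ y) (hℓX : ∀ x ∈ X, ℓ x = 0)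
    {O : Op d Λ} (hO : SupportedOn ω X O) {t : ℝ} (ht : 0 ≤ t) {x : Site D} (hx : x ∈ Λ) :
    ‖semigroup (∑ Z ∈ coll, bulkTerm F Λ Z) t O -
      siteFreeze ω x (semigroup (∑ Z ∈ coll, bulkTerm F Λ Z) t O)‖ ≤
      Real.exp (2 * v * t) * (2 * ν 0 * ‖O‖) / ν (ℓ x) := by
  have hw : ∀ x, 0 < ν (ℓ x) := fun x => hν.pos _ (Nat.cast_nonneg _)
  rw [le_div_iff₀ (hw x), mul_comm]
  refine lieb_robinson Λ (siteFreeze ω) coll id (bulkTerm F Λ)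
    (fun Z => diamondNorm (F.bulk Z)) (fun x => ν (ℓ x)) v
    (fun x _ O => norm_siteFreeze_le ω x O) (fun Z hZ => hcoll Z hZ) ?_
    (fun Z _ => isDissipative_bulkTerm F Λ Z) (fun Z _ => diamondNorm_nonneg _)
    (fun Z hZ O => norm_bulkTerm_le F ω (hcoll Z hZ) O) hw ?_ O ?_ ?_ ht hx
  · intro Z hZ x hx hxZ
    have hx1 : {x} ⊆ Λ := Finset.singleton_subset_iff.2 hx
    rw [siteFreeze_eq ω x hx1]
    exact commute_evalOn_bulkTerm F hx1 _ (Finset.disjoint_singleton_left.2 hxZ)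
  · intro x _
    refine le_trans (Finset.sum_le_sum fun Z hZ => ?_) (sum_bulk_le hν hF coll x)
    have hxZ : x ∈ Z := (Finset.mem_filter.1 hZ).2
    rw [mul_assoc]
    refine mul_le_mul_of_nonneg_left ?_ (diamondNorm_nonneg _)
    rw [← nsmul_eq_mul]
    refine Finset.sum_le_card_nsmul _ _ _ fun y hy => ?_
    rw [div_le_iff₀ (hw y)]
    refine le_trans ?_ (hν.submul _ _ (Nat.cast_nonneg _) (Nat.cast_nonneg _))
    refine hν.mono (Set.mem_Ici.2 (Nat.cast_nonneg _)) (Set.mem_Ici.2 (by positivity)) ?_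
    have h1 := hℓ x y
    have h2 := gdist_le_diam hxZ hy
    exact_mod_cast h1.trans (by omega)
  · have := (hν.pos 0 le_rfl).le
    positivity
  · intro x hx
    have hx1 : {x} ⊆ Λ := Finset.singleton_subset_iff.2 hx
    have hn := hν.pos 0 le_rfl
    by_cases hxX : x ∈ X
    · rw [hℓX x hxX, Nat.cast_zero]
      have h1 := norm_sub_le O (siteFreeze ω x O)
      have h2 := norm_siteFreeze_le ω x O
      nlinarith
    · rw [siteFreeze_eq ω x hx1, hO.freeze_eq hx1 (Finset.disjoint_singleton_left.2 hxX), sub_self,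
        norm_zero, mul_zero]
      positivity

/-- The evolution with local terms inside `b` does not leave `b`. -/
theorem supportedOn_semigroup {ω : Conf d Λ} {coll : Finset (Finset (Site D))}
    (hcoll : ∀ Z ∈ coll, Z ⊆ b) {O : Op d Λ} (hO : SupportedOn ω b O) (t : ℝ) :
    SupportedOn ω b (semigroup (∑ Z ∈ coll, bulkTerm F Λ Z) t O) := by
  have hc : Commute (freeze ω (Finset.sdiff_subset : Λ \ b ⊆ Λ)) (∑ Z ∈ coll, bulkTerm F Λ Z) :=
    Commute.sum_right _ _ _ fun Z hZ => commute_evalOn_bulkTerm F _ _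
      (Finset.disjoint_of_subset_right (hcoll Z hZ) Finset.sdiff_disjoint)
  have h := semigroup_apply_comm hc t O
  have hO' : freeze ω (Finset.sdiff_subset : Λ \ b ⊆ Λ) O = O := hO
  rw [hO'] at h
  exact h

theorem layer_mono (u : Site D) (N : ℕ) {i j : ℕ} (h : i ≤ j) : layer u N i ⊆ layer u N j := by
  intro x hx
  simp only [layer, Finset.mem_filter] at hx ⊢
  obtain ⟨hx1, y, hy1, hy2⟩ := hx
  exact ⟨hx1, y, hy1, hy2.trans h⟩

theorem norm_bdryTerm_le (u : Site D) (N j : ℕ) (O : Op d (ball u N)) :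
    ‖bdryTerm F u N j O‖ ≤ diamondNorm (F.bdry u N j) * ‖O‖ :=
  norm_embed_dual_le _ _ _

/-- The boundary terms act weakly on operators that depend weakly on the boundary layer of width
`J`. Only the sum of the boundary terms annihilates the identity; so the terms inside the layer act
on an operator supported off the layer as the terms beyond the layer act on the identity. -/
theorem norm_sum_bdryTerm_le (hν : IsGrowthFunction ν) (hF : F.LiebRobinsonAssumptions ν v P)
    (u : Site D) (N J : ℕ) (ω : Conf d (ball u N)) (O : Op d (ball u N)) :
    ‖(∑ j ∈ Finset.Icc 1 (N + 1), bdryTerm F u N j) O‖ ≤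
      P.eval (N : ℝ) * ∑ x ∈ layer u N J, ‖O - siteFreeze ω x O‖ +
        2 * (P.eval (N : ℝ) / ν (J + 1)) * ‖O‖ := by
  set Q := freeze ω (layer_subset u N J) O with hQ
  set S := Finset.Icc 1 (N + 1) with hS
  have hQn : ‖Q‖ ≤ ‖O‖ := norm_freeze_apply_le ω _ O
  have htail : ∑ j ∈ S with J + 1 ≤ j, diamondNorm (F.bdry u N j) ≤
      P.eval (N : ℝ) / ν (J + 1) := by
    have h := hF.2 u N (J + 1)
    rw [le_div_iff₀ (hν.pos _ (by positivity)), mul_comm]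
    push_cast at h
    exact h
  have hall : ∑ j ∈ S, diamondNorm (F.bdry u N j) ≤ P.eval (N : ℝ) := by
    have h := hF.2 u N 0
    simp only [Nat.cast_zero, zero_le, Finset.filter_true] at h
    have h1 := hν.one_le le_rfl
    have h2 : 0 ≤ ∑ j ∈ S, diamondNorm (F.bdry u N j) :=
      Finset.sum_nonneg fun j _ => diamondNorm_nonneg _
    nlinarith
  have hsplit : ∀ M : Op d (ball u N), (∑ j ∈ S, bdryTerm F u N j) M =
      (∑ j ∈ S with ¬ J + 1 ≤ j, bdryTerm F u N j) M +
        (∑ j ∈ S with J + 1 ≤ j, bdryTerm F u N j) M := by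
    intro M
    rw [← add_apply, add_comm, Finset.sum_filter_add_sum_filter_not]
  have hbig : ∀ M : Op d (ball u N), ‖(∑ j ∈ S with J + 1 ≤ j, bdryTerm F u N j) M‖ ≤
      P.eval (N : ℝ) / ν (J + 1) * ‖M‖ := by
    intro M
    rw [sum_apply]
    refine (norm_sum_le _ _).trans ?_
    refine (Finset.sum_le_sum fun j _ => norm_bdryTerm_le u N j M).trans ?_
    rw [← Finset.sum_mul]
    exact mul_le_mul_of_nonneg_right htail (norm_nonneg _)
  have hsmall : (∑ j ∈ S with ¬ J + 1 ≤ j, bdryTerm F u N j) Q =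
      (∑ j ∈ S with ¬ J + 1 ≤ j, bdryTerm F u N j) 1 * Q := by
    rw [sum_apply, sum_apply, Matrix.sum_mul]
    refine Finset.sum_congr rfl fun j hj => ?_
    have hj' : j ≤ J := by
      have := (Finset.mem_filter.1 hj).2
      omega
    change embed _ _ _ = embed _ _ _ * _
    rw [← embed_embed (layer_mono u N hj') (layer_subset u N J), hQ, embed_freeze]
  have hone : ‖(∑ j ∈ S with ¬ J + 1 ≤ j, bdryTerm F u N j) 1‖ ≤ P.eval (N : ℝ) / ν (J + 1) := by
    have h := hsplit 1
    rw [hS, sum_bdryTerm_one, ← hS] at h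
    rw [eq_neg_of_add_eq_zero_left h.symm, norm_neg]
    have := hbig 1
    rwa [norm_one_op ω, mul_one] at this
  have e : (∑ j ∈ S, bdryTerm F u N j) O = (∑ j ∈ S, bdryTerm F u N j) (O - Q) +
      ((∑ j ∈ S with ¬ J + 1 ≤ j, bdryTerm F u N j) 1 * Q +
        (∑ j ∈ S with J + 1 ≤ j, bdryTerm F u N j) Q) := by
    rw [← hsmall, ← hsplit, map_sub]; abel
  have hP0 : 0 ≤ P.eval (N : ℝ) / ν (J + 1) :=
    (Finset.sum_nonneg fun j _ => diamondNorm_nonneg _).trans htail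
  have hP1 : 0 ≤ P.eval (N : ℝ) := (Finset.sum_nonneg fun j _ => diamondNorm_nonneg _).trans hall
  rw [e]
  refine (norm_add_le _ _).trans (add_le_add ?_ ?_)
  · rw [sum_apply]
    refine (norm_sum_le _ _).trans ?_
    refine (Finset.sum_le_sum fun j _ => norm_bdryTerm_le u N j _).trans ?_
    rw [← Finset.sum_mul]
    refine mul_le_mul hall ?_ (norm_nonneg _) hP1
    exact norm_sub_freeze_le ω (siteFreeze ω) (fun x hx => siteFreeze_eq ω x hx) _ O
  · refine (norm_add_le _ _).trans ?_
    have h1 := hbig Q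
    have h2 : ‖(∑ j ∈ S with ¬ J + 1 ≤ j, bdryTerm F u N j) 1 * Q‖ ≤
        P.eval (N : ℝ) / ν (J + 1) * ‖Q‖ :=
      (norm_mul_le _ _).trans (mul_le_mul_of_nonneg_right hone (norm_nonneg _))
    have h3 := mul_le_mul_of_nonneg_left hQn hP0
    linarith

/-- Comparison of the evolution on a ball `Λ = b_u(N)` with the evolution under a subcollection of
the local terms inside `b ⊆ Λ`, for an operator supported on `X ⊆ b`: the omitted terms are far from
`X` or have a large diameter. -/
theorem norm_closed_sub_semigroup_le (hν : IsGrowthFunction ν)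
    (hF : F.LiebRobinsonAssumptions ν v P) (hv : 0 < v)
    (u : Site D) (N : ℕ) (ω : Conf d (ball u N)) (hb : b ⊆ ball u N)
    {coll : Finset (Finset (Site D))} (hcoll : ∀ Z ∈ coll, Z ⊆ b)
    {ℓ : Site D → ℕ} (hℓ : ∀ x y, ℓ x ≤ gdist x y + ℓ y) (hℓX : ∀ x ∈ X, ℓ x = 0) (hXb : X ⊆ b)
    {q r : ℝ} (hq0 : 0 ≤ q) (hr0 : 0 ≤ r)
    (hq : ∀ Z, Z ⊆ ball u N → Z ∉ coll → ∀ x ∈ Z, x ∈ b → q ≤ diam Z + ℓ x)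
    (hr : ∀ x ∈ b, ∀ y, y ∉ ball u N → r ≤ gdist x y + ℓ x)
    {O : Op d (ball u N)} (hO : SupportedOn ω X O) {t : ℝ} (ht : 0 ≤ t) :
    ‖semigroup (toCLM (dual (F.closedGenerator u N))) t O -
      semigroup (∑ Z ∈ coll, bulkTerm F (ball u N) Z) t O‖ ≤
      2 * ν 0 * Real.exp (2 * v * t) * (b.card * v / ν q +
        (b.card + 1) * P.eval (N : ℝ) / ν (r / 2)) * ‖O‖ * t := by
  classical
  set J := ⌊r / 2⌋₊ with hJ
  have hcollΛ : ∀ Z ∈ coll, Z ⊆ (ball u N) := fun Z hZ => (hcoll Z hZ).trans hb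
  refine norm_semigroup_sub_semigroup_le (isDissipative_closedGenerator F u N) O ht ?_
  intro s hs0 hst
  set Os := semigroup (∑ Z ∈ coll, bulkTerm F (ball u N) Z) s O with hOs
  have hOsn : ‖Os‖ ≤ ‖O‖ := (IsDissipative.sum _ fun Z _ =>
    isDissipative_bulkTerm F (ball u N) Z).norm_semigroup_apply_le O hs0
  have hOsb : SupportedOn ω b Os := supportedOn_semigroup hcoll (hO.mono hXb) s
  have hν0 := hν.pos 0 le_rfl
  have hνq := hν.pos q hq0
  have hνr := hν.pos (r / 2) (by positivity)
  set K := Real.exp (2 * v * t) * (2 * ν 0 * ‖O‖) with hK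
  have hK0 : 0 ≤ K := by positivity
  -- the Lieb-Robinson bound for the smaller evolution, which does not leave `b`
  have hΔ : ∀ x ∈ b, ‖Os - siteFreeze ω x Os‖ ≤ K / ν (ℓ x) := by
    intro x hx
    refine (norm_sub_siteFreeze_le hν hF ω hcollΛ hℓ hℓX hO hs0 (hb hx)).trans ?_
    have := hν.pos (ℓ x) (Nat.cast_nonneg _)
    rw [hK]
    gcongr
  have hΔ0 : ∀ x ∈ (ball u N), x ∉ b → ‖Os - siteFreeze ω x Os‖ = 0 := by
    intro x hx hxb
    have hx1 : {x} ⊆ (ball u N) := Finset.singleton_subset_iff.2 hx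
    rw [siteFreeze_eq ω x hx1, hOsb.freeze_eq hx1 (Finset.disjoint_singleton_left.2 hxb), sub_self,
      norm_zero]
  -- the omitted local terms, counted by the sites of `b`
  have hbulk : ‖(∑ Z ∈ (ball u N).powerset with Z ∉ coll, bulkTerm F (ball u N) Z) Os‖ ≤
      b.card * v * (K / ν q) := by
    rw [sum_apply]
    refine (norm_sum_le _ _).trans ?_
    calc ∑ Z ∈ (ball u N).powerset with Z ∉ coll, ‖bulkTerm F (ball u N) Z Os‖
        ≤ ∑ Z ∈ (ball u N).powerset with Z ∉ coll, ∑ x ∈ b with x ∈ Z,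
          diamondNorm (F.bulk Z) * (Z.card : ℝ) * ν (diam Z) * (K / ν q) := by
          refine Finset.sum_le_sum fun Z hZ => ?_
          obtain ⟨hZ1, hZ2⟩ := Finset.mem_filter.1 hZ
          rw [Finset.mem_powerset] at hZ1
          refine (norm_bulkTerm_le F ω hZ1 Os).trans ?_
          have e : ∑ x ∈ Z, ‖Os - siteFreeze ω x Os‖ =
              ∑ x ∈ b with x ∈ Z, ‖Os - siteFreeze ω x Os‖ := by
            symm
            refine Finset.sum_subset_zero_on_sdiff (fun x hx => (Finset.mem_filter.1 hx).2) ?_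
              (fun _ _ => rfl)
            intro x hx
            rw [Finset.mem_sdiff, Finset.mem_filter] at hx
            exact hΔ0 x (hZ1 hx.1) fun hxb => hx.2 ⟨hxb, hx.1⟩
          rw [e, Finset.mul_sum]
          refine Finset.sum_le_sum fun x hx => ?_
          obtain ⟨hxb, hxZ⟩ := Finset.mem_filter.1 hx
          have hcard : (1 : ℝ) ≤ Z.card := by
            exact_mod_cast Finset.card_pos.2 ⟨x, hxZ⟩
          have hνd := hν.pos (diam Z) (Nat.cast_nonneg _)
          have hνl := hν.pos (ℓ x) (Nat.cast_nonneg _)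
          have h1 : ν q ≤ ν (diam Z) * ν (ℓ x) := by
            refine le_trans ?_ (hν.submul _ _ (Nat.cast_nonneg _) (Nat.cast_nonneg _))
            exact hν.mono hq0 (Set.mem_Ici.2 (by positivity)) (hq Z hZ1 hZ2 x hxZ hxb)
          have h2 : K / ν (ℓ x) ≤ Z.card * ν (diam Z) * (K / ν q) := by
            rw [div_le_iff₀ hνl]
            have : (Z.card : ℝ) * ν (diam Z) * (K / ν q) * ν (ℓ x) =
                Z.card * ((ν (diam Z) * ν (ℓ x)) / ν q) * K := by ring
            rw [this]
            have h3 : 1 ≤ (ν (diam Z) * ν (ℓ x)) / ν q := by rwa [one_le_div hνq]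
            have h4 : 1 ≤ (Z.card : ℝ) * ((ν (diam Z) * ν (ℓ x)) / ν q) :=
              one_le_mul_of_one_le_of_one_le hcard h3
            exact le_mul_of_one_le_left hK0 h4
          have h5 := mul_le_mul_of_nonneg_left ((hΔ x hxb).trans h2) (diamondNorm_nonneg (F.bulk Z))
          linarith
      _ = ∑ x ∈ b, ∑ Z ∈ (ball u N).powerset.filter (fun Z => Z ∉ coll) with x ∈ Z,
          diamondNorm (F.bulk Z) * (Z.card : ℝ) * ν (diam Z) * (K / ν q) := by
          refine Finset.sum_comm' fun Z x => ?_
          simp only [Finset.mem_filter]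
          tauto
      _ ≤ ∑ x ∈ b, v * (K / ν q) := by
          refine Finset.sum_le_sum fun x _ => ?_
          rw [← Finset.sum_mul]
          exact mul_le_mul_of_nonneg_right (sum_bulk_le hν hF _ x) (by positivity)
      _ = b.card * v * (K / ν q) := by
          rw [Finset.sum_const, nsmul_eq_mul]; ring
  -- the boundary terms: a site of `b` in the layer of width `J = ⌊r / 2⌋` has `ℓ x ≥ r / 2`
  have hJ1 : r / 2 ≤ J + 1 := (Nat.lt_floor_add_one _).le
  have hJ2 : (J : ℝ) ≤ r / 2 := Nat.floor_le (by positivity)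
  have hlayer : ∑ x ∈ layer u N J, ‖Os - siteFreeze ω x Os‖ ≤ b.card * (K / ν (r / 2)) := by
    have e : ∑ x ∈ layer u N J, ‖Os - siteFreeze ω x Os‖ =
        ∑ x ∈ b with x ∈ layer u N J, ‖Os - siteFreeze ω x Os‖ := by
      symm
      refine Finset.sum_subset_zero_on_sdiff (fun x hx => (Finset.mem_filter.1 hx).2) ?_
        (fun _ _ => rfl)
      intro x hx
      rw [Finset.mem_sdiff, Finset.mem_filter] at hx
      exact hΔ0 x (layer_subset u N J hx.1) fun hxb => hx.2 ⟨hxb, hx.1⟩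
    rw [e]
    refine (Finset.sum_le_card_nsmul _ _ (K / ν (r / 2)) fun x hx => ?_).trans ?_
    · obtain ⟨hxb, hxl⟩ := Finset.mem_filter.1 hx
      refine (hΔ x hxb).trans ?_
      have : ν (r / 2) ≤ ν (ℓ x) := by
        refine hν.mono (Set.mem_Ici.2 (by positivity)) (Set.mem_Ici.2 (Nat.cast_nonneg _)) ?_
        simp only [layer, Finset.mem_filter] at hxl
        obtain ⟨_, y, hy1, hy2⟩ := hxl
        have h1 := hr x hxb y hy1
        have h2 : (gdist x y : ℝ) ≤ J := by exact_mod_cast hy2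
        linarith
      gcongr
    · rw [nsmul_eq_mul]
      gcongr
      exact Finset.filter_subset _ _
  have hbdry := norm_sum_bdryTerm_le hν hF u N J ω Os
  have hP0 : 0 ≤ P.eval (N : ℝ) := by
    have h := hF.2 u N 0
    refine le_trans (mul_nonneg (hν.pos _ (Nat.cast_nonneg _)).le
      (Finset.sum_nonneg fun j _ => diamondNorm_nonneg _)) h
  have e : toCLM (dual (F.closedGenerator u N)) - ∑ Z ∈ coll, bulkTerm F (ball u N) Z =
      ∑ Z ∈ (ball u N).powerset with Z ∉ coll, bulkTerm F (ball u N) Z +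
        ∑ j ∈ Finset.Icc 1 (N + 1), bdryTerm F u N j := by
    rw [toCLM_dual_closedGenerator,
      ← Finset.sum_filter_add_sum_filter_not (ball u N).powerset (fun Z => Z ∈ coll)]
    have : (ball u N).powerset.filter (fun Z => Z ∈ coll) = coll := by
      ext Z
      simp only [Finset.mem_filter, Finset.mem_powerset]
      exact ⟨fun h => h.2, fun h => ⟨hcollΛ Z h, h⟩⟩
    rw [this]
    abel
  rw [e, add_apply]
  refine (norm_add_le _ _).trans ?_
  have h1 : P.eval (N : ℝ) / ν (J + 1) ≤ P.eval (N : ℝ) / ν (r / 2) := by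
    have : ν (r / 2) ≤ ν (J + 1) := hν.mono (Set.mem_Ici.2 (by positivity))
      (Set.mem_Ici.2 (by positivity)) hJ1
    gcongr
  have h2 : 2 * (P.eval (N : ℝ) / ν (J + 1)) * ‖Os‖ ≤ P.eval (N : ℝ) / ν (r / 2) * K := by
    have hE : 1 ≤ Real.exp (2 * v * t) := Real.one_le_exp (by positivity)
    have hn1 := hν.one_le le_rfl
    have : 2 * ‖O‖ ≤ K := by
      rw [hK]
      have : 1 ≤ Real.exp (2 * v * t) * ν 0 := one_le_mul_of_one_le_of_one_le hE hn1
      nlinarith [norm_nonneg O]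
    have hPr : 0 ≤ P.eval (N : ℝ) / ν (r / 2) := div_nonneg hP0 hνr.le
    have a1 : 2 * (P.eval (N : ℝ) / ν (J + 1)) * ‖Os‖ ≤ 2 * (P.eval (N : ℝ) / ν (r / 2)) * ‖O‖ :=
      mul_le_mul (mul_le_mul_of_nonneg_left h1 zero_le_two) hOsn (norm_nonneg _) (by linarith)
    have a2 := mul_le_mul_of_nonneg_left this hPr
    linarith
  have h3 := mul_le_mul_of_nonneg_left hlayer hP0
  calc _ ≤ b.card * v * (K / ν q) + (P.eval (N : ℝ) * (b.card * (K / ν (r / 2))) +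
        P.eval (N : ℝ) / ν (r / 2) * K) := by
        refine add_le_add hbulk (hbdry.trans (add_le_add h3 h2))
    _ = _ := by rw [hK]; ring

end Family

/-! ### States and infinite time limits -/

section States

variable {n : Type} [Fintype n] [DecidableEq n]

/-- A functional of norm one which is one on the identity is a state: compare its values at the
unitary operators `1 + (z - 1) p`, for rank one projections `p` and `|z| = 1`. -/
theorem isState_of_norm_trace_le {Y : Matrix n n ℂ} (h1 : Y.trace = 1)
    (h : ∀ F : Matrix n n ℂ, ‖(F * Y).trace‖ ≤ ‖F‖) : IsState Y := by
  refine ⟨?_, h1⟩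
  have key : ∀ v : n → ℂ, normSq v = 1 → 0 ≤ star v ⬝ᵥ Y.mulVec v := by
    intro v hv
    set p := star v ⬝ᵥ Y.mulVec v with hp
    set Q := Matrix.vecMulVec v (star v) with hQ
    have hvv : star v ⬝ᵥ v = 1 := by
      have h2 := trace_vecMulVec_star v
      rw [Matrix.trace_vecMulVec, hv] at h2
      rw [dotProduct_comm, h2]; simp
    have hQQ : Q * Q = Q := by
      rw [hQ, Matrix.vecMulVec_mul_vecMulVec, hvv]; simp
    have hQs : Q.conjTranspose = Q := by
      rw [hQ, Matrix.conjTranspose_vecMulVec, star_star]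
    have htr : ∀ z : ℂ, ((1 + (z - 1) • Q) * Y).trace = 1 + (z - 1) * p := by
      intro z
      rw [Matrix.add_mul, Matrix.one_mul, Matrix.trace_add, h1, Matrix.smul_mul, Matrix.trace_smul,
        Matrix.trace_mul_comm, hQ, trace_mul_vecMulVec, smul_eq_mul]
    have hnorm : ∀ z : ℂ, ‖z‖ = 1 → ‖1 + (z - 1) • Q‖ ≤ 1 := by
      intro z hz
      have hzz : star z * z = 1 := by
        have := Complex.conj_mul' z
        rw [hz] at this
        simpa using this
      have hu : (1 + (z - 1) • Q).conjTranspose * (1 + (z - 1) • Q) = 1 := by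
        rw [Matrix.conjTranspose_add, Matrix.conjTranspose_one, Matrix.conjTranspose_smul, hQs]
        simp only [Matrix.add_mul, Matrix.mul_add, Matrix.one_mul, Matrix.mul_one, Matrix.smul_mul,
          Matrix.mul_smul, hQQ, star_sub, star_one]
        have : (star z - 1) + ((z - 1) + (z - 1) * (star z - 1)) = 0 := by
          linear_combination hzz
        have h3 : (star z - 1) • Q + (z - 1) • (Q + (star z - 1) • Q) = 0 := by
          rw [smul_add, smul_smul, ← add_smul, ← add_smul, this, zero_smul]
        rw [add_assoc, h3, add_zero]
      have h4 := Matrix.l2_opNorm_conjTranspose_mul_self (1 + (z - 1) • Q)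
      rw [hu] at h4
      have : Nonempty n := by
        by_contra hne
        rw [not_nonempty_iff] at hne
        simp [normSq] at hv
      rw [norm_one] at h4
      nlinarith [norm_nonneg (1 + (z - 1) • Q)]
    have hmain : ∀ z : ℂ, ‖z‖ = 1 → Complex.normSq (1 + (z - 1) * p) ≤ 1 := by
      intro z hz
      have := (h (1 + (z - 1) • Q)).trans (hnorm z hz)
      rw [htr] at this
      rw [Complex.normSq_eq_norm_sq]
      nlinarith [norm_nonneg (1 + (z - 1) * p)]
    have hre : p.re ^ 2 + p.im ^ 2 ≤ p.re := by
      have := hmain (-1) (by simp)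
      simp only [Complex.normSq_apply, Complex.add_re, Complex.mul_re, Complex.add_im,
        Complex.mul_im, Complex.sub_re, Complex.sub_im, Complex.neg_re, Complex.neg_im,
        Complex.one_re, Complex.one_im] at this
      nlinarith
    have him : p.im = 0 := by
      by_contra hb
      -- the Cayley transform `z = (1 + i s) / (1 - i s)` with a small `s` of suitable sign
      set K := p.re - (p.re ^ 2 + p.im ^ 2) with hK
      have hK0 : 0 ≤ K := by rw [hK]; linarith
      set s := - p.im / (K + 1) with hs
      have hs1 : (1 - Complex.I * s) ≠ 0 := by
        intro h0
        have := congrArg Complex.re h0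
        simp at this
      have hN : Complex.normSq (1 + Complex.I * s) = Complex.normSq (1 - Complex.I * s) := by
        simp [Complex.normSq_apply]
      have hz : ‖(1 + Complex.I * s) / (1 - Complex.I * s)‖ = 1 := by
        rw [norm_div, div_eq_one_iff_eq (norm_ne_zero_iff.2 hs1)]
        rw [Complex.normSq_eq_norm_sq, Complex.normSq_eq_norm_sq] at hN
        exact (sq_eq_sq₀ (norm_nonneg _) (norm_nonneg _)).1 hN
      have h5 := hmain _ hz
      have e : 1 + ((1 + Complex.I * s) / (1 - Complex.I * s) - 1) * p =
          (1 - Complex.I * s + 2 * Complex.I * s * p) / (1 - Complex.I * s) := by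
        field_simp
        ring
      rw [e, map_div₀, div_le_one (Complex.normSq_pos.2 hs1)] at h5
      simp only [Complex.normSq_apply, Complex.add_re, Complex.mul_re, Complex.add_im,
        Complex.mul_im, Complex.sub_re, Complex.sub_im, Complex.I_re, Complex.I_im,
        Complex.one_re, Complex.one_im, Complex.ofReal_re, Complex.ofReal_im, Complex.re_ofNat,
        Complex.im_ofNat] at h5
      have h6 : - s * p.im ≤ s ^ 2 * K := by rw [hK]; nlinarith
      have h7 : s * (K + 1) = - p.im := by rw [hs]; field_simp
      have hsne : s ≠ 0 := by
        intro h0; rw [h0, zero_mul] at h7; exact hb (by linarith)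
      have h8 : 0 < s ^ 2 := by positivity
      have h9 : - s * p.im = s ^ 2 * (K + 1) := by
        rw [show - s * p.im = s * (- p.im) by ring, ← h7]; ring
      linarith
    rw [Complex.le_def]
    exact ⟨by rw [Complex.zero_re]; nlinarith, by rw [him]; rfl⟩
  have key2 : ∀ v : n → ℂ, 0 ≤ star v ⬝ᵥ Y.mulVec v := by
    intro v
    by_cases hv : v = 0
    · simp [hv]
    have hv0 : 0 < normSq v := by
      rcases (normSq_nonneg v).eq_or_lt with h0 | h0
      · exfalso; apply hv
        have := normSq_eq v
        rw [← h0] at this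
        have h2 : ‖WithLp.toLp 2 v‖ = 0 := by
          exact pow_eq_zero_iff (two_ne_zero) |>.1 this.symm
        have h3 := norm_eq_zero.1 h2
        exact (WithLp.toLp_eq_zero 2).1 h3
      · exact h0
    set s : ℝ := (Real.sqrt (normSq v))⁻¹ with hs
    have hss : s ^ 2 * normSq v = 1 := by
      rw [hs, inv_pow, Real.sq_sqrt hv0.le, inv_mul_cancel₀ hv0.ne']
    have h2 := key ((s : ℂ) • v) (by
      simp only [normSq, Pi.smul_apply, smul_eq_mul, norm_mul, mul_pow, ← Finset.mul_sum,
        Complex.norm_real, Real.norm_eq_abs, sq_abs] at hss ⊢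
      exact hss)
    have e : star ((s : ℂ) • v) ⬝ᵥ Y.mulVec ((s : ℂ) • v) =
        ((s ^ 2 : ℝ) : ℂ) * (star v ⬝ᵥ Y.mulVec v) := by
      rw [star_smul, Matrix.mulVec_smul, smul_dotProduct, dotProduct_smul]
      simp only [smul_eq_mul, RCLike.star_def, Complex.conj_ofReal]
      push_cast
      ring
    rw [e] at h2
    have hs2 : 0 < s ^ 2 := by
      have : 0 < s := by rw [hs]; positivity
      positivity
    rw [Complex.le_def] at h2 ⊢
    rw [Complex.re_ofReal_mul, Complex.im_ofReal_mul] at h2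
    obtain ⟨h3, h4⟩ := h2
    constructor
    · exact (mul_nonneg_iff_of_pos_left hs2).1 h3
    · have : s ^ 2 * (star v ⬝ᵥ Y.mulVec v).im = 0 := h4.symm
      exact ((mul_eq_zero.1 this).resolve_left hs2.ne').symm
  refine Matrix.PosSemidef.of_dotProduct_mulVec_nonneg ?_ key2
  -- a matrix with real quadratic form is Hermitian
  rw [← Matrix.isSymmetric_toEuclideanLin_iff]
  rw [LinearMap.isSymmetric_iff_inner_map_self_real]
  intro x
  have h5 := key2 x.ofLp
  have e : inner ℂ (Matrix.toEuclideanLin Y x) x = star (star x.ofLp ⬝ᵥ Y.mulVec x.ofLp) := by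
    rw [quad_eq_inner, ← Matrix.coe_toEuclideanCLM_eq_toEuclideanLin]
    exact (inner_conj_symm _ _).symm
  rw [e]
  have h6 : (star x.ofLp ⬝ᵥ Y.mulVec x.ofLp).im = 0 := ((Complex.le_def.1 h5).2).symm
  have h7 : star (star x.ofLp ⬝ᵥ Y.mulVec x.ofLp) = star x.ofLp ⬝ᵥ Y.mulVec x.ofLp :=
    Complex.conj_eq_iff_im.2 h6
  rw [h7]
  exact h7

/-- The trace norm distance of operators bounds the difference of expectation values. -/
theorem norm_trace_mul_sub_le (F X Y : Matrix n n ℂ) :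
    ‖(F * X).trace - (F * Y).trace‖ ≤ ‖F‖ * traceNorm (X - Y) := by
  rw [← Matrix.trace_sub, ← Matrix.mul_sub]
  exact norm_trace_mul_le _ _

theorem IsState.norm_trace_mul_le {ρ : Matrix n n ℂ} (hρ : IsState ρ) (F : Matrix n n ℂ) :
    ‖(F * ρ).trace‖ ≤ ‖F‖ :=
  (DissipativeLattice.norm_trace_mul_le F ρ).trans
    (mul_le_of_le_one_right (norm_nonneg _) hρ.traceNorm_le_one)

/-- The infinite time limit of a state is a fixed point of the evolution for time one. -/
theorem infiniteTimeLimit_isState {L Tinf : SuperOp n} (hdiss : IsDissipative (toCLM (dual L)))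
    (hone : ∀ t, semigroup (toCLM (dual L)) t 1 = 1)
    (hT : IsInfiniteTimeLimit (evolve L) Tinf) {ρ : Matrix n n ℂ} (hρ : IsState ρ) :
    IsState (Tinf ρ) ∧ evolve L 1 (Tinf ρ) = Tinf ρ := by
  set G := toCLM (dual L) with hG
  have hcontr : ∀ (m : ℕ) (O : Matrix n n ℂ), ‖semigroup G m O‖ ≤ ‖O‖ := fun m O =>
    hdiss.norm_semigroup_apply_le O (Nat.cast_nonneg m)
  -- Cesàro means of the expectation values
  have hlim : ∀ O : Matrix n n ℂ, Tendsto (fun n : ℕ => ((n : ℂ) + 1)⁻¹ *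
      ∑ m ∈ Finset.range (n + 1), (semigroup G m O * ρ).trace) atTop (𝓝 (O * Tinf ρ).trace) := by
    intro O
    have hc : Continuous fun X : Matrix n n ℂ => (O * X).trace := by fun_prop
    have := (hc.tendsto _).comp (hT ρ)
    refine this.congr fun n => ?_
    simp only [Function.comp_apply, Matrix.mul_smul, Matrix.trace_smul, Matrix.mul_sum,
      Matrix.trace_sum, smul_eq_mul]
    congr 1
    refine Finset.sum_congr rfl fun m _ => ?_
    have := trace_mul_evolve L (m : ℝ) O ρ
    exact_mod_cast this
  have hbound : ∀ (m : ℕ) (O : Matrix n n ℂ), ‖(semigroup G m O * ρ).trace‖ ≤ ‖O‖ := fun m O =>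
    (hρ.norm_trace_mul_le _).trans (hcontr m O)
  have hn : ∀ n : ℕ, ‖((n : ℂ) + 1)⁻¹‖ = ((n : ℝ) + 1)⁻¹ := by
    intro n
    rw [norm_inv]
    congr 1
    have : ((n : ℂ) + 1) = ((n + 1 : ℝ) : ℂ) := by push_cast; rfl
    rw [this, Complex.norm_real, Real.norm_of_nonneg (by positivity)]
  constructor
  · refine isState_of_norm_trace_le ?_ fun O => ?_
    · have h1 := hlim 1
      rw [Matrix.one_mul] at h1
      refine tendsto_nhds_unique h1 ?_
      refine tendsto_const_nhds.congr fun n => ?_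
      have h2 : ∀ m : ℕ, (semigroup G m 1 * ρ).trace = 1 := by
        intro m
        rw [hone, Matrix.one_mul, hρ.2]
      simp only [h2, Finset.sum_const, Finset.card_range, nsmul_eq_mul, mul_one]
      push_cast
      rw [inv_mul_cancel₀]
      exact_mod_cast n.succ_ne_zero
    · refine le_of_tendsto (hlim O).norm (Eventually.of_forall fun n => ?_)
      rw [norm_mul, hn, inv_mul_le_iff₀ (by positivity)]
      refine (norm_sum_le _ _).trans ?_
      refine (Finset.sum_le_card_nsmul _ _ _ fun m _ => hbound m O).trans ?_
      simp
  · refine Matrix.ext_iff_trace_mul_left.2 fun O => ?_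
    rw [trace_mul_evolve, ← hG]
    have h1 := hlim (semigroup G 1 O)
    have h2 := (hlim O)
    have h3 := h1.sub h2
    have h4 : Tendsto (fun n : ℕ => ((n : ℝ) + 1)⁻¹ * (2 * ‖O‖)) atTop (𝓝 0) := by
      have : Tendsto (fun n : ℕ => ((n : ℝ) + 1)⁻¹) atTop (𝓝 0) := by
        simpa [one_div] using tendsto_one_div_add_atTop_nhds_zero_nat (𝕜 := ℝ)
      simpa using this.mul_const (2 * ‖O‖)
    have h5 : Tendsto (fun n : ℕ => ((n : ℂ) + 1)⁻¹ *
        ∑ m ∈ Finset.range (n + 1), (semigroup G m (semigroup G 1 O) * ρ).trace -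
        ((n : ℂ) + 1)⁻¹ * ∑ m ∈ Finset.range (n + 1), (semigroup G m O * ρ).trace)
        atTop (𝓝 0) := by
      refine squeeze_zero_norm (fun n => ?_) h4
      have e : ∀ m : ℕ, semigroup G m (semigroup G 1 O) = semigroup G ((m + 1 : ℕ) : ℝ) O := by
        intro m
        push_cast
        rw [semigroup_add]; rfl
      simp only [e]
      rw [← mul_sub, ← Finset.sum_sub_distrib, Finset.sum_range_sub
        (fun m : ℕ => (semigroup G (m : ℝ) O * ρ).trace), norm_mul, hn]
      refine mul_le_mul_of_nonneg_left ?_ (by positivity)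
      have a1 := hbound (n + 1) O
      have a2 := hbound 0 O
      have a3 := norm_sub_le (semigroup G ((n + 1 : ℕ) : ℝ) O * ρ).trace
        (semigroup G ((0 : ℕ) : ℝ) O * ρ).trace
      linarith
    exact sub_eq_zero.1 (tendsto_nhds_unique h3 h5)

end States

/-! ### Loss of memory from rapid mixing -/

section Mixing

variable {D : ℕ} {d : Site D → ℕ} {F : UniformFamily d}

theorem trace_mul_closedEvolution (u : Site D) (N : ℕ) (t : ℝ) (O ρ : Op d (ball u N)) :
    (O * F.closedEvolution u N t ρ).trace =
      (semigroup (toCLM (dual (F.closedGenerator u N))) t O * ρ).trace :=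
  trace_mul_evolve _ _ _ _

/-- On a ball, rapid mixing and the uniqueness of the fixed point make any two states
indistinguishable after a long time. -/
theorem norm_trace_semigroup_sub_le {c γ δ : ℝ} (hmix : F.RapidMixing c γ δ)
    {u : Site D} {N : ℕ} (hu : HasUniqueFixedState (F.closedEvolution u N))
    {ρ₁ ρ₂ : Op d (ball u N)} (h₁ : IsState ρ₁) (h₂ : IsState ρ₂) {t : ℝ} (ht : 0 ≤ t)
    (O : Op d (ball u N)) :
    ‖(semigroup (toCLM (dual (F.closedGenerator u N))) t O * ρ₁).trace -
      (semigroup (toCLM (dual (F.closedGenerator u N))) t O * ρ₂).trace‖ ≤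
      2 * (c * ((ball u N).card : ℝ) ^ δ * Real.exp (-(γ * t))) * ‖O‖ := by
  obtain ⟨Tinf, hT, hm⟩ := hmix u N
  obtain ⟨s1, f1⟩ := infiniteTimeLimit_isState (isDissipative_closedGenerator F u N)
    (semigroup_closedGenerator_one F u N) hT h₁
  obtain ⟨s2, f2⟩ := infiniteTimeLimit_isState (isDissipative_closedGenerator F u N)
    (semigroup_closedGenerator_one F u N) hT h₂
  have e : Tinf ρ₁ = Tinf ρ₂ :=
    hu.1.unique (hu.2 _ 1 s1 one_pos f1) (hu.2 _ 1 s2 one_pos f2)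
  rw [← trace_mul_closedEvolution, ← trace_mul_closedEvolution]
  have b1 := (norm_trace_mul_sub_le O (F.closedEvolution u N t ρ₁) (Tinf ρ₁)).trans
    (mul_le_mul_of_nonneg_left (hm t ht ρ₁ h₁) (norm_nonneg _))
  have b2 := (norm_trace_mul_sub_le O (F.closedEvolution u N t ρ₂) (Tinf ρ₂)).trans
    (mul_le_mul_of_nonneg_left (hm t ht ρ₂ h₂) (norm_nonneg _))
  rw [← e] at b2
  have b3 := norm_sub_le
    ((O * F.closedEvolution u N t ρ₁).trace - (O * Tinf ρ₁).trace)
    ((O * F.closedEvolution u N t ρ₂).trace - (O * Tinf ρ₁).trace)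
  rw [sub_sub_sub_cancel_right] at b3
  linarith

end Mixing

/-! ### Reduced states -/

section Reduce

variable {D : ℕ} {d : Site D → ℕ} {A B Λ X b : Finset (Site D)}

theorem reduce_isState (h : X ⊆ Λ) {ρ : Op d Λ} (hρ : IsState ρ) : IsState (reduce X ρ) := by
  refine isState_of_norm_trace_le ?_ fun F => ?_
  · have := trace_lift_mul h (1 : Op d X) ρ
    rw [lift_one, Matrix.one_mul, Matrix.one_mul, hρ.2] at this
    exact this.symm
  · rw [← trace_lift_mul h]
    exact (hρ.norm_trace_mul_le _).trans (norm_lift_le h F)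

theorem reduce_reduce (hX : X ⊆ b) (hb : b ⊆ Λ) (ρ : Op d Λ) :
    reduce X (reduce b ρ) = reduce X ρ := by
  refine Matrix.ext_iff_trace_mul_left.2 fun F => ?_
  rw [← trace_lift_mul hX, ← trace_lift_mul hb, lift_lift, trace_lift_mul]

theorem norm_evalOn_state_le (h : X ⊆ Λ) {τ : Op d X} (hτ : IsState τ) (O : Op d Λ) :
    ‖evalOn h τ O‖ ≤ ‖O‖ :=
  (norm_evalOn_apply_le h τ O).trans
    (mul_le_of_le_one_left (norm_nonneg _) hτ.traceNorm_le_one)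

theorem freeze_self (ω : Conf d Λ) (O : Op d Λ) :
    freeze ω (Finset.Subset.refl Λ) O = O ω ω • 1 := by
  ext σ τ
  rw [freeze_apply, Matrix.smul_apply, smul_eq_mul]
  have h2 : ∀ σ : Conf d Λ, upd σ (restrict (Finset.Subset.refl Λ) ω) = ω := fun σ =>
    restrict_upd (Finset.Subset.refl Λ) σ (restrict (Finset.Subset.refl Λ) ω)
  rw [h2, h2]
  rfl

theorem SupportedOn.evalOn_apply {ω : Conf d Λ} {O : Op d Λ} (hO : SupportedOn ω (A ∪ B) O)
    (hA : A ⊆ Λ) (τ : Op d A) : SupportedOn ω B (evalOn hA τ O) := by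
  have hs : (Λ \ B) \ A ⊆ Λ := Finset.sdiff_subset.trans Finset.sdiff_subset
  -- the complement of `B` is made of sites outside of `A ∪ B` and of sites of `A`
  have h1 : freeze ω hs (evalOn hA τ O) = evalOn hA τ O := by
    have hc : Commute (freeze ω hs) (evalOn hA τ) :=
      commute_evalOn _ _ Finset.sdiff_disjoint _ _
    have := congrArg (fun T : Op d Λ →L[ℂ] Op d Λ => T O) hc.eq
    change freeze ω hs (evalOn hA τ O) =
      evalOn hA τ (freeze ω hs O) at this
    rw [this, hO.freeze_eq hs]
    rw [sdiff_sdiff_left]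
    exact Finset.disjoint_of_subset_right (by rw [Finset.sup_eq_union, Finset.union_comm])
      Finset.sdiff_disjoint
  have hAd : A \ B ⊆ Λ := Finset.sdiff_subset.trans hA
  have h2 : freeze ω hAd (evalOn hA τ O) = evalOn hA τ O := by
    have e1 := congrArg (fun T : Op d Λ →L[ℂ] Op d Λ => T O) (freeze_mul_evalOn ω hA τ)
    have e2 := congrArg (fun T : Op d Λ →L[ℂ] Op d Λ => T (evalOn hA τ O))
      (freeze_mul_of_subset ω (Finset.sdiff_subset : A \ B ⊆ A) hA)
    change freeze ω hA (evalOn hA τ O) = evalOn hA τ O at e1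
    change freeze ω hAd (freeze ω hA (evalOn hA τ O)) =
      freeze ω hA (evalOn hA τ O) at e2
    rwa [e1] at e2
  have hU : (Λ \ B) \ A ∪ A \ B ⊆ Λ := Finset.union_subset hs hAd
  have h3 := freeze_union ω hs hAd hU (Finset.disjoint_left.2 fun x hx hx' =>
    (Finset.mem_sdiff.1 hx).2 (Finset.mem_sdiff.1 hx').1)
  have h4 : freeze ω hU (evalOn hA τ O) = evalOn hA τ O := by
    rw [h3]
    change freeze ω hs (freeze ω hAd _) = _
    rw [h2, h1]
  have e : (Λ \ B) \ A ∪ A \ B = Λ \ B := by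
    ext x
    simp only [Finset.mem_union, Finset.mem_sdiff]
    have := @hA x
    tauto
  unfold SupportedOn
  convert h4 using 3
  exact e.symm

end Reduce

/-! ### Correlations after a decoupled evolution -/

section Split

variable {D : ℕ} {d : Site D → ℕ} {F : UniformFamily d} {A B Z Λ X bA bB b : Finset (Site D)}

theorem bulkTerm_apply_eq_zero {ω : Conf d Λ} {O : Op d Λ} (hO : SupportedOn ω X O)
    (hd : Disjoint Z X) : bulkTerm F Λ Z O = 0 := by
  by_cases h : Z ⊆ Λ
  · rw [bulkTerm_of_subset F h, ← hO.freeze_eq h hd, toCLM_apply, embed_freeze]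
    have h1 := bulkTerm_one F Λ Z
    rw [bulkTerm_of_subset F h, toCLM_apply] at h1
    rw [h1, zero_mul]
  · rw [bulkTerm, dif_neg h]; rfl

theorem commute_bulkTerm {Z' : Finset (Site D)} (hd : Disjoint Z Z') :
    Commute (bulkTerm F Λ Z) (bulkTerm F Λ Z') := by
  by_cases h : Z ⊆ Λ
  · by_cases h' : Z' ⊆ Λ
    · rw [bulkTerm_of_subset F h, bulkTerm_of_subset F h']
      exact (commute_embed h h' hd _ _).map toCLM
    · rw [bulkTerm, bulkTerm, dif_neg h']; exact Commute.zero_right _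
  · rw [bulkTerm, dif_neg h]; exact Commute.zero_left _

theorem semigroup_bulk_eq_self {ω : Conf d Λ} {coll : Finset (Finset (Site D))}
    (hcoll : ∀ Z ∈ coll, Z ⊆ b) {O : Op d Λ} (hO : SupportedOn ω X O) (hd : Disjoint b X) (t : ℝ) :
    semigroup (∑ Z ∈ coll, bulkTerm F Λ Z) t O = O := by
  refine semigroup_apply_of_eq_zero ?_ t
  rw [sum_apply]
  exact Finset.sum_eq_zero fun Z hZ =>
    bulkTerm_apply_eq_zero hO (Finset.disjoint_of_subset_left (hcoll Z hZ) hd)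

theorem norm_semigroup_bulk_le (coll : Finset (Finset (Site D))) (O : Op d Λ) {t : ℝ} (ht : 0 ≤ t) :
    ‖semigroup (∑ Z ∈ coll, bulkTerm F Λ Z) t O‖ ≤ ‖O‖ :=
  (IsDissipative.sum _ fun Z _ => isDissipative_bulkTerm F Λ Z).norm_semigroup_apply_le O ht

/-- If the expectation values in `ρ` of the operators on `A ∪ B` are close to those of an evolution
without interaction between `bA ⊇ A` and `bB ⊇ B`, started in a product state, then `A` and `B` are
almost uncorrelated. With `Φ` the evolution on `bA` followed by evaluation in the product state, and
`Ψ` that on `bB`, the approximation `ρ ≈ Φ Ψ` on operators on `A ∪ B` is also used for the operators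
`Ψ O` and `ρ_A O` in place of `O`; since `Φ Ψ = Ψ Φ`, `Ψ Ψ = Ψ` and `Φ ρ_A = ρ_A`, this gives
`ρ_AB ≈ Φ Ψ ≈ ρ_A Ψ = Ψ ρ_A ≈ ρ_B ρ_A` without estimates of completely bounded norms. -/
theorem traceCorrelation_le_of_split {collA collB : Finset (Finset (Site D))}
    (ω : Conf d Λ) (hA : A ⊆ bA) (hB : B ⊆ bB) (hdisj : Disjoint bA bB) (hunion : bA ∪ bB = Λ)
    (hcA : ∀ Z ∈ collA, Z ⊆ bA) (hcB : ∀ Z ∈ collB, Z ⊆ bB) (hcd : Disjoint collA collB)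
    {ρ : Op d Λ} (hρ : IsState ρ) {t e : ℝ} (ht : 0 ≤ t) (he : 0 ≤ e)
    (h : ∀ O, SupportedOn ω (A ∪ B) O → ‖(ρ * O).trace -
      semigroup (∑ Z ∈ collA ∪ collB, bulkTerm F Λ Z) t O ω ω‖ ≤ e * ‖O‖) :
    traceCorrelation A B ρ ≤ 3 * e := by
  have hbA : bA ⊆ Λ := hunion ▸ Finset.subset_union_left
  have hbB : bB ⊆ Λ := hunion ▸ Finset.subset_union_right
  have hAΛ : A ⊆ Λ := hA.trans hbA
  have hBΛ : B ⊆ Λ := hB.trans hbB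
  have hABΛ : A ∪ B ⊆ Λ := Finset.union_subset hAΛ hBΛ
  have hAB : Disjoint A B := Finset.disjoint_of_subset_left hA
    (Finset.disjoint_of_subset_right hB hdisj)
  obtain ⟨SA, hSA⟩ : ∃ SA, SA = semigroup (∑ Z ∈ collA, bulkTerm F Λ Z) t := ⟨_, rfl⟩
  obtain ⟨SB, hSB⟩ : ∃ SB, SB = semigroup (∑ Z ∈ collB, bulkTerm F Λ Z) t := ⟨_, rfl⟩
  have hS : semigroup (∑ Z ∈ collA ∪ collB, bulkTerm F Λ Z) t = SA * SB := by
    rw [Finset.sum_union hcd, semigroup_add_of_commute, hSA, hSB]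
    refine Commute.sum_left _ _ _ fun Z hZ => Commute.sum_right _ _ _ fun Z' hZ' => ?_
    exact commute_bulkTerm (Finset.disjoint_of_subset_left (hcA Z hZ)
      (Finset.disjoint_of_subset_right (hcB Z' hZ') hdisj))
  have hcommA : ∀ {Y : Finset (Site D)} (hY : Y ⊆ Λ) (τ : Op d Y), Disjoint Y bA → ∀ O,
      evalOn hY τ (SA O) = SA (evalOn hY τ O) := by
    intro Y hY τ hd O
    rw [hSA]
    exact semigroup_apply_comm (Commute.sum_right _ _ _ fun Z hZ => commute_evalOn_bulkTerm F _ _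
      (Finset.disjoint_of_subset_right (hcA Z hZ) hd)) t O
  have hcommB : ∀ {Y : Finset (Site D)} (hY : Y ⊆ Λ) (τ : Op d Y), Disjoint Y bB → ∀ O,
      evalOn hY τ (SB O) = SB (evalOn hY τ O) := by
    intro Y hY τ hd O
    rw [hSB]
    exact semigroup_apply_comm (Commute.sum_right _ _ _ fun Z hZ => commute_evalOn_bulkTerm F _ _
      (Finset.disjoint_of_subset_right (hcB Z hZ) hd)) t O
  have hcomm : ∀ {Y Y' : Finset (Site D)} (hY : Y ⊆ Λ) (hY' : Y' ⊆ Λ) (τ : Op d Y) (τ' : Op d Y'),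
      Disjoint Y Y' → ∀ O, evalOn hY τ (evalOn hY' τ' O) = evalOn hY' τ' (evalOn hY τ O) :=
    fun hY hY' τ τ' hd O => congrArg (fun T : Op d Λ →L[ℂ] Op d Λ => T O)
      (commute_evalOn hY hY' hd τ τ').eq
  have hSAB : ∀ O, SA (SB O) = SB (SA O) := by
    intro O
    rw [hSA]
    refine (semigroup_apply_comm (Commute.symm ?_) t O).symm
    rw [hSB]
    refine commute_semigroup ?_ t
    refine Commute.sum_left _ _ _ fun Z hZ => Commute.sum_right _ _ _ fun Z' hZ' => ?_
    exact commute_bulkTerm (Finset.disjoint_of_subset_left (hcA Z hZ)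
      (Finset.disjoint_of_subset_right (hcB Z' hZ') hdisj))
  have hnB : ∀ O, ‖freeze ω hbB (SB O)‖ ≤ ‖O‖ := fun O =>
    (norm_freeze_apply_le ω hbB _).trans (hSB ▸ norm_semigroup_bulk_le collB O ht)
  have hsA := reduce_isState hAΛ hρ
  -- the approximation of the state by the product of the two evolutions
  have key : ∀ O, SupportedOn ω (A ∪ B) O →
      ‖(ρ * O).trace • (1 : Op d Λ) - freeze ω hbA (SA (freeze ω hbB (SB O)))‖ ≤ e * ‖O‖ := by
    intro O hO
    have e1 : freeze ω hbA (SA (freeze ω hbB (SB O))) = ((SA (SB O)) ω ω) • (1 : Op d Λ) := by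
      have e2 : SA (freeze ω hbB (SB O)) = freeze ω hbB (SA (SB O)) :=
        (hcommA hbB _ hdisj.symm _).symm
      rw [e2]
      have e3 := congrArg (fun T : Op d Λ →L[ℂ] Op d Λ => T (SA (SB O)))
        (freeze_union ω hbA hbB (Finset.union_subset hbA hbB) hdisj)
      change _ = freeze ω hbA (freeze ω hbB (SA (SB O))) at e3
      rw [← e3, ← freeze_self]
      congr 2
    have h1 := h O hO
    rw [hS] at h1
    change ‖(ρ * O).trace - (SA (SB O)) ω ω‖ ≤ _ at h1
    rw [e1, ← sub_smul, norm_smul, norm_one_op ω, mul_one]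
    exact h1
  refine traceCorrelation_le_of_evalOn ω hAΛ hBΛ hABΛ hAB ρ fun O hO => ?_
  have hOB : SupportedOn ω B (evalOn hAΛ (reduce A ρ) O) := hO.evalOn_apply hAΛ _
  have hdA : Disjoint bA B := Finset.disjoint_of_subset_right hB hdisj
  have hdB : Disjoint bB A := Finset.disjoint_of_subset_right hA hdisj.symm
  have hABA : A ∪ B ⊆ A ∪ bB := Finset.union_subset_union_right hB
  -- `Ψ O` is supported on `A`
  have hPsi : SupportedOn ω A (freeze ω hbB (SB O)) := by
    have hO1 : SupportedOn ω (bB ∪ A) (SB O) := by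
      rw [hSB]
      refine supportedOn_semigroup (fun Z hZ => (hcB Z hZ).trans Finset.subset_union_left)
        (hO.mono ?_) t
      rw [Finset.union_comm bB]; exact hABA
    exact hO1.evalOn_apply hbB _
  have k1 := key O hO
  have k2 := key _ (hPsi.mono (Finset.subset_union_left (s₂ := B)))
  have k3 := key _ (hOB.mono (Finset.subset_union_right (s₁ := A)))
  rw [← hO.evalOn_reduce hABΛ] at k1
  -- `ρ_A Ψ O` against `Φ Ψ O`
  have e2 : freeze ω hbB (SB (freeze ω hbB (SB O))) = freeze ω hbB (SB O) := by
    have : SB (freeze ω hbB (SB O)) = freeze ω hbB (SB O) := by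
      have := semigroup_bulk_eq_self (F := F) hcB hPsi hdB t
      rwa [← hSB] at this
    rw [this, hPsi.freeze_eq hbB hdB]
  rw [e2, ← hPsi.evalOn_reduce hAΛ] at k2
  -- `ρ_B ρ_A O` against `Ψ ρ_A O`
  have e3 : freeze ω hbA (SA (freeze ω hbB (SB (evalOn hAΛ (reduce A ρ) O)))) =
      evalOn hAΛ (reduce A ρ) (freeze ω hbB (SB O)) := by
    have a1 : SA (freeze ω hbB (SB (evalOn hAΛ (reduce A ρ) O))) =
        freeze ω hbB (SB (evalOn hAΛ (reduce A ρ) O)) := by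
      have : SA (evalOn hAΛ (reduce A ρ) O) = evalOn hAΛ (reduce A ρ) O := by
        have := semigroup_bulk_eq_self (F := F) hcA hOB hdA t
        rwa [← hSA] at this
      have c1 : SA (freeze ω hbB (SB (evalOn hAΛ (reduce A ρ) O))) =
        freeze ω hbB (SA (SB (evalOn hAΛ (reduce A ρ) O))) := (hcommA hbB _ hdisj.symm _).symm
      rw [c1, hSAB, this]
    have a2 : freeze ω hbA (freeze ω hbB (SB (evalOn hAΛ (reduce A ρ) O))) =
        freeze ω hbB (SB (evalOn hAΛ (reduce A ρ) O)) := by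
      have b1 : freeze ω hbA (freeze ω hbB (SB (evalOn hAΛ (reduce A ρ) O))) =
        freeze ω hbB (freeze ω hbA (SB (evalOn hAΛ (reduce A ρ) O))) := hcomm _ _ _ _ hdisj _
      have b2 : freeze ω hbA (SB (evalOn hAΛ (reduce A ρ) O)) =
        SB (freeze ω hbA (evalOn hAΛ (reduce A ρ) O)) := hcommB hbA _ hdisj _
      rw [b1, b2, hOB.freeze_eq hbA hdA]
    rw [a1, a2, ← hcommB hAΛ _ hdB.symm]
    exact hcomm hbB hAΛ _ _ hdB _
  rw [e3, ← hOB.evalOn_reduce hBΛ] at k3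
  have e4 := hcomm hAΛ hBΛ (reduce A ρ) (reduce B ρ) hAB O
  rw [e4]
  have n2 := k2.trans (mul_le_mul_of_nonneg_left (hnB O) he)
  have n3 := k3.trans (mul_le_mul_of_nonneg_left (norm_evalOn_state_le hAΛ hsA O) he)
  generalize evalOn hABΛ (reduce (A ∪ B) ρ) O = W at *
  generalize freeze ω hbA (SA (freeze ω hbB (SB O))) = W1 at *
  generalize evalOn hAΛ (reduce A ρ) (freeze ω hbB (SB O)) = W2 at *
  generalize evalOn hBΛ (reduce B ρ) (evalOn hAΛ (reduce A ρ) O) = W3 at *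
  calc ‖W - W3‖ = ‖(W - W1) - (W2 - W1) - (W3 - W2)‖ := by congr 1; abel
    _ ≤ ‖W - W1‖ + ‖W2 - W1‖ + ‖W3 - W2‖ :=
        (norm_sub_le _ _).trans (add_le_add_left (norm_sub_le _ _) _)
    _ ≤ 3 * e * ‖O‖ := by linarith

end Split

/-! ### Distances -/

section Distance

variable {D : ℕ}

theorem gdist_self (x : Site D) : gdist x x = 0 := by simp [gdist]

theorem gdist_comm (x y : Site D) : gdist x y = gdist y x :=
  Finset.sum_congr rfl fun i _ => by omega

theorem gdist_triangle (x y z : Site D) : gdist x z ≤ gdist x y + gdist y z := by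
  unfold gdist
  rw [← Finset.sum_add_distrib]
  exact Finset.sum_le_sum fun i _ => by omega

/-- The distance of a site from a nonempty region; it is `0` by convention for the empty region. -/
def distTo (X : Finset (Site D)) (x : Site D) : ℕ := sInf {n | ∃ a ∈ X, n = gdist x a}

theorem exists_distTo_eq {X : Finset (Site D)} (hX : X.Nonempty) (x : Site D) :
    ∃ a ∈ X, distTo X x = gdist x a := by
  obtain ⟨a, ha⟩ := hX
  exact Nat.sInf_mem (s := {n | ∃ a ∈ X, n = gdist x a}) ⟨_, a, ha, rfl⟩

theorem distTo_le {X : Finset (Site D)} {a : Site D} (ha : a ∈ X) (x : Site D) :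
    distTo X x ≤ gdist x a := Nat.sInf_le ⟨a, ha, rfl⟩

theorem distTo_le_add {X : Finset (Site D)} (hX : X.Nonempty) (x y : Site D) :
    distTo X x ≤ gdist x y + distTo X y := by
  obtain ⟨a, ha, h⟩ := exists_distTo_eq hX y
  rw [h]
  exact (distTo_le ha x).trans (gdist_triangle _ _ _)

theorem distTo_of_mem {X : Finset (Site D)} {x : Site D} (h : x ∈ X) : distTo X x = 0 :=
  Nat.le_zero.1 ((distTo_le h x).trans (gdist_self x).le)

end Distance

/-! ### Two regions inside a ball -/

section TwoClusters

variable {D : ℕ} {d : Site D → ℕ} {F : UniformFamily d} {A B : Finset (Site D)} {ν : ℝ → ℝ}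
  {v c γ δ : ℝ} {P : Polynomial ℝ}

theorem bulkTerm_lift {Z b Λ : Finset (Site D)} (hZ : Z ⊆ b) (hb : b ⊆ Λ) (O : Op d b) :
    bulkTerm F Λ Z (lift hb O) = lift hb (bulkTerm F b Z O) := by
  rw [bulkTerm_of_subset F (hZ.trans hb), bulkTerm_of_subset F hZ, toCLM_apply, toCLM_apply,
    embed_lift]

theorem semigroup_bulk_lift {b Λ : Finset (Site D)} (hb : b ⊆ Λ)
    {coll : Finset (Finset (Site D))} (hcoll : ∀ Z ∈ coll, Z ⊆ b) (O : Op d b) (t : ℝ) :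
    semigroup (∑ Z ∈ coll, bulkTerm F Λ Z) t (lift hb O) =
      lift hb (semigroup (∑ Z ∈ coll, bulkTerm F b Z) t O) := by
  refine semigroup_intertwine (LinearMap.toContinuousLinearMap (lift hb)) (fun O => ?_) O t
  rw [LinearMap.coe_toContinuousLinearMap', sum_apply, sum_apply, map_sum]
  exact Finset.sum_congr rfl fun Z hZ => (bulkTerm_lift (hcoll Z hZ) hb O).symm

theorem SupportedOn.lift {b Λ X : Finset (Site D)} (hX : X ⊆ b) (hb : b ⊆ Λ) {ω : Conf d Λ}
    {ω' : Conf d b} {O : Op d b} (hO : SupportedOn ω' X O) :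
    SupportedOn ω X (DissipativeLattice.lift hb O) := by
  obtain ⟨F, rfl, _⟩ := hO.exists_lift hX
  rw [lift_lift]
  exact supportedOn_lift ω _ F

/-- Decay of correlations for two regions `A`, `B` inside a ball `b = b_w(R)`: on operators on
`A ∪ B`, the evolutions on `Λ` and on `b` are both close to the evolution on `b` without the
terms that couple the sites closer to `A` to the sites closer to `B`, while the evolution on `b`
forgets its initial state. -/
theorem traceCorrelation_le_of_ball (hν : IsGrowthFunction ν)
    (hF : F.LiebRobinsonAssumptions ν v P) (hv : 0 < v) (hmix : F.RapidMixing c γ δ) (hc : 0 < c)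
    {u w : Site D} {L R : ℕ} (hw : HasUniqueFixedState (F.closedEvolution w R))
    {ρ : Op d (ball u L)} (hρ : IsFixedState (F.closedEvolution u L) ρ)
    (hb : ball w R ⊆ ball u L) (hA : A ⊆ ball w R) (hB : B ⊆ ball w R)
    (hAne : A.Nonempty) (hBne : B.Nonempty) {m : ℕ} (hm0 : 0 < m)
    (hm : ∀ a ∈ A, ∀ a' ∈ B, m ≤ gdist a a') {q r r' : ℝ} (hq0 : 0 ≤ q) (hr0 : 0 ≤ r)
    (hr0' : 0 ≤ r') (hqm : q ≤ m / 2) (hqr : q ≤ r)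
    (hr : ∀ x ∈ A ∪ B, ∀ y, y ∉ ball w R → r ≤ gdist x y)
    (hr' : ∀ x ∈ A ∪ B, ∀ y, y ∉ ball u L → r' ≤ gdist x y) {t : ℝ} (ht : 0 ≤ t) :
    traceCorrelation A B ρ ≤ 3 * (2 * (c * ((ball w R).card : ℝ) ^ δ * Real.exp (-(γ * t))) +
      2 * ν 0 * Real.exp (2 * v * t) * ((ball w R).card * v / ν q +
        ((ball w R).card + 1) * P.eval (L : ℝ) / ν (r' / 2)) * t +
      2 * (2 * ν 0 * Real.exp (2 * v * t) * ((ball w R).card * v / ν q +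
        ((ball w R).card + 1) * P.eval (R : ℝ) / ν (r / 2)) * t)) := by
  classical
  have hXne : (A ∪ B).Nonempty := hAne.mono Finset.subset_union_left
  have hX : A ∪ B ⊆ ball w R := Finset.union_subset hA hB
  -- a configuration exists because the state has trace one
  obtain ⟨ω⟩ : Nonempty (Conf d (ball u L)) := by
    by_contra hne
    rw [not_nonempty_iff] at hne
    have := hρ.1.2
    simp [Matrix.trace] at this
  obtain ⟨ω', hω'⟩ : ∃ ω' : Conf d (ball w R), ω' = restrict hb ω := ⟨_, rfl⟩
  -- the sites closer to `A`, the sites closer to `B`, and the local terms inside each of the parts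
  -- (the empty region is in both power sets and is counted with `A`)
  obtain ⟨bA, hbA⟩ : ∃ bA, bA = (ball w R).filter (fun x => distTo A x ≤ distTo B x) := ⟨_, rfl⟩
  obtain ⟨bB, hbB⟩ : ∃ bB, bB = (ball w R).filter (fun x => ¬ distTo A x ≤ distTo B x) := ⟨_, rfl⟩
  obtain ⟨collA, hcollA⟩ : ∃ collA, collA = bA.powerset := ⟨_, rfl⟩
  obtain ⟨collB, hcollB⟩ : ∃ collB, collB = bB.powerset.filter (fun Z => ¬ Z ⊆ bA) := ⟨_, rfl⟩
  have hAbA : A ⊆ bA := fun x hx => by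
    rw [hbA, Finset.mem_filter, distTo_of_mem hx]
    exact ⟨hA hx, Nat.zero_le _⟩
  have hBbB : B ⊆ bB := fun x hx => by
    rw [hbB, Finset.mem_filter, distTo_of_mem hx, not_le]
    refine ⟨hB hx, ?_⟩
    obtain ⟨a, ha, e⟩ := exists_distTo_eq hAne x
    rw [e, gdist_comm]
    exact hm0.trans_le (hm a ha x hx)
  have hdisj : Disjoint bA bB := by
    rw [hbA, hbB]; exact Finset.disjoint_filter_filter_not _ _ _
  have hunion : bA ∪ bB = ball w R := by
    rw [hbA, hbB]; exact Finset.filter_union_filter_not_eq _ _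
  have hcA : ∀ Z ∈ collA, Z ⊆ bA := fun Z hZ => Finset.mem_powerset.1 (hcollA ▸ hZ)
  have hcB : ∀ Z ∈ collB, Z ⊆ bB := fun Z hZ =>
    Finset.mem_powerset.1 (Finset.mem_filter.1 (hcollB ▸ hZ)).1
  have hcd : Disjoint collA collB := by
    rw [Finset.disjoint_left]
    intro Z h1 h2
    rw [hcollB, Finset.mem_filter] at h2
    exact h2.2 (hcA Z h1)
  have hcoll : ∀ Z ∈ collA ∪ collB, Z ⊆ ball w R := by
    intro Z hZ
    rw [← hunion]
    rcases Finset.mem_union.1 hZ with h | h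
    · exact (hcA Z h).trans Finset.subset_union_left
    · exact (hcB Z h).trans Finset.subset_union_right
  have hnc : ∀ Z, Z ∉ collA ∪ collB → Z ⊆ ball w R → (∃ y ∈ Z, y ∈ bA) ∧ ∃ y ∈ Z, y ∈ bB := by
    intro Z hZ hZb
    have h1 : ¬ Z ⊆ bA := fun h => hZ (Finset.mem_union_left _ (hcollA ▸ Finset.mem_powerset.2 h))
    have h2 : ¬ Z ⊆ bB := fun h => hZ (Finset.mem_union_right _
      (hcollB ▸ Finset.mem_filter.2 ⟨Finset.mem_powerset.2 h, h1⟩))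
    rw [Finset.not_subset] at h1 h2
    obtain ⟨y, hy, hy'⟩ := h1
    obtain ⟨z, hz, hz'⟩ := h2
    have hyb := hZb hy
    have hzb := hZb hz
    rw [← hunion, Finset.mem_union] at hyb hzb
    exact ⟨⟨z, hz, hzb.resolve_right hz'⟩, ⟨y, hy, hyb.resolve_left hy'⟩⟩
  have hℓ : ∀ x y : Site D, distTo (A ∪ B) x ≤ gdist x y + distTo (A ∪ B) y := distTo_le_add hXne
  have hℓX : ∀ x ∈ A ∪ B, distTo (A ∪ B) x = 0 := fun x hx => distTo_of_mem hx
  have hmAB : ∀ y, m ≤ distTo A y + distTo B y := by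
    intro y
    obtain ⟨a, ha, e⟩ := exists_distTo_eq hAne y
    obtain ⟨a', ha', e'⟩ := exists_distTo_eq hBne y
    have h1 := hm a ha a' ha'
    have h2 := gdist_triangle a y a'
    rw [gdist_comm a y] at h2
    omega
  -- a local term that is not in the collection crosses from `bA` to `bB` or leaves the ball `b`
  have hcross : ∀ Z, Z ∉ collA ∪ collB → ∀ x ∈ Z, x ∈ ball w R →
      q ≤ diam Z + distTo (A ∪ B) x := by
    intro Z hZ x hx hxb
    obtain ⟨a, ha, e⟩ := exists_distTo_eq hXne x
    by_cases hZb : Z ⊆ ball w R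
    · obtain ⟨⟨y, hy, hyA⟩, ⟨z, hz, hzB⟩⟩ := hnc Z hZ hZb
      rw [hbA, Finset.mem_filter] at hyA
      rw [hbB, Finset.mem_filter, not_le] at hzB
      have hyd := gdist_le_diam hy hx
      have hzd := gdist_le_diam hz hx
      have h1 := hmAB y
      have h2 := hmAB z
      have h3 : m ≤ 2 * (diam Z + distTo (A ∪ B) x) := by
        rw [e]
        rcases Finset.mem_union.1 ha with ha | ha
        · have h4 := distTo_le ha z
          have h5 := gdist_triangle z x a
          omega
        · have h4 := distTo_le ha y
          have h5 := gdist_triangle y x a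
          omega
      have h4 : (m : ℝ) ≤ 2 * (diam Z + distTo (A ∪ B) x) := by exact_mod_cast h3
      linarith
    · rw [Finset.not_subset] at hZb
      obtain ⟨y, hy, hyb⟩ := hZb
      have h1 := hr a ha y hyb
      have h2 := gdist_triangle a x y
      rw [gdist_comm a x, ← e] at h2
      have h3 := gdist_le_diam hx hy
      have h4 : (gdist a y : ℝ) ≤ diam Z + distTo (A ∪ B) x := by
        exact_mod_cast h2.trans (by omega)
      linarith
  have hfar : ∀ {r : ℝ} {S : Finset (Site D)}, (∀ x ∈ A ∪ B, ∀ y, y ∉ S → r ≤ gdist x y) →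
      ∀ x ∈ ball w R, ∀ y, y ∉ S → r ≤ gdist x y + distTo (A ∪ B) x := by
    intro r S h x _ y hy
    obtain ⟨a, ha, e⟩ := exists_distTo_eq hXne x
    have h1 := h a ha y hy
    have h2 := gdist_triangle a x y
    rw [gdist_comm a x, ← e] at h2
    have h4 : (gdist a y : ℝ) ≤ gdist x y + distTo (A ∪ B) x := by
      exact_mod_cast h2.trans (by omega)
    linarith
  have hρb : IsState (reduce (ball w R) ρ) := reduce_isState hb hρ.1
  have hs := isState_single ω'
  have hPL : 0 ≤ P.eval (L : ℝ) := (mul_nonneg (hν.pos _ (Nat.cast_nonneg 0)).le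
      (Finset.sum_nonneg fun j _ => diamondNorm_nonneg _)).trans (hF.2 u L 0)
  have hPR : 0 ≤ P.eval (R : ℝ) := (mul_nonneg (hν.pos _ (Nat.cast_nonneg 0)).le
      (Finset.sum_nonneg fun j _ => diamondNorm_nonneg _)).trans (hF.2 w R 0)
  have hν0 := hν.pos 0 le_rfl
  have hνq := hν.pos q hq0
  have hνr := hν.pos (r / 2) (by positivity)
  have hνr' := hν.pos (r' / 2) (by positivity)
  unfold traceCorrelation
  rw [← reduce_reduce hX hb, ← reduce_reduce hA hb, ← reduce_reduce hB hb]
  refine traceCorrelation_le_of_split (F := F) ω' hAbA hBbB hdisj hunion hcA hcB hcd hρb ht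
    (by positivity) fun O hO => ?_
  have c1 := norm_closed_sub_semigroup_le hν hF hv u L ω hb hcoll hℓ hℓX hX hq0 hr0'
    (fun Z _ hZ => hcross Z hZ) (hfar hr') (hO.lift hX hb (ω := ω)) ht
  have c2 := norm_closed_sub_semigroup_le hν hF hv w R ω' (Finset.Subset.refl _) hcoll hℓ hℓX hX
    hq0 hr0 (fun Z _ hZ => hcross Z hZ) (hfar hr) hO ht
  have c3 := norm_trace_semigroup_sub_le hmix hw hρb hs ht O
  have f1 := trace_mul_closedEvolution (F := F) u L t (lift hb O) ρ
  rw [hρ.2 t ht, trace_lift_mul] at f1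
  rw [semigroup_bulk_lift hb hcoll] at c1
  have f2 := trace_lift_mul hb (semigroup (∑ Z ∈ collA ∪ collB, bulkTerm F (ball w R) Z) t O) ρ
  have n1 := hρ.1.norm_trace_mul_le
    (semigroup (toCLM (dual (F.closedGenerator u L))) t (lift hb O) -
      lift hb (semigroup (∑ Z ∈ collA ∪ collB, bulkTerm F (ball w R) Z) t O))
  have n2 := hρb.norm_trace_mul_le (semigroup (toCLM (dual (F.closedGenerator w R))) t O -
      semigroup (∑ Z ∈ collA ∪ collB, bulkTerm F (ball w R) Z) t O)
  have n3 := hs.norm_trace_mul_le (semigroup (toCLM (dual (F.closedGenerator w R))) t O -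
      semigroup (∑ Z ∈ collA ∪ collB, bulkTerm F (ball w R) Z) t O)
  have hn := norm_lift_le hb O
  rw [Matrix.sub_mul, Matrix.trace_sub] at n1 n2 n3
  rw [← f1, f2] at n1
  generalize semigroup (∑ Z ∈ collA ∪ collB, bulkTerm F (ball w R) Z) t O = S at *
  generalize semigroup (toCLM (dual (F.closedGenerator w R))) t O = S' at *
  have f3 : (S * Matrix.single ω' ω' 1).trace = S ω' ω' := by
    rw [Matrix.trace_mul_comm, single_mul_trace]
  rw [f3] at n3
  rw [Matrix.trace_mul_comm]
  generalize (S * reduce (ball w R) ρ).trace = y1 at *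
  generalize (S' * reduce (ball w R) ρ).trace = y2 at *
  generalize (S' * Matrix.single ω' ω' 1).trace = y3 at *
  generalize (O * reduce (ball w R) ρ).trace = x at *
  generalize S ω' ω' = z at *
  have e1 : ‖x - z‖ ≤ ‖x - y1‖ + ‖y2 - y1‖ + ‖y2 - y3‖ + ‖y3 - z‖ := by
    calc ‖x - z‖ = ‖(x - y1) - (y2 - y1) + (y2 - y3) + (y3 - z)‖ := by congr 1; ring
      _ ≤ _ := (norm_add_le _ _).trans (add_le_add_left ((norm_add_le _ _).trans
        (add_le_add_left (norm_sub_le _ _) _)) _)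
  have hK1 : 0 ≤ 2 * ν 0 * Real.exp (2 * v * t) * ((ball w R).card * v / ν q +
      ((ball w R).card + 1) * P.eval (L : ℝ) / ν (r' / 2)) * t := by positivity
  have c1' := mul_le_mul_of_nonneg_left hn hK1
  linarith

end TwoClusters

/-! ### Arbitrary regions by repeated bipartition -/

section Clusters

variable {D : ℕ}

/-- A nonempty finite region falls into two parts at a distance `m` which is at least a fraction of
its diameter: take `m` maximal; then no part of the region is separated from the rest by more than
`m`, so that any two sites are joined by a chain of at most `|X|` steps of length at most `m`. -/
theorem exists_bipartition {X A : Finset (Site D)} (hA : A ⊆ X) (hne : A.Nonempty)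
    (hne' : (X \ A).Nonempty) {d : ℕ} (hd : ∀ a ∈ A, ∀ b ∈ X \ A, d ≤ gdist a b) :
    ∃ (X₁ : Finset (Site D)) (m : ℕ), X₁ ⊆ X ∧ X₁.Nonempty ∧ (X \ X₁).Nonempty ∧ d ≤ m ∧
      (∀ a ∈ X₁, ∀ b ∈ X \ X₁, m ≤ gdist a b) ∧ ∀ x ∈ X, ∀ y ∈ X, gdist x y ≤ X.card * m := by
  classical
  let p : ℕ → Prop := fun m => ∃ X₁ ⊆ X, X₁.Nonempty ∧ (X \ X₁).Nonempty ∧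
    ∀ a ∈ X₁, ∀ b ∈ X \ X₁, m ≤ gdist a b
  have hpd : p d := ⟨A, hA, hne, hne', hd⟩
  have hbound : ∀ m, p m → m ≤ diam X := by
    rintro m ⟨X₁, hX₁, ⟨a, ha⟩, ⟨b, hb⟩, h⟩
    exact (h a ha b hb).trans (gdist_le_diam (hX₁ ha) (Finset.sdiff_subset hb))
  obtain ⟨m, hm, hmax⟩ : ∃ m, p m ∧ ∀ m', p m' → m' ≤ m := by
    refine ⟨Nat.findGreatest p (diam X), Nat.findGreatest_spec (hbound d hpd) hpd, fun m' h => ?_⟩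
    exact Nat.le_findGreatest (hbound m' h) h
  obtain ⟨X₁, h1, h2, h3, h4⟩ := hm
  refine ⟨X₁, m, h1, h2, h3, hmax d hpd, h4, fun x hx => ?_⟩
  have hgrow : ∀ k : ℕ, (∀ y ∈ X, gdist x y ≤ k * m) ∨
      k + 1 ≤ (X.filter fun y => gdist x y ≤ k * m).card := by
    intro k
    induction k with
    | zero =>
      right
      refine Finset.card_pos.2 ⟨x, ?_⟩
      simp [hx, gdist_self]
    | succ k ih =>
      rcases ih with ih | ih
      · left
        exact fun y hy => (ih y hy).trans (Nat.mul_le_mul_right m k.le_succ)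
      by_cases hall : ∀ y ∈ X, gdist x y ≤ k * m
      · left
        exact fun y hy => (hall y hy).trans (Nat.mul_le_mul_right m k.le_succ)
      right
      -- otherwise some step of length at most `m` leaves the set of sites reached so far
      have hstep : ∃ a ∈ X.filter (fun y => gdist x y ≤ k * m),
          ∃ b ∈ X \ X.filter (fun y => gdist x y ≤ k * m), gdist a b ≤ m := by
        by_contra hcon
        push Not at hcon hall
        have : p (m + 1) := by
          refine ⟨X.filter (fun y => gdist x y ≤ k * m), Finset.filter_subset _ _,
            Finset.card_pos.1 (by omega), ?_, fun a ha b hb => hcon a ha b hb⟩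
          obtain ⟨y, hy, hy'⟩ := hall
          exact ⟨y, Finset.mem_sdiff.2 ⟨hy, fun h => by
            rw [Finset.mem_filter] at h; omega⟩⟩
        have := hmax _ this
        omega
      obtain ⟨a, ha, b, hb, hab⟩ := hstep
      rw [Finset.mem_filter] at ha
      rw [Finset.mem_sdiff] at hb
      have hlt : (X.filter fun y => gdist x y ≤ k * m).card <
          (X.filter fun y => gdist x y ≤ (k + 1) * m).card := by
        refine Finset.card_lt_card ⟨?_, ?_⟩
        · intro y hy
          rw [Finset.mem_filter] at hy ⊢
          exact ⟨hy.1, hy.2.trans (Nat.mul_le_mul_right m k.le_succ)⟩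
        · intro hsub
          refine hb.2 (hsub ?_)
          rw [Finset.mem_filter]
          refine ⟨hb.1, (gdist_triangle x a b).trans ?_⟩
          rw [Nat.succ_mul]
          exact add_le_add ha.2 hab
      omega
  rcases hgrow X.card with h | h
  · exact h
  · have := Finset.card_filter_le X (fun y => gdist x y ≤ X.card * m)
    omega

variable {d : Site D → ℕ} {A B Λ X : Finset (Site D)}

/-- Evaluation in the reduced state on `Y`. -/
def evalState (ρ : Op d Λ) (Y : Finset (Site D)) : Op d Λ →L[ℂ] Op d Λ :=
  if h : Y ⊆ Λ then evalOn h (reduce Y ρ) else 0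

theorem evalState_of_subset (ρ : Op d Λ) (h : X ⊆ Λ) : evalState ρ X = evalOn h (reduce X ρ) :=
  dif_pos h

theorem norm_evalState_le {ρ : Op d Λ} (hρ : IsState ρ) (X : Finset (Site D)) (O : Op d Λ) :
    ‖evalState ρ X O‖ ≤ ‖O‖ := by
  by_cases h : X ⊆ Λ
  · rw [evalState_of_subset ρ h]
    exact norm_evalOn_state_le h (reduce_isState h hρ) O
  · rw [evalState, dif_neg h]
    simp

theorem evalState_comm (ρ : Op d Λ) (h : Disjoint A B) (O : Op d Λ) :
    evalState ρ A (evalState ρ B O) = evalState ρ B (evalState ρ A O) := by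
  by_cases hA : A ⊆ Λ
  · by_cases hB : B ⊆ Λ
    · have := DFunLike.congr_fun (commute_evalOn hA hB h (reduce A ρ) (reduce B ρ)).eq O
      rw [evalState_of_subset ρ hA, evalState_of_subset ρ hB]
      exact this
    · rw [evalState, evalState, dif_neg hB]
      simp only [zero_apply, map_zero]
  · rw [evalState, evalState, dif_neg hA]
    simp only [zero_apply, map_zero]

theorem evalState_empty {ρ : Op d Λ} (hρ : IsState ρ) (O : Op d Λ) : evalState ρ ∅ O = O := by
  rw [evalState_of_subset ρ (Finset.empty_subset _)]
  ext σ σ'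
  have hs := reduce_isState (Finset.empty_subset Λ) hρ
  have hu : ∀ (σ : Conf d Λ) (a : Conf d (∅ : Finset (Site D))), upd σ a = σ := by
    intro σ a
    funext x
    exact dif_neg (Finset.notMem_empty _)
  have h1 : (restrict (Finset.empty_subset Λ) σ : Conf d ∅) =
      restrict (Finset.empty_subset Λ) σ' := Subsingleton.elim _ _
  rw [evalOn_apply, h1, Matrix.one_apply_eq, mul_one]
  have h2 : (Matrix.of fun a b => O (upd σ a) (upd σ' b) :
      Op d (∅ : Finset (Site D))) = O σ σ' • 1 := by
    ext a b
    rw [Subsingleton.elim b a]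
    simp [hu]
  rw [h2, Matrix.mul_smul, Matrix.mul_one, Matrix.trace_smul, hs.2, smul_eq_mul, mul_one]

theorem norm_evalState_sub_le {ρ : Op d Λ} (hρ : IsState ρ) (hA : A ⊆ Λ) (hB : B ⊆ Λ)
    (hd : Disjoint A B) {η : ℝ} (hη : 0 ≤ η)
    (h : A.Nonempty → B.Nonempty → traceCorrelation A B ρ ≤ η) (O : Op d Λ) :
    ‖evalState ρ (A ∪ B) O - evalState ρ A (evalState ρ B O)‖ ≤ η * ‖O‖ := by
  have h0 : 0 ≤ η * ‖O‖ := mul_nonneg hη (norm_nonneg O)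
  rcases A.eq_empty_or_nonempty with rfl | hA'
  · rwa [evalState_empty hρ, Finset.empty_union, sub_self, norm_zero]
  rcases B.eq_empty_or_nonempty with rfl | hB'
  · rwa [evalState_empty hρ, Finset.union_empty, sub_self, norm_zero]
  rw [evalState_of_subset ρ hA, evalState_of_subset ρ hB,
    evalState_of_subset ρ (Finset.union_subset hA hB)]
  exact (norm_evalOn_sub_le hA hB _ hd ρ O).trans
    (mul_le_mul_of_nonneg_right (h hA' hB') (norm_nonneg O))

/-- Two parts of a region at a distance `s` are weakly correlated if this is so for the parts of
any subregion that are separated by a distance comparable to its diameter. The proof splits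
`A ∪ B` as in `exists_bipartition`; the state almost factorizes between the two parts, and inside
of each of them one argues by induction. -/
theorem norm_evalState_sub_le_of_bipartitions {ρ : Op d Λ} (hρ : IsState ρ) {η : ℝ} (hη : 0 ≤ η)
    {s : ℕ} (hs : 0 < s) (hX : X ⊆ Λ)
    (h : ∀ (Y X₁ X₂ : Finset (Site D)) (m : ℕ), Y ⊆ X → X₁ ⊆ Y → X₂ ⊆ Y → X₁.Nonempty →
      X₂.Nonempty → s ≤ m → (∀ a ∈ X₁, ∀ b ∈ X₂, m ≤ gdist a b) →
      (∀ x ∈ Y, ∀ y ∈ Y, gdist x y ≤ Y.card * m) → traceCorrelation X₁ X₂ ρ ≤ η) (n : ℕ) :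
    ∀ (A B : Finset (Site D)), (A ∪ B).card = n → A ∪ B ⊆ X →
      (∀ a ∈ A, ∀ b ∈ B, s ≤ gdist a b) →
      ∀ O, ‖evalState ρ (A ∪ B) O - evalState ρ A (evalState ρ B O)‖ ≤
        3 * η * (n - 1 : ℕ) * ‖O‖ := by
  classical
  induction n using Nat.strong_induction_on with
  | _ n ih =>
    intro A B hn hAB hdist O
    have hdisj : ∀ {m : ℕ}, 0 < m → ∀ {A B : Finset (Site D)},
        (∀ a ∈ A, ∀ b ∈ B, m ≤ gdist a b) → Disjoint A B := by
      intro m hm A B h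
      refine Finset.disjoint_left.2 fun x hx hx' => ?_
      have := h x hx x hx'
      rw [gdist_self] at this
      omega
    have h0 : 0 ≤ 3 * η * (n - 1 : ℕ) * ‖O‖ := by positivity
    rcases A.eq_empty_or_nonempty with rfl | hA
    · rwa [evalState_empty hρ, Finset.empty_union, sub_self, norm_zero]
    rcases B.eq_empty_or_nonempty with rfl | hB
    · rwa [evalState_empty hρ, Finset.union_empty, sub_self, norm_zero]
    have hABd := hdisj hs hdist
    have e : (A ∪ B) \ A = B := Finset.union_sdiff_cancel_left hABd
    obtain ⟨X₁, m, h1, h2, h3, h4, h5, h6⟩ := exists_bipartition (X := A ∪ B) (A := A)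
      Finset.subset_union_left hA (e.symm ▸ hB) (e.symm ▸ hdist)
    obtain ⟨X₂, hX₂⟩ : ∃ X₂, X₂ = (A ∪ B) \ X₁ := ⟨_, rfl⟩
    rw [← hX₂] at h3 h5
    have hX₂s : X₂ ⊆ A ∪ B := hX₂ ▸ Finset.sdiff_subset
    have hm : 0 < m := hs.trans_le h4
    have hpair : ∀ {C₁ C₂ : Finset (Site D)}, C₁ ⊆ X₁ → C₂ ⊆ X₂ → ∀ O,
        ‖evalState ρ (C₁ ∪ C₂) O - evalState ρ C₁ (evalState ρ C₂ O)‖ ≤ η * ‖O‖ := by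
      intro C₁ C₂ hC₁ hC₂ O
      have hdC : ∀ a ∈ C₁, ∀ b ∈ C₂, m ≤ gdist a b := fun a ha b hb => h5 a (hC₁ ha) b (hC₂ hb)
      exact norm_evalState_sub_le hρ ((hC₁.trans h1).trans (hAB.trans hX))
        ((hC₂.trans hX₂s).trans (hAB.trans hX)) (hdisj hm hdC) hη
        (fun n1 n2 => h (A ∪ B) C₁ C₂ m hAB (hC₁.trans h1) (hC₂.trans hX₂s) n1 n2 h4 hdC h6) O
    have hcard : X₁.card + X₂.card = n := by
      rw [hX₂, ← hn, add_comm]; exact Finset.card_sdiff_add_card_eq_card h1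
    have c1 := Finset.card_pos.2 h2
    have c2 := Finset.card_pos.2 h3
    have hU : X₁ ∪ X₂ = A ∪ B := by rw [hX₂]; exact Finset.union_sdiff_of_subset h1
    have eX₁ : A ∩ X₁ ∪ B ∩ X₁ = X₁ := by
      rw [← Finset.union_inter_distrib_right]; exact Finset.inter_eq_right.2 h1
    have eX₂ : A ∩ X₂ ∪ B ∩ X₂ = X₂ := by
      rw [← Finset.union_inter_distrib_right]; exact Finset.inter_eq_right.2 hX₂s
    have eA : A ∩ X₁ ∪ A ∩ X₂ = A := by
      rw [← Finset.inter_union_distrib_left, hU]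
      exact Finset.inter_eq_left.2 Finset.subset_union_left
    have eB : B ∩ X₁ ∪ B ∩ X₂ = B := by
      rw [← Finset.inter_union_distrib_left, hU]
      exact Finset.inter_eq_left.2 Finset.subset_union_right
    have i1 := ih X₁.card (by omega) (A ∩ X₁) (B ∩ X₁) (by rw [eX₁]) (by rw [eX₁]; exact h1.trans hAB)
      (fun a ha b hb => hdist a (Finset.mem_inter.1 ha).1 b (Finset.mem_inter.1 hb).1)
    have i2 := ih X₂.card (by omega) (A ∩ X₂) (B ∩ X₂) (by rw [eX₂])
      (by rw [eX₂]; exact hX₂s.trans hAB)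
      (fun a ha b hb => hdist a (Finset.mem_inter.1 ha).1 b (Finset.mem_inter.1 hb).1)
    rw [eX₁] at i1
    rw [eX₂] at i2
    -- the factorization between the two parts, for `A ∪ B`, for `A` and for `B`
    have j1 := hpair (Finset.Subset.refl X₁) (Finset.Subset.refl X₂)
    have j2 := hpair (C₁ := A ∩ X₁) (C₂ := A ∩ X₂) Finset.inter_subset_right Finset.inter_subset_right
    have j3 := hpair (C₁ := B ∩ X₁) (C₂ := B ∩ X₂) Finset.inter_subset_right Finset.inter_subset_right
    rw [hU] at j1
    rw [eA] at j2
    rw [eB] at j3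
    have hcross : Disjoint (B ∩ X₁) (A ∩ X₂) := Finset.disjoint_of_subset_left
      Finset.inter_subset_left (Finset.disjoint_of_subset_right Finset.inter_subset_left hABd.symm)
    have hcomm := evalState_comm ρ hcross (evalState ρ (B ∩ X₂) O)
    have hc := norm_evalState_le hρ
    -- `ρ_AB` is replaced in turn by `ρ_X₁ ρ_X₂`, by the product over the four intersections, and
    -- by `ρ_A ρ_B`
    have k1 := j1 O
    have k2 := i1 (evalState ρ X₂ O)
    have k3 := (hc (A ∩ X₁) _).trans ((hc (B ∩ X₁) _).trans (i2 O))
    have k4 := j2 (evalState ρ (B ∩ X₁) (evalState ρ (B ∩ X₂) O))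
    have k5 := (hc A _).trans (j3 O)
    have b2 : 3 * η * (X₁.card - 1 : ℕ) * ‖evalState ρ X₂ O‖ ≤ 3 * η * (X₁.card - 1 : ℕ) * ‖O‖ :=
      mul_le_mul_of_nonneg_left (hc _ _) (by positivity)
    have b4 : η * ‖evalState ρ (B ∩ X₁) (evalState ρ (B ∩ X₂) O)‖ ≤ η * ‖O‖ :=
      mul_le_mul_of_nonneg_left ((hc _ _).trans (hc _ _)) hη
    simp only [map_sub] at k3 k5
    rw [hcomm] at k3
    have en : ((n - 1 : ℕ) : ℝ) = (X₁.card - 1 : ℕ) + (X₂.card - 1 : ℕ) + 1 := by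
      rw [← hcard]
      have : X₁.card + X₂.card - 1 = (X₁.card - 1) + (X₂.card - 1) + 1 := by omega
      rw [this]; push_cast; ring
    rw [en]
    generalize evalState ρ (A ∪ B) O = Z0 at *
    generalize evalState ρ X₁ (evalState ρ X₂ O) = Z1 at *
    generalize evalState ρ (A ∩ X₁) (evalState ρ (B ∩ X₁) (evalState ρ X₂ O)) = Z2 at *
    generalize evalState ρ (A ∩ X₁) (evalState ρ (A ∩ X₂) (evalState ρ (B ∩ X₁)
      (evalState ρ (B ∩ X₂) O))) = Z3 at *
    generalize evalState ρ A (evalState ρ (B ∩ X₁) (evalState ρ (B ∩ X₂) O)) = Z4 at *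
    generalize evalState ρ A (evalState ρ B O) = Z5 at *
    have hfin : ‖Z0 - Z5‖ ≤ ‖Z0 - Z1‖ + ‖Z1 - Z2‖ + ‖Z2 - Z3‖ + ‖Z4 - Z3‖ + ‖Z5 - Z4‖ := by
      calc ‖Z0 - Z5‖ = ‖(Z0 - Z1) + (Z1 - Z2) + (Z2 - Z3) - (Z4 - Z3) - (Z5 - Z4)‖ := by
            congr 1; abel
        _ ≤ _ := (norm_sub_le _ _).trans (add_le_add_left ((norm_sub_le _ _).trans
          (add_le_add_left ((norm_add_le _ _).trans (add_le_add_left (norm_add_le _ _) _)) _)) _)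
    linarith

/-- The bound of `norm_evalState_sub_le_of_bipartitions` in terms of the trace norm. -/
theorem traceCorrelation_le_of_bipartitions {ρ : Op d Λ} (hρ : IsState ρ) {η : ℝ} (hη : 0 ≤ η)
    {s : ℕ} (hs : 0 < s) (hA : A ⊆ Λ) (hB : B ⊆ Λ) (hdist : ∀ a ∈ A, ∀ b ∈ B, s ≤ gdist a b)
    (h : ∀ (Y X₁ X₂ : Finset (Site D)) (m : ℕ), Y ⊆ A ∪ B → X₁ ⊆ Y → X₂ ⊆ Y → X₁.Nonempty →
      X₂.Nonempty → s ≤ m → (∀ a ∈ X₁, ∀ b ∈ X₂, m ≤ gdist a b) →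
      (∀ x ∈ Y, ∀ y ∈ Y, gdist x y ≤ Y.card * m) → traceCorrelation X₁ X₂ ρ ≤ η) :
    traceCorrelation A B ρ ≤ 3 * η * (A ∪ B).card := by
  obtain ⟨ω⟩ : Nonempty (Conf d Λ) := by
    by_contra hne
    rw [not_nonempty_iff] at hne
    have := hρ.2
    simp [Matrix.trace] at this
  have hAB := Finset.union_subset hA hB
  have hd : Disjoint A B := by
    refine Finset.disjoint_left.2 fun x hx hx' => ?_
    have := hdist x hx x hx'
    rw [gdist_self] at this
    omega
  refine traceCorrelation_le_of_evalOn ω hA hB hAB hd ρ fun O _ => ?_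
  have := norm_evalState_sub_le_of_bipartitions hρ hη hs hAB h _ A B rfl (Finset.Subset.refl _)
    hdist O
  rw [evalState_of_subset ρ hA, evalState_of_subset ρ hB, evalState_of_subset ρ hAB] at this
  refine this.trans (mul_le_mul_of_nonneg_right ?_ (norm_nonneg O))
  refine mul_le_mul_of_nonneg_left ?_ (by positivity)
  exact_mod_cast Nat.sub_le _ _

end Clusters

/-! ### Growth functions and the choice of the time -/

section Rates

theorem card_ball_le {D : ℕ} (u : Site D) (N : ℕ) : (ball u N).card ≤ (2 * N + 1) ^ D := by
  refine (Finset.card_filter_le _ _).trans ?_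
  rw [Pi.card_Icc]
  simp only [Int.card_Icc]
  refine (Finset.prod_le_pow_card _ _ (2 * N + 1) fun i _ => ?_).trans ?_
  · omega
  · simp

theorem exists_eval_le (P : Polynomial ℝ) :
    ∃ C : ℝ, 0 ≤ C ∧ ∀ x : ℝ, 0 ≤ x → P.eval x ≤ C * (1 + x) ^ P.natDegree := by
  refine ⟨∑ i ∈ Finset.range (P.natDegree + 1), |P.coeff i|,
    Finset.sum_nonneg fun _ _ => abs_nonneg _, fun x hx => ?_⟩
  rw [Polynomial.eval_eq_sum_range, Finset.sum_mul]
  refine Finset.sum_le_sum fun i hi => ?_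
  refine mul_le_mul (le_abs_self _) ?_ (by positivity) (abs_nonneg _)
  calc x ^ i ≤ (1 + x) ^ i := pow_le_pow_left₀ hx (by linarith) i
    _ ≤ (1 + x) ^ P.natDegree :=
      pow_le_pow_right₀ (by linarith) (Nat.lt_succ_iff.1 (Finset.mem_range.1 hi))

theorem IsGrowthFunction.apply_nat_mul_le {ν : ℝ → ℝ} (hν : IsGrowthFunction ν) {x : ℝ}
    (hx : 0 ≤ x) (J : ℕ) : ν ((J + 1 : ℕ) * x) ≤ ν x ^ (J + 1) := by
  induction J with
  | zero => simp
  | succ J ih =>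
    have : ((J + 1 + 1 : ℕ) : ℝ) * x = (J + 1 : ℕ) * x + x := by push_cast; ring
    rw [this, pow_succ]
    exact (hν.submul _ _ (by positivity) hx).trans
      (mul_le_mul_of_nonneg_right ih (hν.pos x hx).le)

/-- Passing from the argument `x` to the multiple `(J + 1) x` of it, at the cost of a smaller
exponent. -/
theorem IsGrowthFunction.rate_le {ν : ℝ → ℝ} (hν : IsGrowthFunction ν) {x β k : ℝ} (hx : 0 ≤ x)
    (hβ : 0 < β) (hk : 0 ≤ k) (J : ℕ) :
    (1 + 2 * x) ^ k * ν x ^ (-β) ≤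
      2 ^ k * ((1 + (J + 1 : ℕ) * x) ^ k * ν ((J + 1 : ℕ) * x) ^ (-(β / (J + 1 : ℕ)))) := by
  have hJ : (1 : ℝ) ≤ (J + 1 : ℕ) := by exact_mod_cast Nat.succ_le_succ (Nat.zero_le J)
  have hνx := hν.pos x hx
  have hνJ := hν.pos ((J + 1 : ℕ) * x) (by positivity)
  have h1 : (1 + 2 * x) ^ k ≤ 2 ^ k * (1 + (J + 1 : ℕ) * x) ^ k := by
    rw [← Real.mul_rpow (by norm_num) (by positivity)]
    refine Real.rpow_le_rpow (by positivity) ?_ hk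
    nlinarith
  have h2 : ν x ^ (-β) ≤ ν ((J + 1 : ℕ) * x) ^ (-(β / (J + 1 : ℕ))) := by
    have e : ν x ^ (-β) = (ν x ^ (J + 1)) ^ (-(β / (J + 1 : ℕ))) := by
      rw [← Real.rpow_natCast (ν x) (J + 1), ← Real.rpow_mul hνx.le]
      congr 1
      field_simp
    rw [e]
    refine Real.rpow_le_rpow_of_nonpos hνJ (hν.apply_nat_mul_le hx J) ?_
    rw [neg_nonpos]; positivity
  rw [← mul_assoc]
  exact mul_le_mul h1 h2 (by positivity) (by positivity)

/-- The error of the evolution up to a time `t` with `e ^ ((2 v + 1 + γ) t) = ν y`, which balances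
the approach to equilibrium against the growth of the light cone. -/
theorem exists_time {ν : ℝ → ℝ} (hν : IsGrowthFunction ν) {v γ : ℝ} (hv : 0 < v) (hγ : 0 < γ)
    {y : ℝ} (hy : 0 ≤ y) :
    ∃ t, 0 ≤ t ∧ Real.exp (-(γ * t)) = ν y ^ (-(γ / (2 * v + 1 + γ))) ∧
      ∀ z, y ≤ z → Real.exp (2 * v * t) * t / ν z ≤ ν z ^ (-(γ / (2 * v + 1 + γ))) := by
  have hνy := hν.pos y hy
  have h1 := hν.one_le hy
  have ha : 0 < 2 * v + 1 + γ := by positivity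
  refine ⟨Real.log (ν y) / (2 * v + 1 + γ), div_nonneg (Real.log_nonneg h1) ha.le, ?_, ?_⟩
  · rw [Real.rpow_def_of_pos hνy]
    congr 1
    ring
  · intro z hz
    set t := Real.log (ν y) / (2 * v + 1 + γ) with ht
    have ht0 : 0 ≤ t := div_nonneg (Real.log_nonneg h1) ha.le
    have hνz := hν.pos z (hy.trans hz)
    have hyz : ν y ≤ ν z := hν.mono hy (hy.trans hz) hz
    have hlog : Real.log (ν y) ≤ Real.log (ν z) := Real.log_le_log hνy hyz
    rw [div_le_iff₀ hνz]
    have h2 : t ≤ Real.exp t := by linarith [Real.add_one_le_exp t]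
    have h3 : Real.exp (2 * v * t) * t ≤ Real.exp ((2 * v + 1) * t) := by
      rw [add_mul, one_mul, Real.exp_add]
      exact mul_le_mul_of_nonneg_left h2 (Real.exp_pos _).le
    refine h3.trans ?_
    have h4 : ν z = Real.exp (Real.log (ν z)) := (Real.exp_log hνz).symm
    rw [Real.rpow_def_of_pos hνz]
    conv_rhs => rw [mul_comm, h4, Real.log_exp]
    rw [← Real.exp_add, Real.exp_le_exp, ht]
    have h5 : Real.log (ν z) + Real.log (ν z) * -(γ / (2 * v + 1 + γ)) =
        (2 * v + 1) * (Real.log (ν z) / (2 * v + 1 + γ)) := by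
      field_simp
      ring
    rw [h5]
    gcongr

end Rates

/-! ### The bound in terms of the sizes of the balls -/

section Bound

variable {D : ℕ} {d : Site D → ℕ} {F : UniformFamily d} {A B : Finset (Site D)} {ν : ℝ → ℝ}
  {v c γ δ : ℝ} {P : Polynomial ℝ}

/-- The estimate of `traceCorrelation_le_of_ball` for the optimal time, in terms of bounds `S` and
`S'` on the sizes of the two balls. -/
theorem traceCorrelation_le_of_sizes (hν : IsGrowthFunction ν)
    (hF : F.LiebRobinsonAssumptions ν v P) (hv : 0 < v) (hγ : 0 < γ) (hδ : 0 < δ)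
    (hmix : F.RapidMixing c γ δ) (hc : 0 < c) {C : ℝ} (hC0 : 0 ≤ C)
    (hC : ∀ x : ℝ, 0 ≤ x → P.eval x ≤ C * (1 + x) ^ P.natDegree)
    {u w : Site D} {L R : ℕ} (hw : HasUniqueFixedState (F.closedEvolution w R))
    {ρ : Op d (ball u L)} (hρ : IsFixedState (F.closedEvolution u L) ρ)
    (hb : ball w R ⊆ ball u L) (hA : A ⊆ ball w R) (hB : B ⊆ ball w R)
    (hAne : A.Nonempty) (hBne : B.Nonempty) {m : ℕ} (hm0 : 0 < m)
    (hm : ∀ a ∈ A, ∀ a' ∈ B, m ≤ gdist a a') {y z : ℝ} (hy : 0 ≤ y) (hyz : y ≤ z)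
    (hym : 2 * y ≤ m) (hr : ∀ x ∈ A ∪ B, ∀ x', x' ∉ ball w R → 2 * y ≤ gdist x x')
    (hr' : ∀ x ∈ A ∪ B, ∀ x', x' ∉ ball u L → 2 * z ≤ gdist x x') {S S' g : ℝ}
    (hg : g = D * δ + D + P.natDegree) (hS : 2 * (R : ℝ) + 1 ≤ S) (hS' : 2 * (L : ℝ) + 1 ≤ S')
    (hSS' : S ≤ S') :
    traceCorrelation A B ρ ≤ (6 * c + 18 * ν 0 * v + 24 * ν 0 * C) *
      (S ^ g * ν y ^ (-(γ / (2 * v + 1 + γ))) + S' ^ g * ν z ^ (-(γ / (2 * v + 1 + γ)))) := by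
  obtain ⟨t, ht, hexp, hE⟩ := exists_time hν hv hγ hy
  have hmain := traceCorrelation_le_of_ball hν hF hv hmix hc hw hρ hb hA hB hAne hBne hm0 hm
    (q := y) (r := 2 * y) (r' := 2 * z) hy (by linarith) (by linarith) (by linarith) (by linarith)
    hr hr' ht
  refine hmain.trans ?_
  rw [hexp, mul_div_cancel_left₀ y two_ne_zero, mul_div_cancel_left₀ z two_ne_zero]
  have hS1 : 1 ≤ S := by linarith [Nat.cast_nonneg (α := ℝ) R]
  have hS1' : 1 ≤ S' := hS1.trans hSS'
  have hD : (0 : ℝ) ≤ D := Nat.cast_nonneg D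
  have hp : (0 : ℝ) ≤ P.natDegree := Nat.cast_nonneg _
  have hDδ : 0 ≤ D * δ := mul_nonneg hD hδ.le
  have hbS : ((ball w R).card : ℝ) ≤ S ^ (D : ℝ) := by
    rw [Real.rpow_natCast]
    calc ((ball w R).card : ℝ) ≤ ((2 * R + 1 : ℕ) : ℝ) ^ D := by exact_mod_cast card_ball_le w R
      _ ≤ S ^ D := by
        refine pow_le_pow_left₀ (Nat.cast_nonneg _) ?_ D
        push_cast; exact hS
  have hb0 : (0 : ℝ) ≤ (ball w R).card := Nat.cast_nonneg _
  have b1 : ((ball w R).card : ℝ) ^ δ ≤ S ^ g := by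
    calc ((ball w R).card : ℝ) ^ δ ≤ (S ^ (D : ℝ)) ^ δ := Real.rpow_le_rpow hb0 hbS hδ.le
      _ = S ^ (D * δ) := (Real.rpow_mul (by linarith) _ _).symm
      _ ≤ S ^ g := Real.rpow_le_rpow_of_exponent_le hS1 (by linarith)
  have b2 : ((ball w R).card : ℝ) ≤ S ^ g :=
    hbS.trans (Real.rpow_le_rpow_of_exponent_le hS1 (by linarith))
  have b3 : ∀ {U : ℝ} {N : ℕ}, S ≤ U → 2 * (N : ℝ) + 1 ≤ U →
      ((ball w R).card + 1) * P.eval (N : ℝ) ≤ 2 * C * U ^ g := by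
    intro U N hU hN
    have hU1 := hS1.trans hU
    have h1 : ((ball w R).card : ℝ) + 1 ≤ 2 * U ^ (D : ℝ) := by
      have h2 := hbS.trans (Real.rpow_le_rpow (by linarith) hU hD)
      have h3 := Real.one_le_rpow hU1 hD
      linarith
    have h2 : P.eval (N : ℝ) ≤ C * U ^ (P.natDegree : ℝ) := by
      refine (hC N (Nat.cast_nonneg N)).trans ?_
      rw [Real.rpow_natCast]
      refine mul_le_mul_of_nonneg_left (pow_le_pow_left₀ (by positivity) ?_ _) hC0
      linarith [Nat.cast_nonneg (α := ℝ) N]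
    have h3 : 0 ≤ C * U ^ (P.natDegree : ℝ) :=
      mul_nonneg hC0 (Real.rpow_nonneg (by linarith) _)
    calc ((ball w R).card + 1) * P.eval (N : ℝ)
        ≤ ((ball w R).card + 1) * (C * U ^ (P.natDegree : ℝ)) :=
          mul_le_mul_of_nonneg_left h2 (by positivity)
      _ ≤ (2 * U ^ (D : ℝ)) * (C * U ^ (P.natDegree : ℝ)) := mul_le_mul_of_nonneg_right h1 h3
      _ = 2 * C * U ^ ((D : ℝ) + P.natDegree) := by
          rw [Real.rpow_add (by linarith)]; ring
      _ ≤ 2 * C * U ^ g :=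
          mul_le_mul_of_nonneg_left (Real.rpow_le_rpow_of_exponent_le hU1 (by linarith))
            (by positivity)
  have b4 := b3 le_rfl hS
  have b5 := b3 hSS' hS'
  have hν0 := hν.pos 0 le_rfl
  have hνy := hν.pos y hy
  have hνz := hν.pos z (hy.trans hyz)
  have hE1 := hE y le_rfl
  have hE2 := hE z hyz
  have hSg : 0 ≤ S ^ g := Real.rpow_nonneg (by linarith) _
  have hSg' : 0 ≤ S' ^ g := Real.rpow_nonneg (by linarith) _
  have hY0 : 0 ≤ ν y ^ (-(γ / (2 * v + 1 + γ))) := Real.rpow_nonneg hνy.le _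
  have hZ0 : 0 ≤ ν z ^ (-(γ / (2 * v + 1 + γ))) := Real.rpow_nonneg hνz.le _
  have hE10 : 0 ≤ Real.exp (2 * v * t) * t / ν y := by positivity
  have hE20 : 0 ≤ Real.exp (2 * v * t) * t / ν z := by positivity
  generalize ν y ^ (-(γ / (2 * v + 1 + γ))) = Y at *
  generalize ν z ^ (-(γ / (2 * v + 1 + γ))) = Z at *
  generalize S ^ g = s at *
  generalize S' ^ g = s' at *
  generalize P.eval (L : ℝ) = pL at *
  generalize P.eval (R : ℝ) = pR at *
  generalize ((ball w R).card : ℝ) ^ δ = bδ at *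
  generalize ((ball w R).card : ℝ) = b at *
  have m1 : bδ * Y ≤ s * Y := mul_le_mul_of_nonneg_right b1 hY0
  have m2 : b * (Real.exp (2 * v * t) * t / ν y) ≤ s * Y := mul_le_mul b2 hE1 hE10 hSg
  have m3 : (b + 1) * pL * (Real.exp (2 * v * t) * t / ν z) ≤ 2 * C * s' * Z :=
    mul_le_mul b5 hE2 hE20 (by positivity)
  have m4 : (b + 1) * pR * (Real.exp (2 * v * t) * t / ν y) ≤ 2 * C * s * Y :=
    mul_le_mul b4 hE1 hE10 (by positivity)
  have m5 : 0 ≤ (6 * c + 18 * ν 0 * v + 12 * ν 0 * C) * (s' * Z) := by positivity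
  calc _ = 6 * c * (bδ * Y) + 18 * ν 0 * v * (b * (Real.exp (2 * v * t) * t / ν y)) +
        6 * ν 0 * ((b + 1) * pL * (Real.exp (2 * v * t) * t / ν z)) +
        12 * ν 0 * ((b + 1) * pR * (Real.exp (2 * v * t) * t / ν y)) := by ring
    _ ≤ 6 * c * (s * Y) + 18 * ν 0 * v * (s * Y) + 6 * ν 0 * (2 * C * s' * Z) +
        12 * ν 0 * (2 * C * s * Y) := by gcongr
    _ ≤ _ := by linarith

end Bound

/-! ### Decay of the trace distance correlation -/

section Decay

theorem regionDist_le {D : ℕ} {A B : Finset (Site D)} {a b : Site D} (ha : a ∈ A) (hb : b ∈ B) :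
    regionDist A B ≤ gdist a b := Nat.sInf_le ⟨a, ha, b, hb, rfl⟩

/-- The radius of the ball is bounded by a power of the distance of `A ∪ B` from its complement. -/
theorem two_mul_add_one_le {κ s x r : ℝ} (hκ : 0 < κ) (hs : 0 ≤ s) (hx : 0 ≤ x)
    (hr : r = κ * (s + x ^ κ)) :
    2 * x + 1 ≤ (2 + 2 * (1 / κ) ^ (1 / κ)) * (1 + r) ^ (max 1 (1 / κ)) := by
  have hxκ : 0 ≤ x ^ κ := Real.rpow_nonneg hx κ
  have hr0 : 0 ≤ r := by rw [hr]; positivity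
  have h1 : x ^ κ ≤ 1 / κ * (1 + r) := by
    rw [one_div, ← div_eq_inv_mul, le_div_iff₀ hκ, hr]
    nlinarith
  have h2 : x ≤ (1 / κ) ^ (1 / κ) * (1 + r) ^ (1 / κ) := by
    rw [← Real.mul_rpow (by positivity) (by positivity)]
    calc x = (x ^ κ) ^ (1 / κ) := by
          rw [← Real.rpow_mul hx, mul_one_div_cancel hκ.ne', Real.rpow_one]
      _ ≤ _ := Real.rpow_le_rpow hxκ h1 (by positivity)
  have h3 : (1 + r) ^ (1 / κ) ≤ (1 + r) ^ (max 1 (1 / κ)) :=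
    Real.rpow_le_rpow_of_exponent_le (by linarith) (le_max_right _ _)
  have h4 : 1 ≤ (1 + r) ^ (max 1 (1 / κ)) :=
    Real.one_le_rpow (by linarith) (le_max_of_le_left zero_le_one)
  have h5 : 0 ≤ (1 / κ) ^ (1 / κ) := by positivity
  have h6 := mul_le_mul_of_nonneg_left h3 h5
  linarith

/-- Two parts of a region `Y` at a distance `m` comparable to its diameter: the estimate of
`traceCorrelation_le_of_sizes`, in a ball around `Y` of radius comparable to `m` if it fits
into `Λ`, and in `Λ` itself otherwise. -/
theorem exists_traceCorrelation_le_of_region {D : ℕ} {d : Site D → ℕ} {F : UniformFamily d}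
    {ν : ℝ → ℝ} {v c γ δ : ℝ} {P : Polynomial ℝ} (hν : IsGrowthFunction ν)
    (hF : F.LiebRobinsonAssumptions ν v P) (hv : 0 < v) (hγ : 0 < γ) (hδ : 0 < δ)
    (hmix : F.RapidMixing c γ δ) (hc : 0 < c) {C : ℝ} (hC0 : 0 ≤ C)
    (hC : ∀ x : ℝ, 0 ≤ x → P.eval x ≤ C * (1 + x) ^ P.natDegree)
    (huniq : ∀ (u : Site D) (N : ℕ), HasUniqueFixedState (F.closedEvolution u N))
    {u : Site D} {L : ℕ} {ρ : Op d (ball u L)} (hρ : IsFixedState (F.closedEvolution u L) ρ)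
    {g : ℝ} (hg : g = D * δ + D + P.natDegree) {Cs θ r' : ℝ} (hCs2 : 2 ≤ Cs) (hθ1 : 1 ≤ θ)
    (hr'0 : 0 ≤ r') (hLr : 2 * (L : ℝ) + 1 ≤ Cs * (1 + r') ^ θ) {Y X₁ X₂ : Finset (Site D)}
    {m N : ℕ} (hN1 : 1 ≤ N) (hm0 : 0 < m) (hYΛ : Y ⊆ ball u L) (hX₁ : X₁ ⊆ Y) (hX₂ : X₂ ⊆ Y)
    (hne₁ : X₁.Nonempty) (hne₂ : X₂.Nonempty) (hm : ∀ a ∈ X₁, ∀ b ∈ X₂, m ≤ gdist a b)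
    (hYn : ∀ x ∈ Y, ∀ y ∈ Y, gdist x y + m ≤ N * m)
    (haway : ∀ x ∈ Y, ∀ y, y ∉ ball u L → r' ≤ gdist x y) :
    ∃ y z : ℝ, (y = m / 2 ∨ y = r' / 2) ∧ (z = m / 2 ∨ z = r' / 2) ∧
      traceCorrelation X₁ X₂ ρ ≤ (6 * c + 18 * ν 0 * v + 24 * ν 0 * C) *
        ((Cs * (N * (1 + 2 * y)) ^ θ) ^ g * ν y ^ (-(γ / (2 * v + 1 + γ))) +
          (Cs * (N * (1 + 2 * z)) ^ θ) ^ g * ν z ^ (-(γ / (2 * v + 1 + γ)))) := by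
  have hX : X₁ ∪ X₂ ⊆ Y := Finset.union_subset hX₁ hX₂
  have hr'X : ∀ x ∈ X₁ ∪ X₂, ∀ y, y ∉ ball u L → r' ≤ gdist x y := fun x hx =>
    haway x (hX hx)
  have hN1' : (1 : ℝ) ≤ N := by exact_mod_cast hN1
  have hsize : ∀ {a b : ℝ}, 0 ≤ a → a ≤ b → Cs * a ^ θ ≤ Cs * b ^ θ := fun ha hab =>
    mul_le_mul_of_nonneg_left (Real.rpow_le_rpow ha hab (by linarith)) (by linarith)
  rcases lt_or_ge ((N : ℝ) * m) r' with hcase | hcase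
  · -- a ball around the two clusters fits into `Λ`
    obtain ⟨x₀, hx₀⟩ := hne₁
    have hx₀Y := hX₁ hx₀
    have hsub : ball x₀ (N * m) ⊆ ball u L := by
      intro y hy
      rw [mem_ball] at hy
      by_contra hyn
      have h1 := hr'X x₀ (Finset.mem_union_left _ hx₀) y hyn
      have h2 : (gdist x₀ y : ℝ) ≤ N * m := by exact_mod_cast hy
      linarith
    have hYb : Y ⊆ ball x₀ (N * m) := fun y hy => by
      rw [mem_ball]
      have := hYn x₀ hx₀Y y hy
      omega
    have hfar : ∀ x ∈ X₁ ∪ X₂, ∀ x', x' ∉ ball x₀ (N * m) → 2 * ((m : ℝ) / 2) ≤ gdist x x' := by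
      intro x hx x' hx'
      rw [mem_ball, not_le] at hx'
      have h1 := hYn x₀ hx₀Y x (hX hx)
      have h2 := gdist_triangle x₀ x x'
      rw [mul_div_cancel₀ _ two_ne_zero]
      exact_mod_cast (show m ≤ gdist x x' by omega)
    have hNm : (m : ℝ) ≤ N * m := le_mul_of_one_le_left (Nat.cast_nonneg m) hN1'
    have hbd := traceCorrelation_le_of_sizes hν hF hv hγ hδ hmix hc hC0 hC
      (huniq x₀ (N * m)) hρ hsub (hX₁.trans hYb) (hX₂.trans hYb) ⟨x₀, hx₀⟩ hne₂ hm0 hm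
      (y := (m : ℝ) / 2) (z := r' / 2) (by positivity) (by linarith) (by linarith) hfar
      (by rw [mul_div_cancel₀ _ two_ne_zero]; exact hr'X)
      (S := Cs * (N * (1 + 2 * ((m : ℝ) / 2))) ^ θ) (S' := Cs * (N * (1 + 2 * (r' / 2))) ^ θ) hg ?_
      ?_ (hsize (by positivity) (by
        refine mul_le_mul_of_nonneg_left ?_ (by positivity); linarith))
    · exact ⟨_, _, Or.inl rfl, Or.inr rfl, hbd⟩
    · rw [mul_div_cancel₀ _ two_ne_zero]
      have h1 : (N : ℝ) * (1 + m) ≤ (N * (1 + m)) ^ θ := by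
        conv_lhs => rw [← Real.rpow_one (N * (1 + m))]
        exact Real.rpow_le_rpow_of_exponent_le (by nlinarith) hθ1
      have h2 : 0 ≤ ((N : ℝ) * (1 + m)) ^ θ := by positivity
      have h3 := mul_le_mul_of_nonneg_right hCs2 h2
      push_cast
      linarith
    · rw [mul_div_cancel₀ _ two_ne_zero]
      exact hLr.trans (hsize (by positivity) (le_mul_of_one_le_left (by positivity) hN1'))
  · -- the distance from the boundary of `Λ` is small; the ball is `Λ` itself
    obtain ⟨y, hy⟩ : ∃ y : ℝ, y = min ((m : ℝ) / 2) (r' / 2) := ⟨_, rfl⟩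
    have hym : 2 * y ≤ m := by rw [hy]; linarith [min_le_left ((m : ℝ) / 2) (r' / 2)]
    have hyr : 2 * y ≤ r' := by rw [hy]; linarith [min_le_right ((m : ℝ) / 2) (r' / 2)]
    have hy0 : 0 ≤ y := by rw [hy]; positivity
    have hsy : y = m / 2 ∨ y = r' / 2 := by rw [hy]; exact min_choice _ _
    have hsz : 1 + r' ≤ N * (1 + 2 * y) := by
      rcases min_choice ((m : ℝ) / 2) (r' / 2) with h | h <;> rw [hy, h]
      · rw [mul_div_cancel₀ _ two_ne_zero]; linarith
      · rw [mul_div_cancel₀ _ two_ne_zero]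
        exact le_mul_of_one_le_left (by positivity) hN1'
    have hLS : 2 * (L : ℝ) + 1 ≤ Cs * (N * (1 + 2 * y)) ^ θ :=
      hLr.trans (hsize (by positivity) hsz)
    have hfar : ∀ x ∈ X₁ ∪ X₂, ∀ x', x' ∉ ball u L → 2 * y ≤ gdist x x' :=
      fun x hx x' hx' => hyr.trans (hr'X x hx x' hx')
    have hbd := traceCorrelation_le_of_sizes hν hF hv hγ hδ hmix hc hC0 hC
      (huniq u L) hρ (Finset.Subset.refl _) (hX₁.trans hYΛ) (hX₂.trans hYΛ) hne₁ hne₂ hm0 hm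
      hy0 le_rfl hym hfar hfar hg hLS hLS le_rfl
    exact ⟨y, y, hsy, hsy, hbd⟩

/-- Decay of the trace distance correlation, with a rate given by any majorant of
`(1 + r) ^ k * ν r ^ (-β)`. -/
theorem exists_traceCorrelation_le (D : ℕ) {κ v c γ δ : ℝ} (P : Polynomial ℝ)
    (hκ : 0 < κ) (hv : 0 < v) (hc : 0 < c) (hγ : 0 < γ) (hδ : 0 < δ) :
    ∃ β k : ℝ, 0 < β ∧ 0 ≤ k ∧ ∀ ν : ℝ → ℝ, IsGrowthFunction ν → ∃ K : ℝ, 0 ≤ K ∧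
      ∀ (d : Site D → ℕ) (F : UniformFamily d), F.LiebRobinsonAssumptions ν v P →
        F.RapidMixing c γ δ →
        (∀ (u : Site D) (N : ℕ), HasUniqueFixedState (F.closedEvolution u N)) →
      ∀ (u : Site D) (L : ℕ) (ρ : Op d (ball u L)), IsFixedState (F.closedEvolution u L) ρ →
      ∀ A B : Finset (Site D), A ⊆ ball u L → B ⊆ ball u L → 0 < regionDist A B →
        (∀ x ∈ A ∪ B, ∀ y, y ∉ ball u L →
          κ * ((regionDist A B : ℝ) + (L : ℝ) ^ κ) ≤ (gdist x y : ℝ)) →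
      ∀ M : ℝ, (∀ r, (regionDist A B : ℝ) / 2 ≤ r → (1 + r) ^ k * ν r ^ (-β) ≤ M) →
        traceCorrelation A B ρ ≤ 3 * ((A.card : ℝ) + B.card) ^ (k + 1) * (K * M) := by
  classical
  obtain ⟨C, hC0, hC⟩ := exists_eval_le P
  obtain ⟨g, hg⟩ : ∃ g : ℝ, g = D * δ + D + P.natDegree := ⟨_, rfl⟩
  have hg0 : 0 ≤ g := by rw [hg]; positivity
  -- sizes of balls are at most a constant times the power `θ` of the distance from their boundary,
  -- and all the lengths in the argument are at least `s / (2 (J + 1))`, for `s` the distance of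
  -- `A` and `B`; this costs a factor `J + 1` in the exponent `β`
  obtain ⟨θ, hθ⟩ : ∃ θ : ℝ, θ = max 1 (1 / κ) := ⟨_, rfl⟩
  have hθ1 : 1 ≤ θ := hθ ▸ le_max_left _ _
  obtain ⟨J, hJ⟩ : ∃ J : ℕ, J = ⌈1 / κ⌉₊ := ⟨_, rfl⟩
  obtain ⟨β₀, hβ₀⟩ : ∃ β₀ : ℝ, β₀ = γ / (2 * v + 1 + γ) := ⟨_, rfl⟩
  have hβ₀0 : 0 < β₀ := by rw [hβ₀]; positivity
  obtain ⟨Cs, hCs⟩ : ∃ Cs : ℝ, Cs = 2 + 2 * (1 / κ) ^ (1 / κ) := ⟨_, rfl⟩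
  have hCs2 : 2 ≤ Cs := by
    rw [hCs]
    have : 0 ≤ (1 / κ) ^ (1 / κ) := by positivity
    linarith
  have hk0 : 0 ≤ θ * g := by positivity
  refine ⟨β₀ / (J + 1 : ℕ), θ * g, by positivity, hk0, fun ν hν => ?_⟩
  have hν0 := hν.pos 0 le_rfl
  obtain ⟨K₁, hK₁⟩ : ∃ K₁ : ℝ, K₁ = 6 * c + 18 * ν 0 * v + 24 * ν 0 * C := ⟨_, rfl⟩
  have hK₁0 : 0 ≤ K₁ := by rw [hK₁]; positivity
  refine ⟨K₁ * (2 * (Cs ^ g * 2 ^ (θ * g) * 2 ^ (θ * g))), by positivity, ?_⟩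
  intro d F hF hmix huniq u L ρ hρ A B hA hB hdist haway M hM
  obtain ⟨s, hs⟩ : ∃ s, s = regionDist A B := ⟨_, rfl⟩
  rw [← hs] at hdist haway hM
  have hAB : ∀ a ∈ A, ∀ b ∈ B, s ≤ gdist a b := fun a ha b hb => hs ▸ regionDist_le ha hb
  have hdisj : Disjoint A B := by
    refine Finset.disjoint_left.2 fun x hx hx' => ?_
    have := hAB x hx x hx'
    rw [gdist_self] at this
    omega
  obtain ⟨N, hN⟩ : ∃ N, N = (A ∪ B).card + 1 := ⟨_, rfl⟩
  have hN1 : (1 : ℝ) ≤ N := by rw [hN]; push_cast; linarith [Nat.cast_nonneg (α := ℝ) (A ∪ B).card]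
  have hs0 : (0 : ℝ) ≤ s := Nat.cast_nonneg s
  have hM0 : 0 ≤ M := by
    refine le_trans ?_ (hM (s / 2) le_rfl)
    exact mul_nonneg (Real.rpow_nonneg (by positivity) _)
      (Real.rpow_nonneg (hν.pos _ (by positivity)).le _)
  obtain ⟨r', hr'⟩ : ∃ r' : ℝ, r' = κ * ((s : ℝ) + (L : ℝ) ^ κ) := ⟨_, rfl⟩
  rw [← hr'] at haway
  have hL0 : 0 ≤ (L : ℝ) ^ κ := Real.rpow_nonneg (Nat.cast_nonneg L) κ
  have hr'0 : 0 ≤ r' := by rw [hr']; positivity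
  have hLr := two_mul_add_one_le hκ hs0 (Nat.cast_nonneg L) hr'
  rw [← hCs, ← hθ] at hLr
  have hJκ : (s : ℝ) ≤ (J + 1 : ℕ) * r' := by
    have h1 : 1 / κ ≤ (J + 1 : ℕ) := by
      rw [hJ]; push_cast
      linarith [Nat.le_ceil (1 / κ)]
    rw [div_le_iff₀ hκ] at h1
    have h2 : κ * s ≤ r' := by rw [hr']; nlinarith
    have h3 : (0 : ℝ) ≤ (J + 1 : ℕ) := Nat.cast_nonneg _
    nlinarith [mul_le_mul_of_nonneg_left h2 h3]
  -- the contribution of a ball of size comparable to `N * (1 + 2 * x)`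
  have hφ : ∀ x : ℝ, 0 ≤ x → (s : ℝ) / 2 ≤ (J + 1 : ℕ) * x →
      (Cs * (N * (1 + 2 * x)) ^ θ) ^ g * ν x ^ (-β₀) ≤
        Cs ^ g * (N : ℝ) ^ (θ * g) * 2 ^ (θ * g) * M := by
    intro x hx hsx
    have e : (Cs * (N * (1 + 2 * x)) ^ θ) ^ g =
        Cs ^ g * ((N : ℝ) ^ (θ * g) * (1 + 2 * x) ^ (θ * g)) := by
      rw [Real.mul_rpow (by linarith) (by positivity), ← Real.rpow_mul (by positivity),
        Real.mul_rpow (by positivity) (by positivity)]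
    have h1 := (hν.rate_le hx hβ₀0 hk0 J).trans
      (mul_le_mul_of_nonneg_left (hM _ hsx) (by positivity))
    rw [e]
    calc _ = Cs ^ g * (N : ℝ) ^ (θ * g) * ((1 + 2 * x) ^ (θ * g) * ν x ^ (-β₀)) := by ring
      _ ≤ Cs ^ g * (N : ℝ) ^ (θ * g) * (2 ^ (θ * g) * M) :=
        mul_le_mul_of_nonneg_left h1 (by positivity)
      _ = _ := by ring
  have hpair := traceCorrelation_le_of_bipartitions (A := A) (B := B) hρ.1
    (η := K₁ * (2 * (Cs ^ g * (N : ℝ) ^ (θ * g) * 2 ^ (θ * g) * M))) (by positivity) hdist hA hB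
    hAB ?_
  · refine hpair.trans ?_
    have hcard : ((A ∪ B).card : ℝ) = A.card + B.card := by
      rw [Finset.card_union_of_disjoint hdisj]; push_cast; rfl
    rw [← hcard]
    rcases Nat.eq_zero_or_pos (A ∪ B).card with h0 | h0
    · rw [h0]; simp; positivity
    have hn1 : (1 : ℝ) ≤ (A ∪ B).card := by exact_mod_cast h0
    have hNn : (N : ℝ) ^ (θ * g) ≤ 2 ^ (θ * g) * ((A ∪ B).card : ℝ) ^ (θ * g) := by
      rw [← Real.mul_rpow (by norm_num) (by positivity)]
      refine Real.rpow_le_rpow (by positivity) ?_ hk0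
      rw [hN]; push_cast; linarith
    rw [Real.rpow_add (by positivity), Real.rpow_one]
    have h2 : 0 ≤ 6 * K₁ * Cs ^ g * 2 ^ (θ * g) * M * (A ∪ B).card := by positivity
    have h3 := mul_le_mul_of_nonneg_left hNn h2
    calc _ = 6 * K₁ * Cs ^ g * 2 ^ (θ * g) * M * (A ∪ B).card * (N : ℝ) ^ (θ * g) := by ring
      _ ≤ _ := h3
      _ = _ := by ring
  intro Y X₁ X₂ m hY hX₁ hX₂ hne₁ hne₂ hsm hm hdiam
  have hm0 : 0 < m := hdist.trans_le hsm
  have hsm' : (s : ℝ) ≤ m := by exact_mod_cast hsm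
  have hYn : ∀ x ∈ Y, ∀ y ∈ Y, gdist x y + m ≤ N * m := by
    intro x hx y hy
    have h1 := hdiam x hx y hy
    have h2 : Y.card * m ≤ (A ∪ B).card * m := Nat.mul_le_mul_right m (Finset.card_le_card hY)
    rw [hN, Nat.succ_mul]
    omega
  have hABΛ : A ∪ B ⊆ ball u L := Finset.union_subset hA hB
  have hJ1 : (1 : ℝ) ≤ (J + 1 : ℕ) := by exact_mod_cast Nat.succ_le_succ (Nat.zero_le J)
  have hsmall : (s : ℝ) / 2 ≤ (J + 1 : ℕ) * ((m : ℝ) / 2) := by nlinarith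
  have hlarge : (s : ℝ) / 2 ≤ (J + 1 : ℕ) * (r' / 2) := by linarith
  obtain ⟨y, z, hy, hz, hbd⟩ := exists_traceCorrelation_le_of_region hν hF hv hγ hδ hmix hc hC0 hC
    huniq hρ hg hCs2 hθ1 hr'0 hLr (Nat.one_le_cast.1 hN1) hm0 (hY.trans hABΛ) hX₁ hX₂ hne₁ hne₂ hm
    hYn (fun x hx => haway x (hY hx))
  rw [← hβ₀, ← hK₁] at hbd
  refine hbd.trans (mul_le_mul_of_nonneg_left ?_ hK₁0)
  have hsc : ∀ {y : ℝ}, (y = m / 2 ∨ y = r' / 2) → (Cs * (N * (1 + 2 * y)) ^ θ) ^ g * ν y ^ (-β₀) ≤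
      Cs ^ g * (N : ℝ) ^ (θ * g) * 2 ^ (θ * g) * M := by
    rintro y (rfl | rfl)
    · exact hφ _ (by positivity) hsmall
    · exact hφ _ (by positivity) hlarge
  have h1 := hsc hy
  have h2 := hsc hz
  linarith

end Decay

/-! ### Fast decay of the rate -/

section Majorant

/-- The least nonincreasing majorant of `(1 + r) ^ k * ν r ^ (-β)` on `[0, ∞)`, extended to negative
arguments by its value at zero. -/
def majorant (ν : ℝ → ℝ) (β k s : ℝ) : ℝ :=
  sSup ((fun r => (1 + r) ^ k * ν r ^ (-β)) '' Set.Ici (max s 0))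

variable {ν : ℝ → ℝ} {β k : ℝ}

theorem rate_nonneg (hν : IsGrowthFunction ν) {r : ℝ} (hr : 0 ≤ r) :
    0 ≤ (1 + r) ^ k * ν r ^ (-β) :=
  mul_nonneg (Real.rpow_nonneg (by positivity) _) (Real.rpow_nonneg (hν.pos r hr).le _)

theorem bddAbove_rate (hν : IsGrowthFunction ν) (hf : SufficientlyFast ν β k) (hβ : 0 < β)
    (hk : 0 ≤ k) (s : ℝ) :
    BddAbove ((fun r => (1 + r) ^ k * ν r ^ (-β)) '' Set.Ici (max s 0)) := by
  have h1 : ∀ᶠ r in atTop, (1 + r) ^ k * ν r ^ (-β) ≤ 1 :=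
    (hf.eventually (gt_mem_nhds zero_lt_one)).mono fun _ h => h.le
  obtain ⟨r₀, hr₀⟩ := eventually_atTop.1 h1
  refine ⟨max 1 ((1 + |r₀|) ^ k), ?_⟩
  rintro _ ⟨r, hr, rfl⟩
  have hr0 : 0 ≤ r := (le_max_right s 0).trans hr
  rcases le_total r₀ r with h | h
  · exact le_max_of_le_left (hr₀ r h)
  · refine le_max_of_le_right ?_
    have h2 : ν r ^ (-β) ≤ 1 := Real.rpow_le_one_of_one_le_of_nonpos (hν.one_le hr0) (by linarith)
    have h3 : (1 + r) ^ k ≤ (1 + |r₀|) ^ k :=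
      Real.rpow_le_rpow (by positivity) (by linarith [le_abs_self r₀]) hk
    have h4 : 0 ≤ (1 + r) ^ k := Real.rpow_nonneg (by positivity) _
    calc (1 + r) ^ k * ν r ^ (-β) ≤ (1 + r) ^ k * 1 := mul_le_mul_of_nonneg_left h2 h4
      _ ≤ _ := by rw [mul_one]; exact h3

theorem majorant_le {s g : ℝ} (h : ∀ r, max s 0 ≤ r → (1 + r) ^ k * ν r ^ (-β) ≤ g) :
    majorant ν β k s ≤ g := by
  refine csSup_le ⟨_, Set.mem_image_of_mem _ Set.self_mem_Ici⟩ ?_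
  rintro _ ⟨r, hr, rfl⟩
  exact h r hr

theorem rate_le_majorant (hν : IsGrowthFunction ν) (hf : SufficientlyFast ν β k) (hβ : 0 < β)
    (hk : 0 ≤ k) {s r : ℝ} (hr : max s 0 ≤ r) :
    (1 + r) ^ k * ν r ^ (-β) ≤ majorant ν β k s :=
  le_csSup (bddAbove_rate hν hf hβ hk s) ⟨r, hr, rfl⟩

theorem isFastDecaying_majorant (hν : IsGrowthFunction ν) (hf : SufficientlyFast ν β k)
    (hβ : 0 < β) (hk : 0 ≤ k) {K : ℝ} (hK : 0 ≤ K) :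
    IsFastDecaying ν β k fun s => K * majorant ν β k s := by
  have hle : ∀ s r, max s 0 ≤ r → (1 + r) ^ k * ν r ^ (-β) ≤ majorant ν β k s := fun s r hr =>
    rate_le_majorant hν hf hβ hk hr
  have hnn : ∀ s, 0 ≤ majorant ν β k s := fun s =>
    (rate_nonneg hν (le_max_right s 0)).trans (hle s _ le_rfl)
  have hanti : ∀ s s', s ≤ s' → majorant ν β k s' ≤ majorant ν β k s := fun s s' h =>
    majorant_le fun r hr => hle s r ((max_le_max h le_rfl).trans hr)
  refine ⟨fun s _ => mul_nonneg hK (hnn s), fun s _ s' _ h =>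
    mul_le_mul_of_nonneg_left (hanti s s' h) hK, ?_, ⟨K, fun s hs g hg => ?_⟩, ?_, ?_⟩
  · have : Tendsto (majorant ν β k) atTop (𝓝 0) := by
      rw [Metric.tendsto_atTop]
      intro ε hε
      have h1 : ∀ᶠ r in atTop, (1 + r) ^ k * ν r ^ (-β) ≤ ε / 2 :=
        (hf.eventually (gt_mem_nhds (half_pos hε))).mono fun _ h => h.le
      obtain ⟨r₀, hr₀⟩ := eventually_atTop.1 h1
      refine ⟨r₀, fun s hs => ?_⟩
      rw [Real.dist_eq, sub_zero, abs_of_nonneg (hnn s)]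
      have := majorant_le (ν := ν) (β := β) (k := k) (s := s) (g := ε / 2) fun r hr =>
        hr₀ r (hs.trans ((le_max_left s 0).trans hr))
      linarith
    simpa using this.const_mul K
  · refine mul_le_mul_of_nonneg_left (majorant_le fun r hr => hg r ?_) hK
    exact (le_max_left s 0).trans hr
  · -- half of the exponential rate absorbs the polynomial factor
    intro a μ ha hμ h
    have hβμ : 0 < β * μ / 2 := by positivity
    have hlim : Tendsto (fun r : ℝ => (1 + r) ^ k * Real.exp (-(β * μ / 2) * (1 + r))) atTop
        (𝓝 0) :=
      (tendsto_rpow_mul_exp_neg_mul_atTop_nhds_zero k (β * μ / 2) hβμ).comp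
        (tendsto_atTop_add_const_left atTop 1 tendsto_id)
    obtain ⟨r₀, hr₀⟩ := eventually_atTop.1 ((hlim.eventually (gt_mem_nhds zero_lt_one)).mono
      fun _ h => h.le)
    obtain ⟨C, hC⟩ : ∃ C, C = max 1 ((1 + |r₀|) ^ k) := ⟨_, rfl⟩
    have hC1 : 1 ≤ C := hC ▸ le_max_left _ _
    have hpoly : ∀ r, 0 ≤ r → (1 + r) ^ k ≤ C * Real.exp (β * μ / 2 * (1 + r)) := by
      intro r hr
      rcases le_total r₀ r with h1 | h1
      · have h2 := hr₀ r h1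
        rw [neg_mul, Real.exp_neg, ← div_eq_mul_inv, div_le_one (Real.exp_pos _)] at h2
        exact h2.trans (le_mul_of_one_le_left (Real.exp_pos _).le hC1)
      · have h2 : (1 + r) ^ k ≤ (1 + |r₀|) ^ k :=
          Real.rpow_le_rpow (by positivity) (by linarith [le_abs_self r₀]) hk
        have h3 : 1 ≤ Real.exp (β * μ / 2 * (1 + r)) := Real.one_le_exp (by positivity)
        have h4 : (1 + |r₀|) ^ k ≤ C := hC ▸ le_max_right _ _
        exact (h2.trans h4).trans (le_mul_of_one_le_right (by linarith) h3)
    refine ⟨K * (C * Real.exp (β * μ / 2) * a ^ (-β)), β * μ / 2, hβμ, fun s hs => ?_⟩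
    rw [mul_assoc]
    refine mul_le_mul_of_nonneg_left (majorant_le fun r hr => ?_) hK
    have hsr : s ≤ r := (le_max_left s 0).trans hr
    have hr0 : 0 ≤ r := hs.trans hsr
    have h1 : ν r ^ (-β) ≤ a ^ (-β) * Real.exp (-(β * μ * r)) := by
      have h2 : ν r ^ (-β) ≤ (a * Real.exp (μ * r)) ^ (-β) :=
        Real.rpow_le_rpow_of_nonpos (by positivity) (h r hr0) (by linarith)
      refine h2.trans (le_of_eq ?_)
      rw [Real.mul_rpow ha.le (Real.exp_pos _).le, ← Real.exp_mul]
      congr 2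
      ring
    calc (1 + r) ^ k * ν r ^ (-β)
        ≤ (C * Real.exp (β * μ / 2 * (1 + r))) * (a ^ (-β) * Real.exp (-(β * μ * r))) :=
          mul_le_mul (hpoly r hr0) h1 (Real.rpow_nonneg (hν.pos r hr0).le _) (by positivity)
      _ = C * a ^ (-β) * (Real.exp (β * μ / 2 * (1 + r)) * Real.exp (-(β * μ * r))) := by ring
      _ = C * a ^ (-β) * (Real.exp (β * μ / 2) * Real.exp (-(β * μ / 2 * r))) := by
          rw [← Real.exp_add, ← Real.exp_add]; congr 2; ring
      _ ≤ C * a ^ (-β) * (Real.exp (β * μ / 2) * Real.exp (-(β * μ / 2 * s))) := by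
          gcongr
      _ = _ := by ring
  · intro a p ha hp h
    have h1 : ∀ r, 0 ≤ r → (1 + r) ^ k * ν r ^ (-β) ≤ a ^ (-β) * (1 + r) ^ (-(β * p - k)) := by
      intro r hr
      have h2 : ν r ^ (-β) ≤ (a * (1 + r) ^ p) ^ (-β) :=
        Real.rpow_le_rpow_of_nonpos (by positivity) (h r hr) (by linarith)
      refine (mul_le_mul_of_nonneg_left h2 (by positivity)).trans (le_of_eq ?_)
      rw [Real.mul_rpow ha.le (by positivity), ← Real.rpow_mul (by positivity), mul_left_comm,
        ← Real.rpow_add (by positivity)]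
      congr 2
      ring
    rcases le_total 0 (β * p - k) with hpos | hneg
    · refine ⟨K * a ^ (-β), fun s hs => ?_⟩
      rw [mul_assoc]
      refine mul_le_mul_of_nonneg_left (majorant_le fun r hr => ?_) hK
      have hsr : s ≤ r := (le_max_left s 0).trans hr
      refine (h1 r (hs.trans hsr)).trans (mul_le_mul_of_nonneg_left ?_ (by positivity))
      exact Real.rpow_le_rpow_of_nonpos (by positivity) (by linarith) (by linarith)
    · -- here the claimed bound is increasing, and boundedness is enough
      refine ⟨K * majorant ν β k 0, fun s hs => ?_⟩
      have h2 : 1 ≤ (1 + s) ^ (-(β * p - k)) := Real.one_le_rpow (by linarith) (by linarith)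
      exact (mul_le_mul_of_nonneg_left (hanti 0 s hs) hK).trans
        (le_mul_of_one_le_right (mul_nonneg hK (hnn 0)) h2)

end Majorant

/-! ### Inequalities for the von Neumann entropy -/

section Entropy

variable {n m : Type} [Fintype n] [DecidableEq n] [Fintype m] [DecidableEq m]

/-- The von Neumann entropy with the natural logarithm, as a function of the roots of the
characteristic polynomial. -/
def natEntropy (ρ : Matrix n n ℂ) : ℝ :=
  (ρ.charpoly.roots.map fun z : ℂ => Real.negMulLog z.re).sum

theorem entropy_eq_natEntropy_div {ρ : Matrix n n ℂ} (hρ : ρ.IsHermitian) :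
    entropy ρ = natEntropy ρ / Real.log 2 := by
  rw [entropy, dif_pos hρ, natEntropy, hρ.roots_charpoly_eq_eigenvalues, Multiset.map_map]
  change _ = (∑ i, Real.negMulLog ((hρ.eigenvalues i : ℂ)).re) / Real.log 2
  rw [Finset.sum_div]
  refine Finset.sum_congr rfl fun i _ => ?_
  rw [Complex.ofReal_re, Real.logb, Real.negMulLog]
  ring

/-- The eigenvalue zero does not contribute to the entropy, and the other eigenvalues of `A B` and
`B A` agree. -/
theorem natEntropy_mul_comm (A : Matrix n m ℂ) (B : Matrix m n ℂ) :
    natEntropy (A * B) = natEntropy (B * A) := by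
  have key : ∀ {k l : Type} [Fintype k] [DecidableEq k] [Fintype l] [DecidableEq l]
      (M : Matrix k k ℂ), natEntropy M = ((Polynomial.X ^ Fintype.card l * M.charpoly).roots.map
        fun z : ℂ => Real.negMulLog z.re).sum := by
    intro k l _ _ _ _ M
    rw [Polynomial.roots_mul (mul_ne_zero (pow_ne_zero _ Polynomial.X_ne_zero)
      M.charpoly_monic.ne_zero), Polynomial.roots_X_pow, Multiset.map_add, Multiset.sum_add,
      natEntropy, Multiset.map_nsmul, Multiset.sum_nsmul]
    simp
  rw [key (l := m) (A * B), key (l := n) (B * A), Matrix.charpoly_mul_comm']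

theorem natEntropy_conj {U : Matrix m n ℂ} (hU : U.conjTranspose * U = 1) (ρ : Matrix n n ℂ) :
    natEntropy (U * ρ * U.conjTranspose) = natEntropy ρ := by
  rw [natEntropy_mul_comm, ← Matrix.mul_assoc, hU, Matrix.one_mul]

theorem natEntropy_submatrix_equiv (ρ : Matrix n n ℂ) (e : m ≃ n) :
    natEntropy (ρ.submatrix e e) = natEntropy ρ := by
  have := Matrix.charpoly_reindex e.symm ρ
  rw [Matrix.reindex_apply, Equiv.symm_symm] at this
  rw [natEntropy, this, natEntropy]

theorem natEntropy_diagonal (μ : n → ℝ) :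
    natEntropy (Matrix.diagonal fun i => (μ i : ℂ)) = ∑ i, Real.negMulLog (μ i) := by
  rw [natEntropy, Matrix.charpoly_diagonal, Polynomial.roots_prod _ _
    (Finset.prod_ne_zero_iff.2 fun i _ => Polynomial.X_sub_C_ne_zero _)]
  simp

theorem exists_spectral {ρ : Matrix n n ℂ} (hρ : ρ.IsHermitian) :
    ∃ (U : Matrix n n ℂ) (μ : n → ℝ), U.conjTranspose * U = 1 ∧ U * U.conjTranspose = 1 ∧
      ρ = U * Matrix.diagonal (fun i => (μ i : ℂ)) * U.conjTranspose := by
  refine ⟨hρ.eigenvectorUnitary, hρ.eigenvalues, Unitary.coe_star_mul_self _,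
    Unitary.coe_mul_star_self _, ?_⟩
  have := hρ.spectral_theorem
  rw [Unitary.conjStarAlgAut_apply] at this
  exact this

theorem exists_spectral_of_posSemidef {ρ : Matrix n n ℂ} (hρ : ρ.PosSemidef) :
    ∃ (U : Matrix n n ℂ) (μ : n → ℝ), U.conjTranspose * U = 1 ∧ U * U.conjTranspose = 1 ∧
      ρ = U * Matrix.diagonal (fun i => (μ i : ℂ)) * U.conjTranspose ∧ (∀ i, 0 ≤ μ i) ∧
      natEntropy ρ = ∑ i, Real.negMulLog (μ i) ∧ ρ.trace = ((∑ i, μ i : ℝ) : ℂ) := by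
  obtain ⟨U, μ, h1, h2, h3⟩ := exists_spectral hρ.1
  have h4 : U.conjTranspose * ρ * U = Matrix.diagonal (fun i => (μ i : ℂ)) := by
    calc U.conjTranspose * ρ * U = (U.conjTranspose * U) * Matrix.diagonal (fun i => (μ i : ℂ)) *
          (U.conjTranspose * U) := by rw [h3]; simp only [Matrix.mul_assoc]
      _ = _ := by rw [h1, Matrix.one_mul, Matrix.mul_one]
  refine ⟨U, μ, h1, h2, h3, fun i => ?_, ?_, ?_⟩
  · have h5 := (hρ.conjTranspose_mul_mul_same U).diag_nonneg (i := i)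
    rw [h4, Matrix.diagonal_apply_eq] at h5
    exact_mod_cast h5
  · rw [h3, natEntropy_conj h1, natEntropy_diagonal]
  · rw [h3, Matrix.trace_mul_comm, ← Matrix.mul_assoc, h1, Matrix.one_mul, Matrix.trace_diagonal]
    push_cast; rfl

theorem conj_diagonal_apply_self (U : Matrix n m ℂ) (μ : m → ℝ) (i : n) :
    (U * Matrix.diagonal (fun i => (μ i : ℂ)) * U.conjTranspose) i i =
      ((∑ j, Complex.normSq (U i j) * μ j : ℝ) : ℂ) := by
  rw [Matrix.mul_apply]
  push_cast
  refine Finset.sum_congr rfl fun j _ => ?_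
  rw [Matrix.mul_diagonal, Matrix.conjTranspose_apply, Complex.normSq_eq_conj_mul_self,
    RCLike.star_def]
  ring

/-- Schur's inequality: the entropy of the diagonal is at least the entropy of the state, as the
diagonal is an image of the spectrum under a doubly stochastic matrix. -/
theorem natEntropy_le_diag {ρ : Matrix n n ℂ} (hρ : ρ.PosSemidef) :
    natEntropy ρ ≤ ∑ i, Real.negMulLog (ρ i i).re := by
  obtain ⟨U, μ, h1, h2, h3, hμ, hS, -⟩ := exists_spectral_of_posSemidef hρ
  have hrow : ∀ i, ∑ j, Complex.normSq (U i j) = 1 := by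
    intro i
    have h := congrFun (congrFun h2 i) i
    rw [Matrix.mul_apply, Matrix.one_apply_eq] at h
    have h' : ((∑ j, Complex.normSq (U i j) : ℝ) : ℂ) = 1 := by
      rw [← h]; push_cast
      refine Finset.sum_congr rfl fun j _ => ?_
      rw [Matrix.conjTranspose_apply, Complex.normSq_eq_conj_mul_self, RCLike.star_def, mul_comm]
    exact_mod_cast h'
  have hcol : ∀ j, ∑ i, Complex.normSq (U i j) = 1 := by
    intro j
    have h := congrFun (congrFun h1 j) j
    rw [Matrix.mul_apply, Matrix.one_apply_eq] at h
    have h' : ((∑ i, Complex.normSq (U i j) : ℝ) : ℂ) = 1 := by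
      rw [← h]; push_cast
      refine Finset.sum_congr rfl fun i _ => ?_
      rw [Matrix.conjTranspose_apply, Complex.normSq_eq_conj_mul_self, RCLike.star_def]
    exact_mod_cast h'
  calc natEntropy ρ = ∑ j, (∑ i, Complex.normSq (U i j)) * Real.negMulLog (μ j) := by
        rw [hS]; simp only [hcol, one_mul]
    _ = ∑ i, ∑ j, Complex.normSq (U i j) * Real.negMulLog (μ j) := by
        simp only [Finset.sum_mul]; exact Finset.sum_comm
    _ ≤ ∑ i, Real.negMulLog (ρ i i).re := by
        refine Finset.sum_le_sum fun i _ => ?_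
        have e : (ρ i i).re = ∑ j, Complex.normSq (U i j) * μ j := by
          conv_lhs => rw [h3, conj_diagonal_apply_self, Complex.ofReal_re]
        rw [e]
        exact Real.concaveOn_negMulLog.le_map_sum (fun j _ => Complex.normSq_nonneg _) (hrow i)
          fun j _ => hμ j

/-- The entropy of an ensemble of pure states is at most the entropy of its weights. -/
theorem natEntropy_sum_vecMulVec_le {κ : Type} [Fintype κ] [DecidableEq κ] (ψ : κ → n → ℂ) :
    natEntropy (∑ k, Matrix.vecMulVec (ψ k) (star (ψ k))) ≤
      ∑ k, Real.negMulLog (normSq (ψ k)) := by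
  -- `Ψ Ψ*` has the same entropy as the Gram matrix `Ψ* Ψ`
  obtain ⟨Ψ, hΨ⟩ : ∃ Ψ : Matrix n κ ℂ, Ψ = Matrix.of fun i k => ψ k i := ⟨_, rfl⟩
  have e : ∑ k, Matrix.vecMulVec (ψ k) (star (ψ k)) = Ψ * Ψ.conjTranspose := by
    ext i j
    simp [hΨ, Matrix.sum_apply, Matrix.mul_apply, Matrix.vecMulVec_apply]
  rw [e, natEntropy_mul_comm]
  refine (natEntropy_le_diag (Matrix.posSemidef_conjTranspose_mul_self Ψ)).trans (le_of_eq ?_)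
  refine Finset.sum_congr rfl fun k _ => ?_
  congr 1
  simp only [Matrix.mul_apply, Matrix.conjTranspose_apply, hΨ, Matrix.of_apply, normSq,
    Complex.re_sum]
  refine Finset.sum_congr rfl fun i _ => ?_
  rw [RCLike.star_def, ← Complex.normSq_eq_conj_mul_self, Complex.ofReal_re,
    Complex.normSq_eq_norm_sq]

theorem conj_diagonal_eq_sum (U : Matrix n m ℂ) (μ : m → ℝ) :
    U * Matrix.diagonal (fun i => (μ i : ℂ)) * U.conjTranspose =
      ∑ k, (μ k : ℂ) • Matrix.vecMulVec (fun i => U i k) (star fun i => U i k) := by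
  ext i j
  rw [Matrix.mul_apply, Matrix.sum_apply]
  refine Finset.sum_congr rfl fun k _ => ?_
  rw [Matrix.mul_diagonal, Matrix.conjTranspose_apply, Matrix.smul_apply, Matrix.vecMulVec_apply,
    Pi.star_apply, smul_eq_mul]
  ring

/-- The entropy is concave: compare the diagonals in an eigenbasis of the mixture. -/
theorem natEntropy_concave {ρ σ : Matrix n n ℂ} (hρ : ρ.PosSemidef) (hσ : σ.PosSemidef) {p q : ℝ}
    (hp : 0 ≤ p) (hq : 0 ≤ q) (hpq : p + q = 1) :
    p * natEntropy ρ + q * natEntropy σ ≤ natEntropy ((p : ℂ) • ρ + (q : ℂ) • σ) := by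
  have hω : ((p : ℂ) • ρ + (q : ℂ) • σ).PosSemidef :=
    (hρ.smul (by exact_mod_cast hp)).add (hσ.smul (by exact_mod_cast hq))
  obtain ⟨U, μ, h1, h2, h3, hμ, hS, -⟩ := exists_spectral_of_posSemidef hω
  have hconj : ∀ {τ : Matrix n n ℂ}, τ.PosSemidef →
      natEntropy τ ≤ ∑ i, Real.negMulLog ((U.conjTranspose * τ * U) i i).re := by
    intro τ hτ
    have h4 := natEntropy_le_diag (hτ.conjTranspose_mul_mul_same U)
    have h5 := natEntropy_conj (U := U.conjTranspose) (by rwa [Matrix.conjTranspose_conjTranspose]) τ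
    rw [Matrix.conjTranspose_conjTranspose] at h5
    rwa [h5] at h4
  have hdiag : ∀ i, μ i = p * ((U.conjTranspose * ρ * U) i i).re +
      q * ((U.conjTranspose * σ * U) i i).re := by
    intro i
    have e : U.conjTranspose * ((p : ℂ) • ρ + (q : ℂ) • σ) * U =
        Matrix.diagonal (fun i => (μ i : ℂ)) := by
      calc _ = (U.conjTranspose * U) * Matrix.diagonal (fun i => (μ i : ℂ)) *
          (U.conjTranspose * U) := by rw [h3]; simp only [Matrix.mul_assoc]
        _ = _ := by rw [h1, Matrix.one_mul, Matrix.mul_one]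
    have h4 := congrArg Complex.re (congrFun (congrFun e i) i)
    rw [Matrix.diagonal_apply_eq, Complex.ofReal_re, Matrix.mul_add, Matrix.add_mul,
      Matrix.mul_smul, Matrix.smul_mul, Matrix.mul_smul, Matrix.smul_mul, Matrix.add_apply,
      Matrix.smul_apply, Matrix.smul_apply, smul_eq_mul, smul_eq_mul, Complex.add_re,
      Complex.re_ofReal_mul, Complex.re_ofReal_mul] at h4
    exact h4.symm
  have hnn : ∀ {τ : Matrix n n ℂ}, τ.PosSemidef → ∀ i, 0 ≤ ((U.conjTranspose * τ * U) i i).re := by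
    intro τ hτ i
    exact (Complex.le_def.1 ((hτ.conjTranspose_mul_mul_same U).diag_nonneg (i := i))).1
  calc p * natEntropy ρ + q * natEntropy σ
      ≤ p * (∑ i, Real.negMulLog ((U.conjTranspose * ρ * U) i i).re) +
        q * ∑ i, Real.negMulLog ((U.conjTranspose * σ * U) i i).re :=
        add_le_add (mul_le_mul_of_nonneg_left (hconj hρ) hp)
          (mul_le_mul_of_nonneg_left (hconj hσ) hq)
    _ = ∑ i, (p * Real.negMulLog ((U.conjTranspose * ρ * U) i i).re +
        q * Real.negMulLog ((U.conjTranspose * σ * U) i i).re) := by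
        rw [Finset.mul_sum, Finset.mul_sum, ← Finset.sum_add_distrib]
    _ ≤ ∑ i, Real.negMulLog (μ i) := by
        refine Finset.sum_le_sum fun i _ => ?_
        rw [hdiag i]
        exact Real.concaveOn_negMulLog.2 (hnn hρ i) (hnn hσ i) hp hq hpq
    _ = _ := hS.symm

theorem smul_vecMulVec_star {μ : ℝ} (hμ : 0 ≤ μ) (v : n → ℂ) :
    (μ : ℂ) • Matrix.vecMulVec v (star v) =
      Matrix.vecMulVec ((Real.sqrt μ : ℂ) • v) (star ((Real.sqrt μ : ℂ) • v)) := by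
  ext i j
  have h : ((Real.sqrt μ : ℂ)) * (Real.sqrt μ : ℂ) = (μ : ℂ) := by
    rw [← Complex.ofReal_mul, Real.mul_self_sqrt hμ]
  simp only [Matrix.smul_apply, Matrix.vecMulVec_apply, Pi.smul_apply, Pi.star_apply, smul_eq_mul,
    star_mul', RCLike.star_def, Complex.conj_ofReal]
  rw [← h]; ring

theorem normSq_smul_sqrt {μ : ℝ} (hμ : 0 ≤ μ) (v : n → ℂ) :
    normSq ((Real.sqrt μ : ℂ) • v) = μ * normSq v := by
  simp only [normSq, Pi.smul_apply, smul_eq_mul, norm_mul, mul_pow, ← Finset.mul_sum,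
    Complex.norm_real, Real.norm_eq_abs, sq_abs, Real.sq_sqrt hμ]

/-- The entropy is convex up to the entropy of mixing. -/
theorem natEntropy_mix_le {ρ σ : Matrix n n ℂ} (hρ : IsState ρ) (hσ : IsState σ) {p q : ℝ}
    (hp : 0 ≤ p) (hq : 0 ≤ q) :
    natEntropy ((p : ℂ) • ρ + (q : ℂ) • σ) ≤ p * natEntropy ρ + q * natEntropy σ +
      (Real.negMulLog p + Real.negMulLog q) := by
  obtain ⟨U, μ, h1, h2, h3, hμ, hS, htr⟩ := exists_spectral_of_posSemidef hρ.1
  obtain ⟨V, w, g1, g2, g3, hw, hS', htr'⟩ := exists_spectral_of_posSemidef hσ.1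
  have hμ1 : ∑ i, μ i = 1 := by rw [hρ.2] at htr; exact_mod_cast htr.symm
  have hw1 : ∑ i, w i = 1 := by rw [hσ.2] at htr'; exact_mod_cast htr'.symm
  have hunit : ∀ {W : Matrix n n ℂ}, W.conjTranspose * W = 1 → ∀ k, normSq (fun i => W i k) = 1 := by
    intro W hW k
    have h := congrFun (congrFun hW k) k
    rw [Matrix.mul_apply, Matrix.one_apply_eq] at h
    have h' : ((normSq (fun i => W i k) : ℝ) : ℂ) = 1 := by
      rw [← h, normSq]; push_cast
      refine Finset.sum_congr rfl fun i _ => ?_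
      rw [Matrix.conjTranspose_apply, RCLike.star_def, Complex.conj_mul']
    exact_mod_cast h'
  have e : (p : ℂ) • ρ + (q : ℂ) • σ = ∑ k : n ⊕ n, Matrix.vecMulVec
      (Sum.elim (fun k => (Real.sqrt (p * μ k) : ℂ) • fun i => U i k)
        (fun k => (Real.sqrt (q * w k) : ℂ) • fun i => V i k) k)
      (star (Sum.elim (fun k => (Real.sqrt (p * μ k) : ℂ) • fun i => U i k)
        (fun k => (Real.sqrt (q * w k) : ℂ) • fun i => V i k) k)) := by
    rw [Fintype.sum_sum_type]
    simp only [Sum.elim_inl, Sum.elim_inr, ← smul_vecMulVec_star (mul_nonneg hp (hμ _)),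
      ← smul_vecMulVec_star (mul_nonneg hq (hw _))]
    conv_lhs => rw [h3, g3]
    rw [conj_diagonal_eq_sum, conj_diagonal_eq_sum, Finset.smul_sum, Finset.smul_sum]
    simp only [smul_smul, Complex.ofReal_mul]
  rw [e]
  refine (natEntropy_sum_vecMulVec_le _).trans (le_of_eq ?_)
  rw [Fintype.sum_sum_type]
  simp only [Sum.elim_inl, Sum.elim_inr, normSq_smul_sqrt (mul_nonneg hp (hμ _)),
    normSq_smul_sqrt (mul_nonneg hq (hw _)), hunit h1, hunit g1, mul_one, Real.negMulLog_mul,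
    Finset.sum_add_distrib, ← Finset.sum_mul, ← Finset.mul_sum, hμ1, hw1, ← hS, ← hS', one_mul]
  ring

end Entropy

/-! ### Continuity of the conditional entropy -/

section ConditionalEntropy

open scoped Kronecker

variable {m k : Type} [Fintype m] [DecidableEq m] [Fintype k] [DecidableEq k]

/-- The partial trace over the first tensor factor. -/
def partialTrace : Matrix (m × k) (m × k) ℂ →ₗ[ℂ] Matrix k k ℂ where
  toFun ρ := ∑ a : m, ρ.submatrix (fun b => (a, b)) fun b => (a, b)
  map_add' ρ σ := by
    rw [← Finset.sum_add_distrib]; rfl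
  map_smul' c ρ := by
    rw [RingHom.id_apply, Finset.smul_sum]; rfl

theorem partialTrace_apply (ρ : Matrix (m × k) (m × k) ℂ) (b b' : k) :
    partialTrace ρ b b' = ∑ a, ρ (a, b) (a, b') := by
  change (∑ a : m, ρ.submatrix (fun b => (a, b)) fun b => (a, b)) b b' = _
  rw [Matrix.sum_apply]; rfl

theorem partialTrace_isState {ρ : Matrix (m × k) (m × k) ℂ} (hρ : IsState ρ) :
    IsState (partialTrace ρ) := by
  refine ⟨Matrix.posSemidef_sum _ fun a _ => hρ.1.submatrix _, ?_⟩
  rw [← hρ.2, Matrix.trace, Matrix.trace, Fintype.sum_prod_type_right]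
  exact Finset.sum_congr rfl fun b _ => partialTrace_apply ρ b b

theorem partialTrace_vecMulVec (ψ : m × k → ℂ) :
    partialTrace (Matrix.vecMulVec ψ (star ψ)) =
      ∑ a, Matrix.vecMulVec (fun b => ψ (a, b)) (star fun b => ψ (a, b)) := by
  ext b b'
  rw [partialTrace_apply, Matrix.sum_apply]; rfl

theorem sum_negMulLog_le {q : m → ℝ} (hq : ∀ a, 0 ≤ q a) :
    ∑ a, Real.negMulLog (q a) ≤
      Real.negMulLog (∑ a, q a) + (∑ a, q a) * Real.log (Fintype.card m) := by
  rcases isEmpty_or_nonempty m with h | h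
  · simp
  have hd : (0 : ℝ) < Fintype.card m := by exact_mod_cast Fintype.card_pos
  have h1 := Real.concaveOn_negMulLog.le_map_sum (t := Finset.univ)
    (w := fun _ : m => (Fintype.card m : ℝ)⁻¹) (p := q) (fun _ _ => by positivity)
    (by simp [hd.ne']) (fun a _ => hq a)
  simp only [smul_eq_mul, ← Finset.mul_sum] at h1
  rw [Real.negMulLog_mul, inv_mul_le_iff₀ hd] at h1
  refine h1.trans (le_of_eq ?_)
  rw [Real.negMulLog, Real.log_inv]
  field_simp
  ring

theorem natEntropy_le_log_card {ρ : Matrix m m ℂ} (hρ : IsState ρ) :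
    natEntropy ρ ≤ Real.log (Fintype.card m) := by
  have h1 : ∑ a, (ρ a a).re = 1 := by
    have := congrArg Complex.re hρ.2
    rwa [Matrix.trace, Complex.re_sum, Complex.one_re] at this
  have h2 := (natEntropy_le_diag hρ.1).trans
    (sum_negMulLog_le fun a => (Complex.le_def.1 (hρ.1.diag_nonneg (i := a))).1)
  rwa [h1, Real.negMulLog_one, zero_add, one_mul] at h2

/-- The conditional entropy is at most `log d`: compare with the diagonal in a product basis which
diagonalizes the reduced state. -/
theorem natEntropy_le_partialTrace_add {ρ : Matrix (m × k) (m × k) ℂ} (hρ : IsState ρ) :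
    natEntropy ρ ≤ natEntropy (partialTrace ρ) + Real.log (Fintype.card m) := by
  obtain ⟨U, μ, h1, h2, h3, hμ, hS, htr⟩ :=
    exists_spectral_of_posSemidef (partialTrace_isState hρ).1
  rw [(partialTrace_isState hρ).2] at htr
  have hμ1 : ∑ i, μ i = 1 := by exact_mod_cast htr.symm
  obtain ⟨W, hW⟩ : ∃ W : Matrix (m × k) (m × k) ℂ, W = (1 : Matrix m m ℂ) ⊗ₖ U := ⟨_, rfl⟩
  have hWW : W * W.conjTranspose = 1 := by
    rw [hW, Matrix.conjTranspose_kronecker, ← Matrix.mul_kronecker_mul, h2,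
      Matrix.conjTranspose_one, Matrix.one_mul, Matrix.one_kronecker_one]
  have hconj := natEntropy_conj (U := W.conjTranspose)
    (by rwa [Matrix.conjTranspose_conjTranspose]) ρ
  rw [Matrix.conjTranspose_conjTranspose] at hconj
  have hpsd := hρ.1.conjTranspose_mul_mul_same W
  obtain ⟨τ, hτ⟩ : ∃ τ, τ = W.conjTranspose * ρ * W := ⟨_, rfl⟩
  rw [← hτ] at hconj hpsd
  have hpt : ∀ j, ∑ a, (τ (a, j) (a, j)).re = μ j := by
    intro j
    have e : partialTrace τ = U.conjTranspose * partialTrace ρ * U := by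
      ext b b'
      simp only [partialTrace_apply, hτ, Matrix.mul_apply, Matrix.conjTranspose_apply, hW,
        Matrix.kroneckerMap_apply, Fintype.sum_prod_type, Matrix.one_apply, ite_mul, mul_ite,
        one_mul, zero_mul, mul_zero, apply_ite star, star_zero, Finset.sum_mul, Finset.mul_sum,
        Finset.sum_ite_eq', Finset.mem_univ, if_true, Finset.sum_const_zero,
        Finset.sum_ite_irrel]
      rw [Finset.sum_comm]
      refine Finset.sum_congr rfl fun i _ => ?_
      rw [Finset.sum_comm]
    have e2 : U.conjTranspose * partialTrace ρ * U = Matrix.diagonal fun i => (μ i : ℂ) := by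
      calc _ = (U.conjTranspose * U) * Matrix.diagonal (fun i => (μ i : ℂ)) *
          (U.conjTranspose * U) := by rw [h3]; simp only [Matrix.mul_assoc]
        _ = _ := by rw [h1, Matrix.one_mul, Matrix.mul_one]
    have e3 := congrArg Complex.re (congrFun (congrFun (e.trans e2) j) j)
    rwa [partialTrace_apply, Matrix.diagonal_apply_eq, Complex.ofReal_re, Complex.re_sum] at e3
  calc natEntropy ρ ≤ ∑ p, Real.negMulLog (τ p p).re := hconj ▸ natEntropy_le_diag hpsd
    _ = ∑ j, ∑ a, Real.negMulLog (τ (a, j) (a, j)).re := Fintype.sum_prod_type_right _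
    _ ≤ ∑ j, (Real.negMulLog (μ j) + μ j * Real.log (Fintype.card m)) := by
        refine Finset.sum_le_sum fun j _ => ?_
        have h4 := sum_negMulLog_le (q := fun a => (τ (a, j) (a, j)).re) fun a =>
          (Complex.le_def.1 (hpsd.diag_nonneg (i := (a, j)))).1
        simp only [hpt] at h4
        exact h4
    _ = _ := by rw [Finset.sum_add_distrib, ← Finset.sum_mul, hμ1, one_mul, hS]

/-- The conditional entropy is at least `-log d`: the reduced state of a pure state is an ensemble
of `d` pure states. -/
theorem partialTrace_natEntropy_le_add {ρ : Matrix (m × k) (m × k) ℂ} (hρ : IsState ρ) :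
    natEntropy (partialTrace ρ) ≤ natEntropy ρ + Real.log (Fintype.card m) := by
  obtain ⟨U, μ, h1, h2, h3, hμ, hS, htr⟩ := exists_spectral_of_posSemidef hρ.1
  rw [hρ.2] at htr
  have hμ1 : ∑ i, μ i = 1 := by exact_mod_cast htr.symm
  obtain ⟨ψ, hψ⟩ : ∃ ψ : m × k → m × k → ℂ,
      ψ = fun p => (Real.sqrt (μ p) : ℂ) • fun i => U i p := ⟨_, rfl⟩
  have e : ρ = ∑ p, Matrix.vecMulVec (ψ p) (star (ψ p)) := by
    rw [h3, conj_diagonal_eq_sum, hψ]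
    exact Finset.sum_congr rfl fun p _ => smul_vecMulVec_star (hμ p) _
  have hn : ∀ p, normSq (ψ p) = μ p := by
    intro p
    rw [hψ, normSq_smul_sqrt (hμ p)]
    have h := congrFun (congrFun h1 p) p
    rw [Matrix.mul_apply, Matrix.one_apply_eq] at h
    have h' : ((normSq (fun i => U i p) : ℝ) : ℂ) = 1 := by
      rw [← h, normSq]; push_cast
      refine Finset.sum_congr rfl fun i _ => ?_
      rw [Matrix.conjTranspose_apply, RCLike.star_def, Complex.conj_mul']
    rw [Complex.ofReal_eq_one.1 h', mul_one]
  have e2 : partialTrace ρ = ∑ q : (m × k) × m, Matrix.vecMulVec (fun b => ψ q.1 (q.2, b))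
      (star fun b => ψ q.1 (q.2, b)) := by
    rw [Fintype.sum_prod_type]
    conv_lhs => rw [e, map_sum]
    exact Finset.sum_congr rfl fun p _ => partialTrace_vecMulVec _
  calc natEntropy (partialTrace ρ)
      ≤ ∑ q : (m × k) × m, Real.negMulLog (normSq fun b => ψ q.1 (q.2, b)) := by
        rw [e2]; exact natEntropy_sum_vecMulVec_le fun q : (m × k) × m => fun b => ψ q.1 (q.2, b)
    _ = ∑ p, ∑ a, Real.negMulLog (normSq fun b => ψ p (a, b)) := Fintype.sum_prod_type _
    _ ≤ ∑ p, (Real.negMulLog (μ p) + μ p * Real.log (Fintype.card m)) := by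
        refine Finset.sum_le_sum fun p _ => ?_
        have h4 := sum_negMulLog_le (q := fun a => normSq fun b => ψ p (a, b))
          fun a => normSq_nonneg _
        rwa [← normSq_prod, hn] at h4
    _ = _ := by rw [Finset.sum_add_distrib, ← Finset.sum_mul, hμ1, one_mul, hS]

theorem natEntropy_kronecker {α : Matrix m m ℂ} {β : Matrix k k ℂ} (hα : IsState α)
    (hβ : IsState β) : natEntropy (α ⊗ₖ β) = natEntropy α + natEntropy β := by
  obtain ⟨U, μ, h1, h2, h3, hμ, hS, htr⟩ := exists_spectral_of_posSemidef hα.1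
  obtain ⟨V, w, g1, g2, g3, hw, hS', htr'⟩ := exists_spectral_of_posSemidef hβ.1
  have hμ1 : ∑ i, μ i = 1 := by rw [hα.2] at htr; exact_mod_cast htr.symm
  have hw1 : ∑ i, w i = 1 := by rw [hβ.2] at htr'; exact_mod_cast htr'.symm
  have e : α ⊗ₖ β = (U ⊗ₖ V) * Matrix.diagonal (fun p : m × k => ((μ p.1 * w p.2 : ℝ) : ℂ)) *
      (U ⊗ₖ V).conjTranspose := by
    rw [Matrix.conjTranspose_kronecker]
    conv_lhs => rw [h3, g3]
    rw [Matrix.mul_kronecker_mul, Matrix.mul_kronecker_mul, Matrix.diagonal_kronecker_diagonal]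
    simp only [Complex.ofReal_mul]
  rw [e, natEntropy_conj, natEntropy_diagonal, Fintype.sum_prod_type]
  · simp only [Real.negMulLog_mul, Finset.sum_add_distrib, ← Finset.sum_mul, ← Finset.mul_sum, hμ1,
      hw1, ← hS, ← hS', one_mul]
  · rw [Matrix.conjTranspose_kronecker, ← Matrix.mul_kronecker_mul, h1, g1,
      Matrix.one_kronecker_one]

theorem kronecker_isState {α : Matrix m m ℂ} {β : Matrix k k ℂ} (hα : IsState α)
    (hβ : IsState β) : IsState (α ⊗ₖ β) :=
  ⟨hα.1.kronecker hβ.1, by rw [Matrix.trace_kronecker, hα.2, hβ.2, one_mul]⟩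

theorem partialTrace_kronecker {α : Matrix m m ℂ} (hα : IsState α) (β : Matrix k k ℂ) :
    partialTrace (α ⊗ₖ β) = β := by
  ext b b'
  rw [partialTrace_apply]
  simp only [Matrix.kroneckerMap_apply, ← Finset.sum_mul]
  have : ∑ a, α a a = 1 := hα.2
  rw [this, one_mul]

/-- The Jordan decomposition of a difference of states. -/
theorem exists_jordan {n : Type} [Fintype n] [DecidableEq n] {Δ : Matrix n n ℂ}
    (hΔ : Δ.IsHermitian) (htr : Δ.trace = 0) :
    ∃ P Q : Matrix n n ℂ, P.PosSemidef ∧ Q.PosSemidef ∧ Δ = P - Q ∧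
      P.trace = ((traceNorm Δ / 2 : ℝ) : ℂ) ∧ Q.trace = ((traceNorm Δ / 2 : ℝ) : ℂ) := by
  obtain ⟨U, μ, h1, h2, h3⟩ := exists_spectral hΔ
  have htrU : ∀ f : n → ℝ, (U * Matrix.diagonal (fun i => (f i : ℂ)) * U.conjTranspose).trace =
      ((∑ i, f i : ℝ) : ℂ) := by
    intro f
    rw [Matrix.trace_mul_comm, ← Matrix.mul_assoc, h1, Matrix.one_mul, Matrix.trace_diagonal]
    push_cast; rfl
  have hpsd : ∀ f : n → ℝ, (∀ i, 0 ≤ f i) →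
      (U * Matrix.diagonal (fun i => (f i : ℂ)) * U.conjTranspose).PosSemidef := by
    intro f hf
    refine Matrix.PosSemidef.mul_mul_conjTranspose_same ?_ U
    exact Matrix.PosSemidef.diagonal fun i =>
      show (0 : ℂ) ≤ (f i : ℂ) by exact_mod_cast hf i
  obtain ⟨P, hP⟩ : ∃ P, P = U * Matrix.diagonal (fun i => ((max (μ i) 0 : ℝ) : ℂ)) *
    U.conjTranspose := ⟨_, rfl⟩
  obtain ⟨Q, hQ⟩ : ∃ Q, Q = U * Matrix.diagonal (fun i => ((max (-μ i) 0 : ℝ) : ℂ)) *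
    U.conjTranspose := ⟨_, rfl⟩
  have hPQ : Δ = P - Q := by
    rw [hP, hQ, ← Matrix.sub_mul, ← Matrix.mul_sub, Matrix.diagonal_sub, h3]
    congr 3
    funext i
    rw [← Complex.ofReal_sub]
    congr 1
    rcases le_total 0 (μ i) with h | h
    · rw [max_eq_left h, max_eq_right (by linarith)]; ring
    · rw [max_eq_right h, max_eq_left (by linarith)]; ring
  have hPp : P.PosSemidef := hP ▸ hpsd _ fun i => le_max_right _ _
  have hQp : Q.PosSemidef := hQ ▸ hpsd _ fun i => le_max_right _ _
  have hPt : P.trace = ((∑ i, max (μ i) 0 : ℝ) : ℂ) := hP ▸ htrU _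
  have hQt : Q.trace = ((∑ i, max (-μ i) 0 : ℝ) : ℂ) := hQ ▸ htrU _
  have heq : ∑ i, max (μ i) 0 = ∑ i, max (-μ i) 0 := by
    rw [hPQ, Matrix.trace_sub, hPt, hQt, sub_eq_zero] at htr
    exact_mod_cast htr
  -- the trace norm is the trace of `P + Q`, attained at the sign of `Δ`
  have hT : traceNorm Δ = ∑ i, max (μ i) 0 + ∑ i, max (-μ i) 0 := by
    refine le_antisymm ?_ ?_
    · have a1 := traceNorm_posSemidef_le hPp
      have a2 := traceNorm_posSemidef_le hQp
      rw [hPt, Complex.ofReal_re] at a1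
      rw [hQt, Complex.ofReal_re] at a2
      have a3 : traceNorm (P - Q) ≤ traceNorm P + traceNorm Q := by
        have b1 := traceNorm_sub_comm 0 Q
        rw [zero_sub, sub_zero] at b1
        rw [sub_eq_add_neg, ← b1]
        exact traceNorm_add_le _ _
      rw [hPQ]
      linarith
    · have hFn : ‖U * Matrix.diagonal (fun i => ((if 0 ≤ μ i then 1 else -1 : ℝ) : ℂ)) *
          U.conjTranspose‖ ≤ 1 := by
        rcases isEmpty_or_nonempty n with hne | hne
        · rw [Subsingleton.elim (U * _ * _) 0, norm_zero]; exact zero_le_one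
        have hU : ‖U‖ ≤ 1 := by
          have h4 := Matrix.l2_opNorm_conjTranspose_mul_self U
          rw [h1, norm_one] at h4
          nlinarith [norm_nonneg U]
        have hU' : ‖U.conjTranspose‖ ≤ 1 := by rwa [Matrix.l2_opNorm_conjTranspose]
        have hD : ‖Matrix.diagonal (fun i => ((if 0 ≤ μ i then 1 else -1 : ℝ) : ℂ))‖ ≤ 1 := by
          rw [Matrix.l2_opNorm_diagonal]
          refine (pi_norm_le_iff_of_nonneg zero_le_one).2 fun i => ?_
          split_ifs <;> simp
        calc _ ≤ ‖U * Matrix.diagonal (fun i => ((if 0 ≤ μ i then 1 else -1 : ℝ) : ℂ))‖ *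
              ‖U.conjTranspose‖ := norm_mul_le _ _
          _ ≤ (‖U‖ * ‖Matrix.diagonal (fun i => ((if 0 ≤ μ i then 1 else -1 : ℝ) : ℂ))‖) *
              ‖U.conjTranspose‖ := mul_le_mul_of_nonneg_right (norm_mul_le _ _) (norm_nonneg _)
          _ ≤ 1 * 1 := mul_le_mul (mul_le_one₀ hU (norm_nonneg _) hD) hU' (norm_nonneg _) zero_le_one
          _ = 1 := one_mul 1
      have hF := norm_trace_mul_le (U * Matrix.diagonal
        (fun i => ((if 0 ≤ μ i then 1 else -1 : ℝ) : ℂ)) * U.conjTranspose) Δ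
      have e : (U * Matrix.diagonal (fun i => ((if 0 ≤ μ i then 1 else -1 : ℝ) : ℂ)) *
          U.conjTranspose) * Δ = U * Matrix.diagonal
          (fun i => ((max (μ i) 0 + max (-μ i) 0 : ℝ) : ℂ)) * U.conjTranspose := by
        calc _ = U * (Matrix.diagonal (fun i => ((if 0 ≤ μ i then 1 else -1 : ℝ) : ℂ)) *
            (U.conjTranspose * U) * Matrix.diagonal (fun i => (μ i : ℂ))) * U.conjTranspose := by
              conv_lhs => rw [h3]
              simp only [Matrix.mul_assoc]
          _ = _ := by
              rw [h1, Matrix.mul_one, Matrix.diagonal_mul_diagonal]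
              congr 3
              funext i
              rw [← Complex.ofReal_mul]
              congr 1
              split_ifs with h
              · rw [max_eq_left h, max_eq_right (by linarith)]; ring
              · rw [max_eq_right (by linarith), max_eq_left (by linarith)]; ring
      rw [e, htrU, Complex.norm_real, Finset.sum_add_distrib] at hF
      exact ((le_abs_self _).trans hF).trans
        (mul_le_of_le_one_left (traceNorm_nonneg _) hFn)
  refine ⟨P, Q, hPp, hQp, hPQ, ?_, ?_⟩
  · rw [hPt, hT, ← heq]; congr 1; ring
  · rw [hQt, hT, heq]; congr 1; ring

/-- Continuity of the conditional entropy. With the Jordan decomposition `ρ - σ = P - Q`, the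
states `ρ` and `σ` become equal when they are mixed with multiples of `Q` and `P`; and the
conditional entropy is affine up to the entropy of mixing. -/
theorem conditional_natEntropy_sub_le {ρ σ : Matrix (m × k) (m × k) ℂ} (hρ : IsState ρ)
    (hσ : IsState σ) {ε : ℝ} (hε : ε = traceNorm (ρ - σ) / 2) (hε0 : 0 < ε) :
    (natEntropy σ - natEntropy (partialTrace σ)) - (natEntropy ρ - natEntropy (partialTrace ρ)) ≤
      2 * ε * Real.log (Fintype.card m) +
        2 * ((1 + ε) * Real.log (1 + ε) - ε * Real.log ε) := by
  obtain ⟨P, Q, hP, hQ, hPQ, hPt, hQt⟩ := exists_jordan (Δ := ρ - σ) (hρ.1.1.sub hσ.1.1)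
    (by rw [Matrix.trace_sub, hρ.2, hσ.2, sub_self])
  rw [← hε] at hPt hQt
  have hεc : (ε : ℂ) ≠ 0 := by exact_mod_cast hε0.ne'
  have hnorm : ∀ {X : Matrix (m × k) (m × k) ℂ}, X.PosSemidef → X.trace = (ε : ℂ) →
      IsState (((ε⁻¹ : ℝ) : ℂ) • X) := by
    intro X hX hXt
    refine ⟨hX.smul (by exact_mod_cast (inv_pos.2 hε0).le), ?_⟩
    rw [Matrix.trace_smul, hXt, smul_eq_mul, Complex.ofReal_inv, inv_mul_cancel₀ hεc]
  have sP := hnorm hP hPt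
  have sQ := hnorm hQ hQt
  obtain ⟨P', hP'⟩ : ∃ P', P' = ((ε⁻¹ : ℝ) : ℂ) • P := ⟨_, rfl⟩
  obtain ⟨Q', hQ'⟩ : ∃ Q', Q' = ((ε⁻¹ : ℝ) : ℂ) • Q := ⟨_, rfl⟩
  rw [← hP'] at sP
  rw [← hQ'] at sQ
  obtain ⟨p, hp⟩ : ∃ p, p = (1 + ε)⁻¹ := ⟨_, rfl⟩
  obtain ⟨q, hq⟩ : ∃ q, q = ε * (1 + ε)⁻¹ := ⟨_, rfl⟩
  have hp0 : 0 ≤ p := by rw [hp]; positivity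
  have hq0 : 0 ≤ q := by rw [hq]; positivity
  have h1ε : (1 + ε) ≠ 0 := by positivity
  have hpq : p + q = 1 := by rw [hp, hq]; field_simp
  -- the common mixture of `σ` with `P` and of `ρ` with `Q`
  have hω : (p : ℂ) • σ + (q : ℂ) • P' = (p : ℂ) • ρ + (q : ℂ) • Q' := by
    have e1 : (q : ℂ) * ((ε⁻¹ : ℝ) : ℂ) = (p : ℂ) := by
      rw [← Complex.ofReal_mul]
      congr 1
      rw [hq, hp]; field_simp
    rw [hP', hQ', smul_smul, smul_smul, e1, ← smul_add, ← smul_add]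
    congr 1
    rw [eq_sub_iff_add_eq, sub_add_eq_add_sub, sub_eq_iff_eq_add] at hPQ
    rw [hPQ, add_comm]
  have ptm : ∀ X Y : Matrix (m × k) (m × k) ℂ, partialTrace ((p : ℂ) • X + (q : ℂ) • Y) =
      (p : ℂ) • partialTrace X + (q : ℂ) • partialTrace Y := by
    intro X Y; rw [map_add, map_smul, map_smul]
  have a1 := natEntropy_concave hσ.1 sP.1 hp0 hq0 hpq
  have a2 := natEntropy_mix_le (partialTrace_isState hσ) (partialTrace_isState sP) hp0 hq0
  have a3 := natEntropy_mix_le hρ sQ hp0 hq0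
  have a4 := natEntropy_concave (partialTrace_isState hρ).1 (partialTrace_isState sQ).1 hp0 hq0 hpq
  rw [← ptm, hω] at a2
  rw [← ptm] at a4
  rw [hω] at a1
  have b1 := natEntropy_le_partialTrace_add sQ
  have b2 := partialTrace_natEntropy_le_add sP
  have c1 : Real.negMulLog p + Real.negMulLog q =
      p * ((1 + ε) * Real.log (1 + ε) - ε * Real.log ε) := by
    have e1 : Real.negMulLog p = p * Real.log (1 + ε) := by
      rw [Real.negMulLog, hp, Real.log_inv]; ring
    have e2 : Real.negMulLog q = p * (ε * (Real.log (1 + ε) - Real.log ε)) := by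
      rw [Real.negMulLog, hq, Real.log_mul hε0.ne' (inv_ne_zero h1ε), Real.log_inv, hp]; ring
    rw [e1, e2]; ring
  have hqp : q = p * ε := by rw [hq, hp]; ring
  have hp1 : 0 < p := by rw [hp]; positivity
  have b3 : q * ((natEntropy Q' - natEntropy (partialTrace Q')) -
      (natEntropy P' - natEntropy (partialTrace P'))) ≤ q * (2 * Real.log (Fintype.card m)) :=
    mul_le_mul_of_nonneg_left (by linarith) hq0
  refine le_of_mul_le_mul_left ?_ hp1
  have c2 : p * (2 * ε * Real.log (Fintype.card m) +
        2 * ((1 + ε) * Real.log (1 + ε) - ε * Real.log ε)) =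
      q * (2 * Real.log (Fintype.card m)) + 2 * (Real.negMulLog p + Real.negMulLog q) := by
    rw [c1, hqp]; ring
  rw [c2]
  linarith

theorem eq_of_traceNorm_sub_eq_zero {n : Type} [Fintype n] [DecidableEq n] {X Y : Matrix n n ℂ}
    (h : traceNorm (X - Y) = 0) : X = Y := by
  refine Matrix.ext_iff_trace_mul_left.2 fun F => ?_
  have := norm_trace_mul_sub_le F X Y
  rw [h, mul_zero] at this
  exact sub_eq_zero.1 (norm_le_zero_iff.1 this)

end ConditionalEntropy

/-! ### Bounds on the mutual information -/

section MutualInformation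

open scoped Kronecker

variable {D : ℕ} {d : Site D → ℕ} {A B Λ : Finset (Site D)}

theorem lift_eq_tensor (hd : Disjoint A B) (F : Op d B) :
    lift (Finset.subset_union_right (s₁ := A)) F = tensor 1 F := by
  classical
  ext σ τ
  have hiff : restrict (Finset.subset_union_left (s₂ := B)) σ = restrict Finset.subset_union_left τ ↔
      ∀ x : (A ∪ B : Finset (Site D)), x.1 ∉ B → σ x = τ x := by
    rw [restrict_eq_iff]
    refine forall_congr' fun x => ?_
    have h1 := Finset.mem_union.1 x.2
    have h2 : x.1 ∈ A → x.1 ∉ B := fun h => Finset.disjoint_left.1 hd h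
    exact ⟨fun h hx => h (h1.resolve_right hx), fun h hx => h (h2 hx)⟩
  rw [lift_apply, tensor, Matrix.of_apply, Matrix.one_apply]
  by_cases h : restrict (Finset.subset_union_left (s₂ := B)) σ = restrict Finset.subset_union_left τ
  · rw [if_pos (hiff.1 h), if_pos h, one_mul]
  · rw [if_neg fun h' => h (hiff.2 h'), if_neg h, zero_mul]

theorem tensor_eq_kronecker (hd : Disjoint A B) (α : Op d A) (β : Op d B) :
    tensor α β = (α ⊗ₖ β).submatrix (unionEquiv d hd) (unionEquiv d hd) :=
  tensor_eq_submatrix hd α β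

theorem partialTrace_reduce (hA : A ⊆ Λ) (hB : B ⊆ Λ) (hd : Disjoint A B) (ρ : Op d Λ) :
    partialTrace ((reduce (A ∪ B) ρ).submatrix (unionEquiv d hd).symm (unionEquiv d hd).symm) =
      reduce B ρ := by
  refine Matrix.ext_iff_trace_mul_left.2 fun F => ?_
  rw [← reduce_reduce (Finset.subset_union_right (s₁ := A)) (Finset.union_subset hA hB) ρ,
    ← trace_lift_mul Finset.subset_union_right, lift_eq_tensor hd, tensor_eq_kronecker hd,
    trace_submatrix_mul]
  generalize (reduce (A ∪ B) ρ).submatrix (unionEquiv d hd).symm (unionEquiv d hd).symm = τ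
  simp only [Matrix.trace, Matrix.diag_apply, Matrix.mul_apply, partialTrace_apply,
    Fintype.sum_prod_type, Matrix.kroneckerMap_apply, Matrix.one_apply, ite_mul, one_mul, zero_mul,
    Finset.mul_sum, Finset.sum_ite_irrel, Finset.sum_const_zero, Finset.sum_ite_eq,
    Finset.mem_univ, if_true]
  conv_rhs => rw [Finset.sum_comm]
  refine Finset.sum_congr rfl fun b _ => ?_
  exact Finset.sum_comm

/-- The mutual information in nats, bounded by the trace distance correlation: it is the difference
of the conditional entropies of `ρ_A ⊗ ρ_B` and of `ρ_AB`. -/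
theorem mutualInformation_mul_log_le {ρ : Op d Λ} (hρ : IsState ρ) (hA : A ⊆ Λ) (hB : B ⊆ Λ)
    (hd : Disjoint A B) :
    mutualInformation A B ρ * Real.log 2 ≤ 2 * Real.log (Fintype.card (Conf d A)) ∧
    (traceCorrelation A B ρ = 0 → mutualInformation A B ρ = 0) ∧
    ∀ ε : ℝ, ε = traceCorrelation A B ρ / 2 → 0 < ε → mutualInformation A B ρ * Real.log 2 ≤
      2 * ε * Real.log (Fintype.card (Conf d A)) +
        2 * ((1 + ε) * Real.log (1 + ε) - ε * Real.log ε) := by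
  have hAB := Finset.union_subset hA hB
  have sA := reduce_isState hA hρ
  have sB := reduce_isState hB hρ
  have sAB := reduce_isState hAB hρ
  obtain ⟨e, he⟩ : ∃ e, e = unionEquiv d hd := ⟨_, rfl⟩
  obtain ⟨τ, hτ⟩ : ∃ τ, τ = (reduce (A ∪ B) ρ).submatrix e.symm e.symm := ⟨_, rfl⟩
  have hτ' : reduce (A ∪ B) ρ = τ.submatrix e e := by
    rw [hτ, Matrix.submatrix_submatrix]
    simp
  have hpt : partialTrace τ = reduce B ρ := by
    rw [hτ, he]; exact partialTrace_reduce hA hB hd ρ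
  have sτ : IsState τ := by
    refine ⟨hτ ▸ sAB.1.submatrix _, ?_⟩
    rw [← sAB.2, hτ]
    exact Fintype.sum_equiv e.symm _ _ fun _ => rfl
  have hT : traceCorrelation A B ρ = traceNorm (τ - reduce A ρ ⊗ₖ reduce B ρ) := by
    rw [traceCorrelation, tensor_eq_kronecker hd, hτ', ← he]
    exact traceNorm_submatrix_equiv (τ - reduce A ρ ⊗ₖ reduce B ρ) e
  have hlog : Real.log 2 ≠ 0 := (Real.log_pos one_lt_two).ne'
  have hI : mutualInformation A B ρ * Real.log 2 =
      natEntropy (reduce A ρ) + natEntropy (reduce B ρ) - natEntropy τ := by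
    rw [mutualInformation, entropy_eq_natEntropy_div sA.1.1, entropy_eq_natEntropy_div sB.1.1,
      entropy_eq_natEntropy_div sAB.1.1, hτ', natEntropy_submatrix_equiv]
    field_simp
  have hk := natEntropy_kronecker sA sB
  refine ⟨?_, fun h0 => ?_, fun ε hε hε0 => ?_⟩
  · have h1 := natEntropy_le_log_card sA
    have h2 := partialTrace_natEntropy_le_add sτ
    rw [hpt] at h2
    rw [hI]
    linarith
  · rw [hT] at h0
    rw [eq_of_traceNorm_sub_eq_zero h0, hk, sub_self] at hI
    exact (mul_eq_zero.1 hI).resolve_right hlog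
  · rw [hT] at hε
    have h := conditional_natEntropy_sub_le sτ (kronecker_isState sA sB) hε hε0
    rw [partialTrace_kronecker sA, hpt, hk] at h
    rw [hI]
    linarith

theorem traceCorrelation_nonneg (ρ : Op d Λ) : 0 ≤ traceCorrelation A B ρ := traceNorm_nonneg _

theorem binaryEntropy_mul_log (x : ℝ) : binaryEntropy x * Real.log 2 = Real.binEntropy x := by
  have hlog : Real.log 2 ≠ 0 := (Real.log_pos one_lt_two).ne'
  rw [binaryEntropy, Real.binEntropy_eq_negMulLog_add_negMulLog_one_sub, Real.negMulLog,
    Real.negMulLog, Real.logb, Real.logb]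
  field_simp
  ring

/-- The bound on the mutual information in terms of the binary entropy. The remainder from
`(1 + ε) log (1 + ε)` is linear in the correlation, so it is absorbed by the term with the dimension
of `A` if that dimension is at least two; for dimension one the mutual information vanishes. -/
theorem mutualInformation_le {ρ : Op d Λ} (hρ : IsState ρ) (hA : A ⊆ Λ) (hB : B ⊆ Λ)
    (hd : Disjoint A B) (hT : traceCorrelation A B ρ < 1) :
    mutualInformation A B ρ ≤ 6 * traceCorrelation A B ρ *
      Real.logb 2 (Fintype.card (Conf d A)) + 4 * binaryEntropy (traceCorrelation A B ρ) := by
  obtain ⟨h1, h2, h3⟩ := mutualInformation_mul_log_le hρ hA hB hd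
  have hT0 : 0 ≤ traceCorrelation A B ρ := traceCorrelation_nonneg ρ
  have hlog : 0 < Real.log 2 := Real.log_pos one_lt_two
  refine le_of_mul_le_mul_right ?_ hlog
  have e : (6 * traceCorrelation A B ρ * Real.logb 2 (Fintype.card (Conf d A)) +
      4 * binaryEntropy (traceCorrelation A B ρ)) * Real.log 2 =
      6 * traceCorrelation A B ρ * Real.log (Fintype.card (Conf d A)) +
        4 * Real.binEntropy (traceCorrelation A B ρ) := by
    rw [add_mul, mul_assoc 4, binaryEntropy_mul_log, mul_assoc _ (Real.logb 2 _), Real.logb,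
      div_mul_cancel₀ _ hlog.ne']
  rw [e]
  generalize mutualInformation A B ρ = I at *
  generalize traceCorrelation A B ρ = T at *
  have hh := Real.binEntropy_eq_negMulLog_add_negMulLog_one_sub T
  have hn1 := Real.negMulLog_nonneg hT0 hT.le
  have hn2 := Real.negMulLog_nonneg (sub_nonneg.2 hT.le) (by linarith : 1 - T ≤ 1)
  have hne : 0 < Fintype.card (Conf d A) := by
    have : Nonempty (Conf d A) := by
      by_contra hne
      rw [not_nonempty_iff] at hne
      have := (reduce_isState hA hρ).2
      simp [Matrix.trace] at this
    exact Fintype.card_pos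
  have hcard : Fintype.card (Conf d A) = 1 ∨ 2 ≤ Fintype.card (Conf d A) := by omega
  generalize Fintype.card (Conf d A) = c at *
  rcases hcard with rfl | hc
  · simp only [Nat.cast_one, Real.log_one, mul_zero] at h1 ⊢
    linarith
  have hc' : Real.log 2 ≤ Real.log c :=
    Real.log_le_log (by norm_num) (by exact_mod_cast hc)
  rcases hT0.eq_or_lt with h0 | h0
  · rw [h2 h0.symm, ← h0]; simp
  have h4 := h3 (T / 2) rfl (half_pos h0)
  have e1 : Real.log (T / 2) = Real.log T - Real.log 2 := Real.log_div h0.ne' two_ne_zero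
  have e2 : Real.log (1 + T / 2) ≤ T / 2 := by
    have := Real.log_le_sub_one_of_pos (by positivity : 0 < 1 + T / 2)
    linarith
  have e3 : Real.log T ≤ 0 := Real.log_nonpos hT0 hT.le
  have e4 : (1 + T / 2) * Real.log (1 + T / 2) ≤ 3 / 2 * (T / 2) := by
    have := mul_le_mul_of_nonneg_left e2 (by positivity : 0 ≤ 1 + T / 2)
    nlinarith
  have e5 : T * (-Real.log T) = Real.negMulLog T := by rw [Real.negMulLog]; ring
  have e6 := Real.log_two_gt_d9
  have e7 : T * Real.log 2 ≤ T * Real.log c := mul_le_mul_of_nonneg_left hc' hT0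
  have e8 : 0.69 * T ≤ T * Real.log 2 := by nlinarith
  rw [e1] at h4
  nlinarith

theorem mutualInformation_le_of_le {ρ : Op d Λ} (hρ : IsState ρ) (hA : A ⊆ Λ) (hB : B ⊆ Λ)
    (hd : Disjoint A B) {ε : ℝ} (hT : traceCorrelation A B ρ ≤ ε) (hε : ε ≤ 1 / 2) :
    mutualInformation A B ρ ≤ 6 * ε * Real.logb 2 (Fintype.card (Conf d A)) +
      4 * binaryEntropy ε := by
  have hT0 : 0 ≤ traceCorrelation A B ρ := traceCorrelation_nonneg ρ
  refine (mutualInformation_le hρ hA hB hd (by linarith)).trans ?_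
  have h1 : 0 ≤ Real.logb 2 (Fintype.card (Conf d A)) := by
    rcases Nat.eq_zero_or_pos (Fintype.card (Conf d A)) with h | h
    · rw [h]; simp
    · exact Real.logb_nonneg one_lt_two (by exact_mod_cast h)
  have h2 : binaryEntropy (traceCorrelation A B ρ) ≤ binaryEntropy ε := by
    refine le_of_mul_le_mul_right ?_ (Real.log_pos one_lt_two)
    rw [binaryEntropy_mul_log, binaryEntropy_mul_log]
    refine Real.binEntropy_strictMonoOn.monotoneOn ⟨hT0, ?_⟩ ⟨hT0.trans hT, ?_⟩ hT <;> linarith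
  have h3 : 6 * traceCorrelation A B ρ ≤ 6 * ε := by linarith
  have h4 := mul_le_mul_of_nonneg_right h3 h1
  linarith

end MutualInformation

end DissipativeLattice

end

open DissipativeLattice

theorem mainTheorem3 (D : ℕ) (κ v c γ δ : ℝ) (P : Polynomial ℝ)
    (hκ : 0 < κ) (hv : 0 < v) (hc : 0 < c) (hγ : 0 < γ) (hδ : 0 < δ) :
    ∃ δ' β k : ℝ, 0 < δ' ∧ 0 < β ∧ 0 ≤ k ∧
      ∀ ν : ℝ → ℝ, IsGrowthFunction ν → SufficientlyFast ν β k →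
      ∃ Δ₀ : ℝ → ℝ, IsFastDecaying ν β k Δ₀ ∧
      ∀ (d : Site D → ℕ) (F : UniformFamily d),
        F.LiebRobinsonAssumptions ν v P →
        F.RapidMixing c γ δ →
        (∀ (u : Site D) (N : ℕ), HasUniqueFixedState (F.closedEvolution u N)) →
      ∀ (u : Site D) (L : ℕ) (ρ : Op d (ball u L)), IsFixedState (F.closedEvolution u L) ρ →
      ∀ A B : Finset (Site D), A ⊆ ball u L → B ⊆ ball u L → 0 < regionDist A B →
        (∀ x ∈ A ∪ B, ∀ y, y ∉ ball u L →
          κ * ((regionDist A B : ℝ) + (L : ℝ) ^ κ) ≤ (gdist x y : ℝ)) →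
        traceCorrelation A B ρ
          ≤ 3 * ((A.card : ℝ) + (B.card : ℝ)) ^ δ' * Δ₀ ((regionDist A B : ℝ) / 2) ∧
        (traceCorrelation A B ρ < 1 →
          mutualInformation A B ρ
            ≤ 6 * traceCorrelation A B ρ * Real.logb 2 (Fintype.card (Conf d A))
              + 4 * binaryEntropy (traceCorrelation A B ρ)) ∧
        ∀ ε : ℝ,
          ε = 3 * ((A.card : ℝ) + (B.card : ℝ)) ^ δ' * Δ₀ ((regionDist A B : ℝ) / 2) →
          ε ≤ 1 / 2 →
          mutualInformation A B ρ
            ≤ 6 * ε * Real.logb 2 (Fintype.card (Conf d A)) + 4 * binaryEntropy ε := by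
  obtain ⟨β, k, hβ, hk, hmain⟩ := exists_traceCorrelation_le D P hκ hv hc hγ hδ
  refine ⟨k + 1, β, k, by positivity, hβ, hk, fun ν hν hf => ?_⟩
  obtain ⟨K, hK, hT⟩ := hmain ν hν
  refine ⟨fun s => K * majorant ν β k s, isFastDecaying_majorant hν hf hβ hk hK, ?_⟩
  intro d F hF hmix huniq u L ρ hρ A B hA hB hdist haway
  have hbound := hT d F hF hmix huniq u L ρ hρ A B hA hB hdist haway
    (majorant ν β k ((regionDist A B : ℝ) / 2)) fun r hr =>
      rate_le_majorant hν hf hβ hk (max_le hr ((by positivity : (0 : ℝ) ≤ _).trans hr))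
  have hd : Disjoint A B := by
    refine Finset.disjoint_left.2 fun x hx hx' => ?_
    have := regionDist_le hx hx'
    rw [gdist_self] at this
    omega
  refine ⟨hbound, mutualInformation_le hρ.1 hA hB hd, ?_⟩
  rintro ε rfl hε
  exact mutualInformation_le_of_le hρ.1 hA hB hd hbound hε
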